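/- **Setting.** Consider a single bosonic mode with Hilbert space $L^2(\mathbb R)$, $\hat a=(\hat q+i\hat p)/\sqrt2$, $[\hat q,\hat p]=i$, displacement operators $D(\alpha)=\exp(\alpha\hat a^\dagger-\alpha^*\hat a)$, coherent states $|\alpha\rangle=D(\alpha)|0\rangle$, and Weyl characteristic function $\chi(\xi;\rho)=\operatorname{Tr}[D(\xi_1+i\xi_2)\rho]$, $\xi\in\mathbb R^2$. A state $\rho$ is *classical* if its Sudarshan–Glauber diagonal weight is a probability distribution, i.e. $\rho=\int|\alpha\rangle\langle\alpha|\,d\mu(\alpha)$ for a probability measure $\mu$ on $\mathbb C$. A channel (completely positive trace-preserving linear map on trace-class operators) is *nonclassicality breaking* (NB) if it maps every state to a classical state. It is *Gaussian with parameters $(X,Y)$*, where $X,Y$ are real $2\times2$ matrices and $Y$ is symmetric, if $\chi(\xi;\Gamma(\rho))=\chi(X\xi;\rho)\,e^{-\xi^TY\xi/2}$ for all states $\rho$ and all $\xi$. Say that $(X,Y)$ *has the form* $(X_0,Y_0)$ if $X_0=SXR$ and $Y_0=R^TYR$ for some $S\in Sp(2,\mathbb R)$ and $R\in SO(2)$.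 Let $\sigma_3=\mathrm{diag}(1,-1)$. **Theorem.** Let $\Gamma$ be a Gaussian channel with parameters $(X,Y)$. 0. If $\det X>0$, then $(X,Y)$ has the form $(\kappa\mathbb 1,\mathrm{diag}(a,b))$ for some $\kappa>0$ and $a,b\in\mathbb R$; if $\det X<0$, it has the form $(\kappa\sigma_3,\mathrm{diag}(a,b))$ for some $\kappa>0$ and $a,b\in\mathbb R$; if $\det X=0$ and $X\ne0$, it has the form $(\mathrm{diag}(1,0),Y_0)$ for some $Y_0$; if $X=0$, it has the form $(0,\mathrm{diag}(a,b))$ for some $a,b\in\mathbb R$. 1. If $(X,Y)$ has the form $(\kappa\mathbb 1,\mathrm{diag}(a,b))$ with $\kappa>0$, then $\Gamma$ is NB if and only if $a>1$, $b>1$ and $(a-1)(b-1)\ge\kappa^4$; equivalently, if and only if $\tilde a:=a+\kappa^2-1>0$, $\tilde b:=b+\kappa^2-1>0$ and $1/\tilde a+1/\tilde b\le1/\kappa^2$. Unless $a=b=1-\kappa^2$ (the pure-loss attenuators and the identity-type channel $\kappa=1$, $a=b=0$), the single inequality $(a-1)(b-1)\ge\kappa^4$ is already necessary and sufficient for $\Gamma$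 to be NB. 2. If $(X,Y)$ has the form $(\kappa\sigma_3,\mathrm{diag}(a,b))$ with $\kappa>0$, then $\Gamma$ is NB if and only if $(a-1)(b-1)\ge\kappa^4$; equivalently, if and only if $\tilde a>0$, $\tilde b>0$ and $1/\tilde a+1/\tilde b\le1/\kappa^2$, with $\tilde a,\tilde b$ as in 1. 3. If $(X,Y)$ has the form $(\mathrm{diag}(1,0),Y_0)$, then $\Gamma$ is NB if and only if $Y_0\ge\mathbb 1$; equivalently, if and only if both eigenvalues of $Y$ are $\ge1$. If $(X,Y)$ has the form $(0,\mathrm{diag}(a,b))$, then $\Gamma$ is NB if and only if $a\ge1$ and $b\ge1$. -/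

import Mathlib

open MeasureTheory Matrix
open scoped ComplexOrder InnerProductSpace ENNReal

noncomputable section

namespace SingleMode

/-! ### The Hilbert space, displacement operators and coherent states -/

/-- The Hilbert space `L²(ℝ; ℂ)` of a single bosonic mode. -/
abbrev Mode : Type := Lp ℂ 2 (volume : Measure ℝ)

/-- The pointwise action of the Weyl displacement operator in the Schrödinger representation. With
`â = (q̂ + i p̂)/√2`, `[q̂, p̂] = i` and `α = α₁ + i α₂` one has
`D(α) = exp(α â† - α* â) = exp(i√2 (α₂ q̂ - α₁ p̂))`, that is,
`(D(α) ψ)(x) = exp(i (√2 α₂ x - α₁ α₂)) ψ(x - √2 α₁)`. -/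
def displaceFun (α : ℂ) (f : ℝ → ℂ) (x : ℝ) : ℂ :=
  Complex.exp (((√2 * α.im * x - α.re * α.im : ℝ) : ℂ) * Complex.I) * f (x - √2 * α.re)

theorem norm_displaceFun (α : ℂ) (f : ℝ → ℂ) (x : ℝ) :
    ‖displaceFun α f x‖ = ‖f (x - √2 * α.re)‖ := by
  rw [displaceFun, norm_mul, Complex.norm_exp_ofReal_mul_I, one_mul]

theorem mp_shift (α : ℂ) :
    MeasurePreserving (fun x : ℝ => x - √2 * α.re) volume volume :=
  measurePreserving_sub_right volume _

theorem aestronglyMeasurable_displaceFun (α : ℂ) {f : ℝ → ℂ}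
    (hf : AEStronglyMeasurable f volume) :
    AEStronglyMeasurable (displaceFun α f) volume := by
  have h1 : Continuous fun x : ℝ =>
      Complex.exp (((√2 * α.im * x - α.re * α.im : ℝ) : ℂ) * Complex.I) := by fun_prop
  exact h1.aestronglyMeasurable.mul (hf.comp_measurePreserving (mp_shift α))

theorem eLpNorm_displaceFun (α : ℂ) {f : ℝ → ℂ} (hf : AEStronglyMeasurable f volume) :
    eLpNorm (displaceFun α f) 2 volume = eLpNorm f 2 volume := by
  rw [← eLpNorm_comp_measurePreserving hf (mp_shift α)]
  exact eLpNorm_congr_norm_ae (Filter.Eventually.of_forall fun x => norm_displaceFun α f x)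

theorem memLp_displaceFun (α : ℂ) {f : ℝ → ℂ} (hf : MemLp f 2 volume) :
    MemLp (displaceFun α f) 2 volume :=
  ⟨aestronglyMeasurable_displaceFun α hf.1, by rw [eLpNorm_displaceFun α hf.1]; exact hf.2⟩

/-- The displacement operator `D(α)` as a linear isometry of `L²(ℝ; ℂ)`. -/
def displacementIsometry (α : ℂ) : Mode →ₗᵢ[ℂ] Mode where
  toFun ψ := (memLp_displaceFun α (Lp.memLp ψ)).toLp _
  map_add' ψ φ := by
    rw [← MemLp.toLp_add]
    refine MemLp.toLp_congr _ _ ?_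
    filter_upwards [(mp_shift α).quasiMeasurePreserving.ae_eq_comp (Lp.coeFn_add ψ φ)] with x hx
    simp only [Function.comp_apply, Pi.add_apply] at hx
    simp only [displaceFun, Pi.add_apply, hx, mul_add]
  map_smul' c ψ := by
    rw [RingHom.id_apply, ← MemLp.toLp_const_smul]
    refine MemLp.toLp_congr _ _ ?_
    filter_upwards [(mp_shift α).quasiMeasurePreserving.ae_eq_comp (Lp.coeFn_smul c ψ)] with x hx
    simp only [Function.comp_apply, Pi.smul_apply, smul_eq_mul] at hx
    simp only [displaceFun, Pi.smul_apply, smul_eq_mul, hx]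
    ring
  norm_map' ψ := by
    change ‖(memLp_displaceFun α (Lp.memLp ψ)).toLp _‖ = ‖ψ‖
    rw [Lp.norm_toLp, eLpNorm_displaceFun α (Lp.memLp ψ).1, Lp.norm_def]

/-- The displacement operator `D(α)` as a bounded operator. -/
def displacement (α : ℂ) : Mode →L[ℂ] Mode :=
  (displacementIsometry α).toContinuousLinearMap

/-- The ground state wave function `π^(-1/4) exp(-x²/2)` of the oscillator. -/
def vacuumFun (x : ℝ) : ℂ := ((Real.pi ^ (-(1 / 4) : ℝ) * Real.exp (-x ^ 2 / 2) : ℝ) : ℂ)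

theorem memLp_vacuumFun : MemLp vacuumFun 2 (volume : Measure ℝ) := by
  have hc : Continuous vacuumFun := by unfold vacuumFun; fun_prop
  rw [memLp_two_iff_integrable_sq_norm hc.aestronglyMeasurable]
  have h := (integrable_exp_neg_mul_sq (b := 1) one_pos).const_mul
    ((Real.pi ^ (-(1 / 4) : ℝ)) ^ 2)
  refine h.congr (Filter.Eventually.of_forall fun x => ?_)
  simp only [vacuumFun, Complex.norm_real, Real.norm_eq_abs, sq_abs, mul_pow, ← Real.exp_nat_mul]
  congr 2
  push_cast
  ring

/-- The vacuum state vector `|0⟩`. -/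
def vacuum : Mode := memLp_vacuumFun.toLp vacuumFun

/-- The coherent state vector `|α⟩ = D(α)|0⟩`. -/
def coherent (α : ℂ) : Mode := displacement α vacuum

/-! ### Trace, density operators, characteristic function, classicality -/

/-- The operator `T` has trace `z`: for every orthonormal (Hilbert) basis the sum of the diagonal
matrix elements converges (unconditionally) to `z`. -/
def HasTrace (T : Mode →L[ℂ] Mode) (z : ℂ) : Prop :=
  ∀ (ι : Type) (b : HilbertBasis ι ℂ Mode), HasSum (fun i => ⟪b i, T (b i)⟫_ℂ) z

open Classical in
/-- The trace of an operator (`0` if the operator has no trace). -/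
def trace (T : Mode →L[ℂ] Mode) : ℂ :=
  if h : ∃ z, HasTrace T z then h.choose else 0

/-- Density operators (states): positive operators of trace one. -/
def IsDensity (ρ : Mode →L[ℂ] Mode) : Prop := ρ.IsPositive ∧ HasTrace ρ 1

/-- The space of trace-class operators: the linear span of the density operators (every trace-class
operator is a linear combination of four positive ones). -/
def traceClass : Submodule ℂ (Mode →L[ℂ] Mode) := Submodule.span ℂ {ρ | IsDensity ρ}

/-- A density operator, regarded as a trace-class operator. -/
def IsDensity.toTraceClass {ρ : Mode →L[ℂ] Mode} (hρ : IsDensity ρ) : traceClass :=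
  ⟨ρ, Submodule.subset_span hρ⟩

/-- The symmetric-ordered (Weyl, Wigner) characteristic function `χ_W(ξ; ρ) = Tr[D(ξ) ρ]`, where
`ξ = (ξ₁, ξ₂) ∈ ℝ²` is identified with `ξ₁ + i ξ₂ ∈ ℂ`. -/
def weylChar (ρ : Mode →L[ℂ] Mode) (ξ : Fin 2 → ℝ) : ℂ :=
  trace (displacement (⟨ξ 0, ξ 1⟩ : ℂ) ∘L ρ)

/-- `ρ` is classical: its diagonal (Sudarshan–Glauber) weight is a genuine probability distribution,
`ρ = ∫ |α⟩⟨α| dμ(α)` (as a weak integral) for some probability measure `μ` on `ℂ`. -/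
def IsClassical (ρ : Mode →L[ℂ] Mode) : Prop :=
  ∃ μ : Measure ℂ, IsProbabilityMeasure μ ∧
    ∀ f g : Mode, ⟪f, ρ g⟫_ℂ = ∫ α, ⟪f, coherent α⟫_ℂ * ⟪coherent α, g⟫_ℂ ∂μ

/-! ### Channels -/

/-- Quantum channels: completely positive, trace-preserving linear maps on trace-class operators.
Complete positivity is stated with block operators `(T i j)` on `Modeⁿ`. -/
structure IsChannel (Γ : traceClass →ₗ[ℂ] traceClass) : Prop where
  completely_positive : ∀ (n : ℕ) (T : Fin n → Fin n → traceClass),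
    (∀ v : Fin n → Mode, 0 ≤ ∑ i, ∑ j, ⟪v i, (T i j : Mode →L[ℂ] Mode) (v j)⟫_ℂ) →
    ∀ v : Fin n → Mode, 0 ≤ ∑ i, ∑ j, ⟪v i, (Γ (T i j) : Mode →L[ℂ] Mode) (v j)⟫_ℂ
  trace_preserving : ∀ T : traceClass,
    trace (Γ T : Mode →L[ℂ] Mode) = trace (T : Mode →L[ℂ] Mode)

/-- `Γ` is a Gaussian channel described by the pair `(X, Y)` of real `2 × 2` matrices, `Y`
symmetric: `χ_W^out(ξ) = χ_W^in(X ξ) exp(-ξᵀ Y ξ / 2)` for every input state. -/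
structure IsGaussianChannel (Γ : traceClass →ₗ[ℂ] traceClass)
    (X Y : Matrix (Fin 2) (Fin 2) ℝ) : Prop extends IsChannel Γ where
  symm : Y.IsSymm
  weylChar_out : ∀ (ρ : Mode →L[ℂ] Mode) (hρ : IsDensity ρ) (ξ : Fin 2 → ℝ),
    weylChar (Γ hρ.toTraceClass) ξ =
      weylChar ρ (X *ᵥ ξ) * ((Real.exp (-(ξ ⬝ᵥ Y *ᵥ ξ) / 2) : ℝ) : ℂ)

/-- `Γ` is nonclassicality breaking: every output state is classical. -/
def NonclassicalityBreaking (Γ : traceClass →ₗ[ℂ] traceClass) : Prop :=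
  ∀ (ρ : Mode →L[ℂ] Mode) (hρ : IsDensity ρ), IsClassical (Γ hρ.toTraceClass)

/-! ### Canonical forms -/

/-- The symplectic form `β` on `ℝ²`. -/
def symplecticForm : Matrix (Fin 2) (Fin 2) ℝ := !![0, 1; -1, 0]

/-- `(X₀, Y₀)` lies in the nonclassicality orbit of `(X, Y)`:
`(X₀, Y₀) = (S X R, Rᵀ Y R)` with `S ∈ Sp(2, ℝ)` and `R ∈ SO(2)`. -/
def HasForm (X Y X₀ Y₀ : Matrix (Fin 2) (Fin 2) ℝ) : Prop :=
  ∃ S R : Matrix (Fin 2) (Fin 2) ℝ, S * symplecticForm * Sᵀ = symplecticForm ∧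
    R ∈ Matrix.specialOrthogonalGroup (Fin 2) ℝ ∧ S * X * R = X₀ ∧ Rᵀ * Y * R = Y₀

/-- The Pauli matrix `σ₃ = diag(1, -1)`. -/
def sigma3 : Matrix (Fin 2) (Fin 2) ℝ := diagonal ![1, -1]

end SingleMode

end

open SingleMode

/-! ### Displacement operators: Weyl relations, strong continuity, coherent-state matrix elements -/

namespace SingleMode

/-! Everything reduces to one criterion: `Γ` is nonclassicality breaking iff `Y - 1 ≥ 0` and `det X
^ 2 ≤ det (Y - 1)`. Both conditions are unchanged when `(X, Y)` is replaced by a canonical form, so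
each clause is this criterion evaluated on a diagonal or singular pair.

A coherent state has characteristic function `exp (-|ξ|² / 2)` times the character `exp (2 i symp ξ
α)`. So an output is classical iff its Weyl characteristic function times `exp (|ξ|² / 2)` is the
Fourier transform of a probability measure. For a Gaussian channel that product is `χ(Xξ) exp (-ξᵀ
(Y - 1) ξ / 2)`.

Sufficiency. For a state, the matrix `exp (i symp x_i x_j) χ(x_i - x_j)` is a Gram matrix, hence
positive semidefinite. Evaluated at the points `X x_i` its phase becomes `exp (i det X symp x_i
x_j)`. The two conditions make a Gaussian kernel with the opposite phase positive semidefinite, by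
the Schur product theorem applied to the exponential series. In the entrywise product the phases
cancel, Bochner's theorem supplies the measure, and it represents the output because a state is
determined by its characteristic function.

Necessity. Displacements have approximate eigenvectors of eigenvalue one, so boundedness of
characteristic functions forces `Y - 1 ≥ 0` (`IsGaussianChannel.bilin_nonneg`). For the determinant,
the odd superposition of two coherent states is sent through the channel and the putative measure is
tested against a Gaussian. The resulting nonnegative integral is explicit, and its sign is the
determinant inequality (`IsGaussianChannel.det_le_of_pos`).

The clauses with the single inequality `(a - 1) (b - 1) ≥ κ⁴` also use complete positivity, which
gives `(1 - det X) ^ 2 ≤ det Y` (`IsGaussianChannel.uncertainty`). By the arithmetic-geometric mean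
inequality this excludes the branch `a, b < 1`, except at pure loss, where both inequalities are
equalities. -/

theorem displacement_coeFn (α : ℂ) (ψ : Mode) :
    displacement α ψ =ᵐ[volume] displaceFun α ψ :=
  MemLp.coeFn_toLp (memLp_displaceFun α (Lp.memLp ψ))

theorem displaceFun_congr (α : ℂ) {f g : ℝ → ℂ} (h : f =ᵐ[volume] g) :
    displaceFun α f =ᵐ[volume] displaceFun α g := by
  filter_upwards [(mp_shift α).quasiMeasurePreserving.ae_eq_comp h] with x hx
  simp only [Function.comp_apply] at hx
  simp only [displaceFun, hx]

/-- The Weyl relation, pointwise. The phase is the symplectic form of the two displacements; every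
later phase computation goes back to it. -/
theorem displaceFun_displaceFun (α β : ℂ) (f : ℝ → ℂ) (x : ℝ) :
    displaceFun α (displaceFun β f) x =
      Complex.exp (((α.im * β.re - α.re * β.im : ℝ) : ℂ) * Complex.I) *
        displaceFun (α + β) f x := by
  have h2 : (√2 : ℝ) * √2 = 2 := Real.mul_self_sqrt (by norm_num)
  simp only [displaceFun, ← mul_assoc, ← Complex.exp_add, Complex.add_re, Complex.add_im]
  congr 1
  · congr 1
    rw [← add_mul, ← add_mul]
    congr 1
    norm_cast
    linear_combination (-α.re * β.im) * h2
  · congr 1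
    ring

theorem displacement_displacement (α β : ℂ) (ψ : Mode) :
    displacement α (displacement β ψ) =
      Complex.exp (((α.im * β.re - α.re * β.im : ℝ) : ℂ) * Complex.I) •
        displacement (α + β) ψ := by
  apply Lp.ext
  filter_upwards [displacement_coeFn α (displacement β ψ),
    displaceFun_congr α (displacement_coeFn β ψ), displacement_coeFn (α + β) ψ,
    Lp.coeFn_smul (Complex.exp (((α.im * β.re - α.re * β.im : ℝ) : ℂ) * Complex.I))
      (displacement (α + β) ψ)] with x h1 h2 h3 h4
  rw [h1, h2, h4, Pi.smul_apply, h3, displaceFun_displaceFun, smul_eq_mul]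

@[simp]
theorem displacement_zero (ψ : Mode) : displacement 0 ψ = ψ := by
  apply Lp.ext
  filter_upwards [displacement_coeFn 0 ψ] with x h1
  simp [h1, displaceFun]

@[simp]
theorem displacement_neg_displacement (α : ℂ) (ψ : Mode) :
    displacement (-α) (displacement α ψ) = ψ := by
  rw [displacement_displacement]
  simp [mul_comm]

@[simp]
theorem displacement_displacement_neg (α : ℂ) (ψ : Mode) :
    displacement α (displacement (-α) ψ) = ψ := by
  simpa using displacement_neg_displacement (-α) ψ

@[simp]
theorem norm_displacement (α : ℂ) (ψ : Mode) : ‖displacement α ψ‖ = ‖ψ‖ :=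
  (displacementIsometry α).norm_map ψ

@[simp]
theorem inner_displacement_displacement (α : ℂ) (u v : Mode) :
    ⟪displacement α u, displacement α v⟫_ℂ = ⟪u, v⟫_ℂ :=
  (displacementIsometry α).inner_map_map u v

theorem inner_displacement_left (α : ℂ) (u v : Mode) :
    ⟪displacement α u, v⟫_ℂ = ⟪u, displacement (-α) v⟫_ℂ := by
  rw [← inner_displacement_displacement (-α), displacement_neg_displacement]

theorem inner_displacement_right (α : ℂ) (u v : Mode) :
    ⟪u, displacement α v⟫_ℂ = ⟪displacement (-α) u, v⟫_ℂ := by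
  rw [inner_displacement_left, neg_neg]

/-- The displacement operator as a unitary. -/
noncomputable def displacementEquiv (α : ℂ) : Mode ≃ₗᵢ[ℂ] Mode where
  toLinearEquiv := LinearEquiv.ofLinearMap (displacement α).toLinearMap
    (displacement (-α)).toLinearMap (by ext1 ψ; simp) (by ext1 ψ; simp)
  norm_map' ψ := norm_displacement α ψ

theorem inner_displacement_eq_integral (α : ℂ) (u v : Mode) :
    ⟪u, displacement α v⟫_ℂ = ∫ x : ℝ, (starRingEnd ℂ) (u x) * displaceFun α v x := by
  rw [L2.inner_def]
  refine integral_congr_ae ?_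
  filter_upwards [displacement_coeFn α v] with x hx
  rw [hx, RCLike.inner_apply, mul_comm]

/-- On a sphere weak and strong convergence agree, because `‖f x - f x₀‖ ^ 2 = 2 r ^ 2 - 2 Re ⟪f x₀,
f x⟫`. -/
theorem continuous_of_weak_of_norm {X : Type*} [TopologicalSpace X] {f : X → Mode} {r : ℝ}
    (hn : ∀ x, ‖f x‖ = r) (hw : ∀ u, Continuous fun x => ⟪u, f x⟫_ℂ) : Continuous f := by
  rw [continuous_iff_continuousAt]
  intro x₀
  rw [ContinuousAt, tendsto_iff_norm_sub_tendsto_zero]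
  have h : ∀ x, ‖f x - f x₀‖ = √(2 * r ^ 2 - 2 * RCLike.re ⟪f x₀, f x⟫_ℂ) := by
    intro x
    rw [eq_comm, ← Real.sqrt_sq (norm_nonneg (f x - f x₀)), norm_sub_sq (𝕜 := ℂ), hn, hn,
      inner_re_symm]
    congr 1
    ring
  have h2 : Filter.Tendsto (fun x => √(2 * r ^ 2 - 2 * RCLike.re ⟪f x₀, f x⟫_ℂ)) (nhds x₀)
      (nhds (√(2 * r ^ 2 - 2 * RCLike.re ⟪f x₀, f x₀⟫_ℂ))) := by
    have h3 : Continuous fun x => √(2 * r ^ 2 - 2 * RCLike.re ⟪f x₀, f x⟫_ℂ) :=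
      ((continuous_const.sub (continuous_const.mul (RCLike.continuous_re.comp (hw (f x₀)))))).sqrt
    exact h3.tendsto x₀
  rw [← h x₀, sub_self, norm_zero] at h2
  exact h2.congr fun x => (h x).symm

theorem continuous_displacement_re (ψ : Mode) :
    Continuous fun a : ℝ => displacement (a : ℂ) ψ := by
  let g : ℝ → C(ℝ, ℝ) := fun a => ⟨fun x => x - √2 * a, by fun_prop⟩
  have hg : Continuous g := ContinuousMap.continuous_of_continuous_uncurry _ (by
    change Continuous fun p : ℝ × ℝ => p.2 - √2 * p.1
    fun_prop)
  have hmp : ∀ a, MeasurePreserving (g a) volume volume :=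
    fun a => measurePreserving_sub_right volume _
  have h := (continuous_const (y := ψ)).compMeasurePreservingLp hg hmp (by simp)
  refine h.congr fun a => Lp.ext ?_
  filter_upwards [displacement_coeFn (a : ℂ) ψ, Lp.coeFn_compMeasurePreserving ψ (hmp a)]
    with x h1 h2
  rw [h1, h2]
  simp [displaceFun, g]

/-- These displacements only multiply by a phase, so the integrand of the matrix element has a
modulus independent of `b` and dominated convergence applies. -/
theorem continuous_displacement_im (ψ : Mode) :
    Continuous fun b : ℝ => displacement (b * Complex.I) ψ := by
  refine continuous_of_weak_of_norm (r := ‖ψ‖) (fun α => norm_displacement _ ψ) fun u => ?_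
  simp_rw [inner_displacement_eq_integral]
  have hint : Integrable fun x => ‖⟪u x, ψ x⟫_ℂ‖ := (L2.integrable_inner u ψ).norm
  refine continuous_of_dominated (bound := fun x => ‖⟪u x, ψ x⟫_ℂ‖) (fun b => ?_) (fun b => ?_)
    hint ?_
  · exact (RCLike.continuous_conj.comp_aestronglyMeasurable (Lp.aestronglyMeasurable u)).mul
      (aestronglyMeasurable_displaceFun _ (Lp.aestronglyMeasurable ψ))
  · refine Filter.Eventually.of_forall fun x => ?_
    rw [norm_mul, norm_displaceFun, RCLike.inner_apply, norm_mul, mul_comm]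
    simp
  · refine Filter.Eventually.of_forall fun x => ?_
    simp only [displaceFun]
    simp
    fun_prop

theorem continuous_displacement (ψ : Mode) : Continuous fun α : ℂ => displacement α ψ := by
  refine continuous_of_weak_of_norm (r := ‖ψ‖) (fun α => norm_displacement α ψ) fun u => ?_
  -- Up to a phase, `D(α)` is a modulation after a translation. Moving the modulation to the left
  -- argument leaves an inner product of two strongly continuous families.
  have h : ∀ α : ℂ, ⟪u, displacement α ψ⟫_ℂ =
      Complex.exp (((-α.im * α.re : ℝ) : ℂ) * Complex.I) *
      ⟪displacement ((-α.im : ℝ) * Complex.I) u, displacement (α.re : ℂ) ψ⟫_ℂ := by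
    intro α
    rw [inner_displacement_left, displacement_displacement, inner_smul_right, ← mul_assoc,
      ← Complex.exp_add]
    have e1 : -((-α.im : ℝ) * Complex.I) + (α.re : ℂ) = α := by
      apply Complex.ext <;> simp
    rw [e1]
    simp
  simp_rw [h]
  have h1 := (continuous_displacement_im u).comp (Complex.continuous_im.neg)
  have h2 := (continuous_displacement_re ψ).comp (Complex.continuous_re)
  refine Continuous.mul ?_ (h1.inner h2)
  fun_prop

theorem inner_vacuum_displacement_vacuum (α : ℂ) :
    ⟪vacuum, displacement α vacuum⟫_ℂ = ((Real.exp (-(α.re ^ 2 + α.im ^ 2) / 2) : ℝ) : ℂ) := by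
  have hv : vacuum =ᵐ[volume] vacuumFun := memLp_vacuumFun.coeFn_toLp
  rw [inner_displacement_eq_integral]
  have h2 : ((√2 : ℝ) : ℂ) * (√2 : ℝ) = 2 := by
    norm_cast; exact Real.mul_self_sqrt (by norm_num)
  have hpi : (((Real.pi ^ (-(1 / 4) : ℝ) : ℝ) : ℂ)) * ((Real.pi ^ (-(1 / 4) : ℝ) : ℝ) : ℂ) *
      ((Real.pi : ℂ) ^ (1 / 2 : ℂ)) = 1 := by
    have : ((Real.pi : ℂ) ^ (1 / 2 : ℂ)) = ((Real.pi ^ (1 / 2 : ℝ) : ℝ) : ℂ) := by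
      rw [Complex.ofReal_cpow Real.pi_pos.le]; norm_num
    rw [this]
    norm_cast
    rw [← Real.rpow_add Real.pi_pos, ← Real.rpow_add Real.pi_pos]
    norm_num
  have h1 : ∫ x : ℝ, (starRingEnd ℂ) (vacuum x) * displaceFun α vacuum x =
      ∫ x : ℝ, ((Real.pi ^ (-(1 / 4) : ℝ) : ℝ) : ℂ) * ((Real.pi ^ (-(1 / 4) : ℝ) : ℝ) : ℂ) *
        Complex.exp ((-1) * (x : ℂ) ^ 2 + ((√2 : ℝ) * α) * x +
          (-(α.re : ℂ) ^ 2 - α.re * α.im * Complex.I)) := by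
    refine integral_congr_ae ?_
    filter_upwards [hv, displaceFun_congr α hv] with x e1 e2
    rw [e1, e2]
    simp only [displaceFun, vacuumFun, Complex.conj_ofReal]
    push_cast
    have e3 : (-1) * (x : ℂ) ^ 2 + ((√2 : ℝ) * α) * x +
          (-(α.re : ℂ) ^ 2 - α.re * α.im * Complex.I) = -(x : ℂ) ^ 2 / 2 +
        ((√2 : ℝ) * α.im * x - α.re * α.im) * Complex.I + -(x - (√2 : ℝ) * α.re) ^ 2 / 2 := by
      linear_combination ((√2 : ℝ) * (x : ℂ)) * (Complex.re_add_im α).symm +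
        ((α.re : ℂ) ^ 2 / 2) * h2
    rw [e3, Complex.exp_add, Complex.exp_add]
    ring
  rw [h1, integral_const_mul, integral_cexp_quadratic (by simp), neg_neg, div_one, ← mul_assoc, hpi, one_mul]
  push_cast
  congr 1
  have e4 := Complex.re_add_im α
  have e5 : (α : ℂ) ^ 2 = (α.re + α.im * Complex.I) ^ 2 := by rw [e4]
  linear_combination (α ^ 2 / 4) * h2 + e5 / 2 + (α.im : ℂ) ^ 2 / 2 * Complex.I_sq

@[simp]
theorem norm_vacuum : ‖vacuum‖ = 1 := by
  have h := inner_vacuum_displacement_vacuum 0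
  rw [displacement_zero, inner_self_eq_norm_sq_to_K] at h
  have h2 : ‖vacuum‖ ^ 2 = 1 := by exact_mod_cast (by simpa using h : ((‖vacuum‖ : ℂ)) ^ 2 = 1)
  nlinarith [norm_nonneg vacuum]

@[simp]
theorem norm_coherent (α : ℂ) : ‖coherent α‖ = 1 := by
  rw [coherent, norm_displacement, norm_vacuum]

theorem continuous_coherent : Continuous coherent := continuous_displacement vacuum

/-- Matrix elements of displacement operators between coherent states. -/
theorem inner_coherent_displacement_coherent (α β ξ : ℂ) :
    ⟪coherent α, displacement ξ (coherent β)⟫_ℂ =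
      Complex.exp (((ξ.im * β.re - ξ.re * β.im - α.im * (ξ + β).re + α.re * (ξ + β).im : ℝ) : ℂ)
        * Complex.I) *
      ((Real.exp (-((ξ + β - α).re ^ 2 + (ξ + β - α).im ^ 2) / 2) : ℝ) : ℂ) := by
  rw [coherent, coherent, inner_displacement_left, displacement_displacement ξ β, map_smul,
    displacement_displacement, smul_smul, inner_smul_right, ← Complex.exp_add,
    show -α + (ξ + β) = ξ + β - α by ring, inner_vacuum_displacement_vacuum]
  congr 2
  rw [← add_mul]
  congr 1
  norm_cast
  simp only [Complex.neg_im, Complex.neg_re]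
  ring

theorem inner_coherent_displacement_self (α ξ : ℂ) :
    ⟪coherent α, displacement ξ (coherent α)⟫_ℂ =
      Complex.exp (((2 * (ξ.im * α.re - ξ.re * α.im) : ℝ) : ℂ) * Complex.I) *
      ((Real.exp (-(ξ.re ^ 2 + ξ.im ^ 2) / 2) : ℝ) : ℂ) := by
  rw [inner_coherent_displacement_coherent, add_sub_cancel_right]
  congr 4
  simp only [Complex.add_re, Complex.add_im]
  ring

end SingleMode

/-! ### Traces, mixtures of pure states, rank-one operators -/

namespace SingleMode

theorem HasTrace.unique {T : Mode →L[ℂ] Mode} {z w : ℂ} (hz : HasTrace T z) (hw : HasTrace T w) :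
    z = w := by
  obtain ⟨s, b, -⟩ := exists_hilbertBasis ℂ Mode
  exact (hz s b).unique (hw s b)

theorem HasTrace.trace_eq {T : Mode →L[ℂ] Mode} {z : ℂ} (hz : HasTrace T z) : trace T = z := by
  have h : ∃ z, HasTrace T z := ⟨z, hz⟩
  rw [trace, dif_pos h]
  exact h.choose_spec.unique hz

theorem HasTrace.add {S T : Mode →L[ℂ] Mode} {z w : ℂ} (hz : HasTrace S z) (hw : HasTrace T w) :
    HasTrace (S + T) (z + w) := by
  intro ι b
  simpa [inner_add_right] using (hz ι b).add (hw ι b)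

theorem HasTrace.smul {T : Mode →L[ℂ] Mode} {z : ℂ} (c : ℂ) (hz : HasTrace T z) :
    HasTrace (c • T) (c * z) := by
  intro ι b
  simpa [inner_smul_right] using (hz ι b).mul_left c

theorem hasTrace_zero : HasTrace 0 0 := by
  intro ι b
  simp

instance : SecondCountableTopology Mode := by
  have : Fact ((2 : ℝ≥0∞) ≠ ⊤) := ⟨by simp⟩
  infer_instance

/-- Distinct basis vectors lie at distance `√2`, so balls of radius `1/2` around them are disjoint,
and the space is separable. -/
theorem countable_of_hilbertBasis {ι : Type*} (b : HilbertBasis ι ℂ Mode) : Countable ι := by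
  have hd : Set.univ.PairwiseDisjoint fun i => Metric.ball (b i) (1 / 2) := by
    intro i _ j _ hij
    apply Metric.ball_disjoint_ball
    have h : ‖b i - b j‖ ^ 2 = 2 := by
      rw [norm_sub_sq (𝕜 := ℂ), b.orthonormal.1 i, b.orthonormal.1 j, b.orthonormal.2 hij]
      norm_num
    rw [dist_eq_norm]
    nlinarith [norm_nonneg (b i - b j)]
  have := hd.countable_of_isOpen (fun i _ => Metric.isOpen_ball)
    (fun i _ => ⟨b i, Metric.mem_ball_self (by norm_num)⟩)
  exact Set.countable_univ_iff.mp this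

theorem hasSum_norm_inner_sq {ι : Type*} (b : HilbertBasis ι ℂ Mode) (x : Mode) :
    HasSum (fun i => ‖⟪b i, x⟫_ℂ‖ ^ 2) (‖x‖ ^ 2) := by
  have h := b.hasSum_inner_mul_inner x x
  rw [inner_self_eq_norm_sq_to_K] at h
  have h2 : ∀ i, ⟪x, b i⟫_ℂ * ⟪b i, x⟫_ℂ = ((‖⟪b i, x⟫_ℂ‖ ^ 2 : ℝ) : ℂ) := by
    intro i
    rw [← inner_conj_symm x, mul_comm, RCLike.mul_conj]
    norm_cast
  simp_rw [h2] at h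
  exact Complex.hasSum_ofReal.mp (by simpa using h)

/-- `ρ` is the (weak) integral of the rank-one operators `|v a⟩⟨v a|`. -/
structure IsMixture {A : Type*} [MeasurableSpace A] (m : Measure A) (v : A → Mode)
    (ρ : Mode →L[ℂ] Mode) : Prop where
  meas : AEStronglyMeasurable v m
  integrable_sq : Integrable (fun a => ‖v a‖ ^ 2) m
  inner_eq : ∀ f g : Mode, ⟪f, ρ g⟫_ℂ = ∫ a, ⟪f, v a⟫_ℂ * ⟪v a, g⟫_ℂ ∂m

section Mixture

variable {A : Type*} [MeasurableSpace A] {m : Measure A} {v : A → Mode} {ρ : Mode →L[ℂ] Mode}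

theorem IsMixture.integrable_apply_sq (h : IsMixture m v ρ) (B : Mode →L[ℂ] Mode) :
    Integrable (fun a => ‖B (v a)‖ ^ 2) m := by
  refine (h.integrable_sq.const_mul (‖B‖ ^ 2)).mono'
    ((B.continuous.comp_aestronglyMeasurable h.meas).norm.pow 2)
    (Filter.Eventually.of_forall fun a => ?_)
  rw [Real.norm_eq_abs, abs_of_nonneg (by positivity), ← mul_pow]
  gcongr
  exact B.le_opNorm _

/-- Sum and integral are exchanged: the terms are dominated by `(|⟪b i, v⟫|² + |⟪b i, B v⟫|²) / 2`,
whose sum is `(‖v‖² + ‖B v‖²) / 2` by Parseval. The value does not involve the basis. -/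
theorem IsMixture.hasTrace (h : IsMixture m v ρ) (B : Mode →L[ℂ] Mode) :
    HasTrace (B ∘L ρ) (∫ a, ⟪v a, B (v a)⟫_ℂ ∂m) := by
  intro ι b
  have : Countable ι := countable_of_hilbertBasis b
  have e : ∀ i, ⟪b i, (B ∘L ρ) (b i)⟫_ℂ = ∫ a, ⟪v a, b i⟫_ℂ * ⟪b i, B (v a)⟫_ℂ ∂m := by
    intro i
    rw [ContinuousLinearMap.comp_apply, ← ContinuousLinearMap.adjoint_inner_left, h.inner_eq]
    simp_rw [ContinuousLinearMap.adjoint_inner_left, mul_comm]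
  simp_rw [e]
  have hB := B.continuous.comp_aestronglyMeasurable h.meas
  have hs : ∀ a, HasSum (fun i => (‖⟪b i, v a⟫_ℂ‖ ^ 2 + ‖⟪b i, B (v a)⟫_ℂ‖ ^ 2) / 2)
      ((‖v a‖ ^ 2 + ‖B (v a)‖ ^ 2) / 2) := fun a =>
    ((hasSum_norm_inner_sq b (v a)).add
      (hasSum_norm_inner_sq b (B (v a)))).div_const 2
  refine hasSum_integral_of_dominated_convergence
    (fun i a => (‖⟪b i, v a⟫_ℂ‖ ^ 2 + ‖⟪b i, B (v a)⟫_ℂ‖ ^ 2) / 2) (fun i => ?_) (fun i => ?_) ?_ ?_ ?_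
  · exact (h.meas.inner aestronglyMeasurable_const).mul (aestronglyMeasurable_const.inner hB)
  · refine Filter.Eventually.of_forall fun a => ?_
    rw [norm_mul, norm_inner_symm]
    nlinarith [sq_nonneg (‖⟪b i, v a⟫_ℂ‖ - ‖⟪b i, B (v a)⟫_ℂ‖)]
  · exact Filter.Eventually.of_forall fun a => (hs a).summable
  · simp_rw [fun a => (hs a).tsum_eq]
    exact (h.integrable_sq.add (h.integrable_apply_sq B)).div_const 2
  · exact Filter.Eventually.of_forall fun a => b.hasSum_inner_mul_inner _ _

theorem IsMixture.trace_comp (h : IsMixture m v ρ) (B : Mode →L[ℂ] Mode) :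
    trace (B ∘L ρ) = ∫ a, ⟪v a, B (v a)⟫_ℂ ∂m :=
  (h.hasTrace B).trace_eq

end Mixture

theorem exists_isPositive_mul_self_eq {H : Type*} [NormedAddCommGroup H] [InnerProductSpace ℂ H]
    [CompleteSpace H] {ρ : H →L[ℂ] H} (h : ρ.IsPositive) :
    ∃ r : H →L[ℂ] H, r.IsPositive ∧ r * r = ρ :=
  ⟨CFC.sqrt ρ, (ContinuousLinearMap.nonneg_iff_isPositive _).mp (CFC.sqrt_nonneg ρ),
    CFC.sqrt_mul_sqrt_self ρ ((ContinuousLinearMap.nonneg_iff_isPositive ρ).mpr h)⟩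

/-- Every density operator is a countable mixture of pure states. -/
theorem IsDensity.exists_isMixture {ρ : Mode →L[ℂ] Mode} (hρ : IsDensity ρ) :
    ∃ (A : Type) (_ : MeasurableSpace A) (m : Measure A) (v : A → Mode),
      SigmaFinite m ∧ IsMixture m v ρ ∧ ∫ a, ‖v a‖ ^ 2 ∂m = 1 := by
  obtain ⟨s, b, -⟩ := exists_hilbertBasis ℂ Mode
  have : Countable s := countable_of_hilbertBasis b
  let : MeasurableSpace s := ⊤
  -- With `r` the square root of `ρ`, one has `ρ = ∑ |r b_i⟩⟨r b_i|`, and the squared norms of the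
  -- `r b_i` sum to the trace.
  obtain ⟨r, hr, hrr⟩ := exists_isPositive_mul_self_eq hρ.1
  have hadj : ∀ f g, ⟪r f, g⟫_ℂ = ⟪f, r g⟫_ℂ := hr.isSymmetric
  have hin : ∀ f g, ⟪f, ρ g⟫_ℂ = ⟪r f, r g⟫_ℂ := by
    intro f g
    rw [hadj, ← hrr]
    rfl
  have hsq : HasSum (fun i => ‖r (b i)‖ ^ 2) 1 := by
    have h := hρ.2 s b
    have h2 : ∀ i, ⟪b i, ρ (b i)⟫_ℂ = ((‖r (b i)‖ ^ 2 : ℝ) : ℂ) := by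
      intro i
      rw [hin, inner_self_eq_norm_sq_to_K]
      norm_cast
    simp_rw [h2] at h
    exact Complex.hasSum_ofReal.mp (by simpa using h)
  have hsqi : Integrable (fun i => ‖r (b i)‖ ^ 2) Measure.count :=
    integrable_count_iff.mpr hsq.summable.norm
  refine ⟨s, ⊤, Measure.count, fun i => r (b i), inferInstance, ⟨?_, hsqi, fun f g => ?_⟩, ?_⟩
  · exact (StronglyMeasurable.of_discrete).aestronglyMeasurable
  · have h1 : HasSum (fun i => ⟪f, r (b i)⟫_ℂ * ⟪r (b i), g⟫_ℂ) ⟪f, ρ g⟫_ℂ := by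
      rw [hin]
      simp_rw [← hadj f, hadj _ g]
      exact b.hasSum_inner_mul_inner _ _
    rw [integral_countable (integrable_count_iff.mpr h1.summable.norm)]
    simpa using h1.tsum_eq.symm
  · rw [integral_countable hsqi]
    simpa using hsq.tsum_eq

theorem exists_hasTrace_comp (B : Mode →L[ℂ] Mode) (T : traceClass) :
    ∃ z, HasTrace (B ∘L (T : Mode →L[ℂ] Mode)) z := by
  obtain ⟨T, hT⟩ := T
  induction hT using Submodule.span_induction with
  | mem ρ hρ =>
    obtain ⟨A, _, m, v, -, h, -⟩ := IsDensity.exists_isMixture hρ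
    exact ⟨_, h.hasTrace B⟩
  | zero => exact ⟨0, by simpa using hasTrace_zero⟩
  | add S T _ _ hS hT =>
    obtain ⟨z, hz⟩ := hS
    obtain ⟨w, hw⟩ := hT
    exact ⟨z + w, by simpa using hz.add hw⟩
  | smul c T _ hT =>
    obtain ⟨z, hz⟩ := hT
    exact ⟨c * z, by simpa using hz.smul c⟩

theorem hasTrace_comp (B : Mode →L[ℂ] Mode) (T : traceClass) :
    HasTrace (B ∘L (T : Mode →L[ℂ] Mode)) (trace (B ∘L (T : Mode →L[ℂ] Mode))) := by
  obtain ⟨z, hz⟩ := exists_hasTrace_comp B T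
  rwa [hz.trace_eq]

/-- The rank-one operator `|u⟩⟨w|`. -/
noncomputable abbrev ketBra (u w : Mode) : Mode →L[ℂ] Mode := InnerProductSpace.rankOne ℂ u w

theorem hasTrace_comp_ketBra (B : Mode →L[ℂ] Mode) (u w : Mode) :
    HasTrace (B ∘L ketBra u w) ⟪w, B u⟫_ℂ := by
  intro ι b
  have h := b.hasSum_inner_mul_inner w (B u)
  simpa [inner_smul_right] using h

theorem isDensity_ketBra {u : Mode} (hu : ‖u‖ = 1) : IsDensity (ketBra u u) := by
  constructor
  · exact InnerProductSpace.isPositive_rankOne_self u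
  · have h := hasTrace_comp_ketBra (ContinuousLinearMap.id ℂ Mode) u u
    simpa [inner_self_eq_norm_sq_to_K, hu] using h

theorem ketBra_self_mem_traceClass (u : Mode) : ketBra u u ∈ traceClass := by
  by_cases hu : u = 0
  · simp [hu]
  · have h : ketBra u u = ((‖u‖ ^ 2 : ℝ) : ℂ) • ketBra ((‖u‖⁻¹ : ℂ) • u) ((‖u‖⁻¹ : ℂ) • u) := by
      have hn : (‖u‖ : ℂ) ≠ 0 := by simpa using hu
      ext1 f
      simp only [InnerProductSpace.rankOne_apply, inner_smul_left, _root_.smul_apply, smul_smul]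
      congr 1
      simp
      field_simp
    rw [h]
    refine Submodule.smul_mem _ _ (Submodule.subset_span (isDensity_ketBra ?_))
    rw [norm_smul]
    simp [hu]

/-- Polarization writes `|u⟩⟨w|` through four projectors `|x⟩⟨x|`. -/
theorem ketBra_mem_traceClass (u w : Mode) : ketBra u w ∈ traceClass := by
  have h : ketBra u w = (1 / 4 : ℂ) • (ketBra (u + w) (u + w) - ketBra (u - w) (u - w)
      + Complex.I • ketBra (u + Complex.I • w) (u + Complex.I • w)
      - Complex.I • ketBra (u - Complex.I • w) (u - Complex.I • w)) := by
    ext1 f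
    simp only [InnerProductSpace.rankOne_apply, _root_.smul_apply, _root_.add_apply,
      _root_.sub_apply, inner_add_left, inner_sub_left, inner_smul_left, smul_add, smul_sub,
      smul_smul, add_smul, sub_smul, Complex.conj_I]
    match_scalars <;> ring_nf <;> simp [Complex.I_sq]
    ring
  rw [h]
  have := ketBra_self_mem_traceClass
  exact Submodule.smul_mem _ _ (Submodule.sub_mem _ (Submodule.add_mem _ (Submodule.sub_mem _
    (this _) (this _)) (Submodule.smul_mem _ _ (this _))) (Submodule.smul_mem _ _ (this _)))

end SingleMode

/-! ### The characteristic function determines the state -/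

namespace SingleMode

theorem continuous_displacement_uncurry :
    Continuous fun p : ℂ × Mode => displacement p.1 p.2 := by
  rw [continuous_iff_continuousAt]
  rintro ⟨α, ψ⟩
  rw [ContinuousAt, tendsto_iff_norm_sub_tendsto_zero]
  have h1 : Filter.Tendsto (fun p : ℂ × Mode => ‖p.2 - ψ‖ +
      ‖displacement p.1 ψ - displacement α ψ‖) (nhds (α, ψ)) (nhds 0) := by
    have h2 : Continuous fun p : ℂ × Mode => ‖p.2 - ψ‖ +
        ‖displacement p.1 ψ - displacement α ψ‖ := by
      have := (continuous_displacement ψ).comp (continuous_fst (X := ℂ) (Y := Mode))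
      exact (continuous_snd.sub continuous_const).norm.add (this.sub continuous_const).norm
    simpa using h2.tendsto (α, ψ)
  refine squeeze_zero (fun _ => norm_nonneg _) (fun p => ?_) h1
  rw [← norm_displacement p.1 (p.2 - ψ), map_sub]
  exact norm_sub_le_norm_sub_add_norm_sub _ _ _

theorem continuous_inner_displacement (u w : Mode) :
    Continuous fun ξ : ℂ => ⟪u, displacement ξ w⟫_ℂ :=
  continuous_const.inner (continuous_displacement w)

theorem integrable_gauss : Integrable fun ξ : ℂ => Real.exp (-‖ξ‖ ^ 2 / 2) := by
  have h := (GaussianFourier.integrable_cexp_neg_mul_sq_norm_add (V := ℂ) (b := 1 / 2)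
    (by norm_num) 0 0).norm
  refine h.congr (Filter.Eventually.of_forall fun ξ => ?_)
  simp only [zero_mul, add_zero, Complex.norm_exp]
  congr 1
  rw [show (-(1 / 2) * (‖ξ‖ : ℂ) ^ 2) = ((-‖ξ‖ ^ 2 / 2 : ℝ) : ℂ) by push_cast; ring,
    Complex.ofReal_re]

theorem norm_inner_displacement_le (u w : Mode) (ξ : ℂ) :
    ‖⟪u, displacement ξ w⟫_ℂ‖ ≤ ‖u‖ * ‖w‖ := by
  simpa using norm_inner_le_norm (𝕜 := ℂ) u (displacement ξ w)

theorem integrable_gauss_mul_inner (u w : Mode) :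
    Integrable fun ξ : ℂ => ((Real.exp (-‖ξ‖ ^ 2 / 2) : ℝ) : ℂ) * ⟪u, displacement ξ w⟫_ℂ :=
  integrable_gauss.ofReal.mul_bdd (c := ‖u‖ * ‖w‖)
    (continuous_inner_displacement u w).aestronglyMeasurable
    (Filter.Eventually.of_forall fun ξ => norm_inner_displacement_le u w ξ)

theorem inner_vacuum_ae (u : Mode) :
    (fun x => ⟪vacuum x, u x⟫_ℂ) =ᵐ[volume] fun x => ((Real.pi ^ (-(1 / 4) : ℝ) : ℝ) : ℂ) *
      (((Real.exp (-x ^ 2 / 2) : ℝ) : ℂ) * u x) := by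
  have hv : vacuum =ᵐ[volume] vacuumFun := memLp_vacuumFun.coeFn_toLp
  filter_upwards [hv] with x hx
  rw [hx, RCLike.inner_apply, vacuumFun, Complex.conj_ofReal]
  push_cast
  ring

theorem integrable_exp_mul_coe (u : Mode) :
    Integrable fun x : ℝ => ((Real.exp (-x ^ 2 / 2) : ℝ) : ℂ) * u x := by
  have h := (L2.integrable_inner (𝕜 := ℂ) vacuum u).congr (inner_vacuum_ae u)
  have hpi : ((Real.pi ^ (-(1 / 4) : ℝ) : ℝ) : ℂ) ≠ 0 := by
    exact_mod_cast (Real.rpow_pos_of_pos Real.pi_pos _).ne'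
  exact (integrable_const_mul_iff (isUnit_iff_ne_zero.mpr hpi) _).mp h

theorem inner_vacuum_left (u : Mode) : ⟪vacuum, u⟫_ℂ =
    ((Real.pi ^ (-(1 / 4) : ℝ) : ℝ) : ℂ) * ∫ x, ((Real.exp (-x ^ 2 / 2) : ℝ) : ℂ) * u x := by
  rw [L2.inner_def, integral_congr_ae (inner_vacuum_ae u), integral_const_mul]

theorem inner_vacuum_right (u : Mode) : ⟪u, vacuum⟫_ℂ =
    ((Real.pi ^ (-(1 / 4) : ℝ) : ℝ) : ℂ) *
      ∫ x, ((Real.exp (-x ^ 2 / 2) : ℝ) : ℂ) * (starRingEnd ℂ) (u x) := by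
  rw [← inner_conj_symm, inner_vacuum_left, map_mul, Complex.conj_ofReal, ← integral_conj]
  simp_rw [map_mul, Complex.conj_ofReal]

theorem integrable_comp_shear {g : ℝ → ℂ} (hg : Integrable g) (x : ℝ) :
    Integrable fun a : ℝ => g (x - √2 * a) :=
  (hg.comp_sub_left x).comp_mul_left' (by positivity)

theorem integral_comp_shear {E : Type*} [NormedAddCommGroup E] [NormedSpace ℝ E] (g : ℝ → E)
    (x : ℝ) : ∫ a : ℝ, g (x - √2 * a) = (√2)⁻¹ • ∫ y, g y := by
  rw [Measure.integral_comp_mul_left (fun y => g (x - y)), integral_sub_left_eq_self g,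
    abs_of_nonneg (by positivity)]

theorem integrable_shear {f g : ℝ → ℂ} (hf : Integrable f) (hg : Integrable g)
    (hgm : StronglyMeasurable g) :
    Integrable (fun p : ℝ × ℝ => f p.1 * g (p.1 - √2 * p.2)) (volume.prod volume) := by
  have hm : Measurable fun p : ℝ × ℝ => p.1 - √2 * p.2 := by fun_prop
  have hs : AEStronglyMeasurable (fun p : ℝ × ℝ => f p.1 * g (p.1 - √2 * p.2))
      (volume.prod volume) :=
    hf.1.comp_fst.mul (hgm.comp_measurable hm).aestronglyMeasurable
  rw [integrable_prod_iff hs]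
  refine ⟨Filter.Eventually.of_forall fun x => (integrable_comp_shear hg x).const_mul (f x), ?_⟩
  simp_rw [norm_mul, integral_const_mul, fun x => integral_comp_shear (fun y => ‖g y‖) x]
  exact hf.norm.mul_const _

/-- For fixed `x` the substitution `y = x - √2 a` decouples the two factors; the Jacobian gives
`(√2)⁻¹`. -/
theorem integral_shear {f g : ℝ → ℂ} (hf : Integrable f) (hg : Integrable g)
    (hgm : StronglyMeasurable g) :
    ∫ a, ∫ x, f x * g (x - √2 * a) = (√2 : ℂ)⁻¹ * ((∫ x, f x) * ∫ x, g x) := by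
  rw [integral_integral_swap (f := fun a x => f x * g (x - √2 * a))
    (integrable_shear hf hg hgm).swap]
  simp_rw [integral_const_mul, integral_comp_shear, integral_mul_const, Complex.real_smul]
  push_cast
  ring

/-- The imaginary part of the displacement enters only through a phase linear in it, so that
integral is the Fourier transform of a Gaussian. -/
theorem integral_im_displaceFun (u w : Mode) (a : ℝ) :
    ∫ b : ℝ, ((Real.exp (-b ^ 2 / 2) : ℝ) : ℂ) * ⟪u, displacement ⟨a, b⟩ w⟫_ℂ =
      ∫ x : ℝ, (√(2 * Real.pi) : ℂ) * ((Real.exp (-(√2 * x - a) ^ 2 / 2) : ℝ) : ℂ) *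
        ((starRingEnd ℂ) (u x) * w (x - √2 * a)) := by
  have hb : Integrable fun b : ℝ => ((Real.exp (-b ^ 2 / 2) : ℝ) : ℂ) := by
    have h := (integrable_exp_neg_mul_sq (b := 1 / 2) (by norm_num)).ofReal (𝕜 := ℂ)
    refine h.congr (Filter.Eventually.of_forall fun x => ?_)
    simp only
    congr 2
    ring
  have hx : Integrable fun x : ℝ => (starRingEnd ℂ) (u x) * w (x - √2 * a) := by
    refine (L2.integrable_inner (𝕜 := ℂ) u (displacement ⟨a, 0⟩ w)).congr ?_
    filter_upwards [displacement_coeFn ⟨a, 0⟩ w] with x hx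
    rw [hx, RCLike.inner_apply, mul_comm]
    simp [displaceFun]
  have hint : Integrable (fun p : ℝ × ℝ => (((Real.exp (-p.1 ^ 2 / 2) : ℝ) : ℂ) *
      ((starRingEnd ℂ) (u p.2) * w (p.2 - √2 * a))) *
      Complex.exp (((√2 * p.1 * p.2 - a * p.1 : ℝ) : ℂ) * Complex.I)) (volume.prod volume) := by
    refine (hb.mul_prod hx).mul_bdd (c := 1) ?_ (Filter.Eventually.of_forall fun p => ?_)
    · exact Continuous.aestronglyMeasurable (by fun_prop)
    · rw [Complex.norm_exp_ofReal_mul_I]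
  have h1 : ∀ b : ℝ, ((Real.exp (-b ^ 2 / 2) : ℝ) : ℂ) * ⟪u, displacement ⟨a, b⟩ w⟫_ℂ =
      ∫ x : ℝ, (((Real.exp (-b ^ 2 / 2) : ℝ) : ℂ) *
      ((starRingEnd ℂ) (u x) * w (x - √2 * a))) *
      Complex.exp (((√2 * b * x - a * b : ℝ) : ℂ) * Complex.I) := by
    intro b
    rw [inner_displacement_eq_integral, ← integral_const_mul]
    congr 1
    ext1 x
    simp only [displaceFun]
    ring
  simp_rw [h1]
  rw [integral_integral_swap hint]
  congr 1
  ext1 x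
  have h2 : ∀ b : ℝ, (((Real.exp (-b ^ 2 / 2) : ℝ) : ℂ) *
      ((starRingEnd ℂ) (u x) * w (x - √2 * a))) *
      Complex.exp (((√2 * b * x - a * b : ℝ) : ℂ) * Complex.I) =
      Complex.exp ((-(1 / 2 : ℂ)) * (b : ℂ) ^ 2 + ((√2 * x - a : ℝ) * Complex.I) * b + 0) *
      ((starRingEnd ℂ) (u x) * w (x - √2 * a)) := by
    intro b
    rw [mul_right_comm, Complex.ofReal_exp, ← Complex.exp_add]
    congr 2
    push_cast
    ring
  simp_rw [h2]
  rw [integral_mul_const, integral_cexp_quadratic (by norm_num)]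
  congr 2
  · rw [Real.sqrt_eq_rpow, Complex.ofReal_cpow (by positivity)]
    congr 1
    · push_cast; ring
    · norm_num
  · rw [Complex.ofReal_exp]
    congr 1
    rw [mul_pow, Complex.I_sq]
    push_cast
    ring

/-- The vacuum projector is a Gaussian superposition of displacement operators. -/
theorem integral_gauss_mul_inner (u w : Mode) :
    ∫ ξ : ℂ, ((Real.exp (-‖ξ‖ ^ 2 / 2) : ℝ) : ℂ) * ⟪u, displacement ξ w⟫_ℂ =
      Real.pi * (⟪u, vacuum⟫_ℂ * ⟪vacuum, w⟫_ℂ) := by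
  have hmp := Complex.volume_preserving_equiv_real_prod.symm
  rw [← hmp.integral_comp Complex.measurableEquivRealProd.symm.measurableEmbedding]
  have hint := (hmp.integrable_comp_emb
    Complex.measurableEquivRealProd.symm.measurableEmbedding).mpr (integrable_gauss_mul_inner u w)
  rw [Measure.volume_eq_prod]
  refine (integral_prod _ hint).trans ?_
  have h1 : ∀ a b : ℝ, ((fun ξ : ℂ => ((Real.exp (-‖ξ‖ ^ 2 / 2) : ℝ) : ℂ) *
      ⟪u, displacement ξ w⟫_ℂ) ∘ Complex.measurableEquivRealProd.symm) (a, b) =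
      ((Real.exp (-a ^ 2 / 2) : ℝ) : ℂ) * (((Real.exp (-b ^ 2 / 2) : ℝ) : ℂ) *
        ⟪u, displacement ⟨a, b⟩ w⟫_ℂ) := by
    intro a b
    have e : Complex.measurableEquivRealProd.symm (a, b) = ⟨a, b⟩ := rfl
    rw [Function.comp_apply, e, ← mul_assoc, ← Complex.ofReal_mul, ← Real.exp_add,
      Complex.sq_norm, Complex.normSq_mk]
    congr 3
    ring
  simp_rw [h1, integral_const_mul, integral_im_displaceFun, ← integral_const_mul]
  -- Both exponents equal `-x² + √2 a x - a²`. In the second form the integrand is a function of `x`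
  -- times a function of `x - √2 a`, which is what `integral_shear` needs.
  have h2 : ∀ a x : ℝ, ((Real.exp (-a ^ 2 / 2) : ℝ) : ℂ) * ((√(2 * Real.pi) : ℂ) *
      ((Real.exp (-(√2 * x - a) ^ 2 / 2) : ℝ) : ℂ) *
        ((starRingEnd ℂ) (u x) * w (x - √2 * a))) =
      ((√(2 * Real.pi) : ℂ) * (((Real.exp (-x ^ 2 / 2) : ℝ) : ℂ) * (starRingEnd ℂ) (u x))) *
        (fun y : ℝ => ((Real.exp (-y ^ 2 / 2) : ℝ) : ℂ) * w y) (x - √2 * a) := by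
    intro a x
    have e : Real.exp (-a ^ 2 / 2) * Real.exp (-(√2 * x - a) ^ 2 / 2) =
        Real.exp (-x ^ 2 / 2) * Real.exp (-(x - √2 * a) ^ 2 / 2) := by
      rw [← Real.exp_add, ← Real.exp_add]
      congr 1
      have h2 : (√2 : ℝ) * √2 = 2 := Real.mul_self_sqrt (by norm_num)
      linear_combination (-(x ^ 2 / 2) + a ^ 2 / 2) * h2
    have e2 := congrArg (fun r : ℝ => (r : ℂ)) e
    push_cast at e2 ⊢
    linear_combination ((√(2 * Real.pi) : ℂ) * (starRingEnd ℂ) (u x) * w (x - √2 * a)) * e2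
  simp_rw [h2]
  have hi1 : Integrable fun x : ℝ => (√(2 * Real.pi) : ℂ) *
      (((Real.exp (-x ^ 2 / 2) : ℝ) : ℂ) * (starRingEnd ℂ) (u x)) := by
    refine Integrable.const_mul ?_ _
    have h := Complex.conjLIE.toContinuousLinearEquiv.toContinuousLinearMap.integrable_comp
      (integrable_exp_mul_coe u)
    refine h.congr (Filter.Eventually.of_forall fun x => ?_)
    refine (map_mul (starRingEnd ℂ) _ _).trans ?_
    rw [Complex.conj_ofReal]
  have hi2 := integrable_exp_mul_coe w
  have hm2 : StronglyMeasurable fun x : ℝ => ((Real.exp (-x ^ 2 / 2) : ℝ) : ℂ) * w x :=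
    StronglyMeasurable.mul (Continuous.stronglyMeasurable (by fun_prop)) (Lp.stronglyMeasurable w)
  refine (integral_shear hi1 hi2 hm2).trans ?_
  rw [integral_const_mul, inner_vacuum_right, inner_vacuum_left]
  have hs : ((√2 : ℝ) : ℂ) ≠ 0 := by norm_num
  have hpi : ((√(2 * Real.pi) : ℝ) : ℂ) = (√2 : ℝ) * Real.pi * (((Real.pi ^ (-(1 / 4) : ℝ) : ℝ) : ℂ)
      * ((Real.pi ^ (-(1 / 4) : ℝ) : ℝ) : ℂ)) := by
    norm_cast
    rw [← Real.rpow_add Real.pi_pos, mul_assoc, Real.sqrt_mul (by norm_num)]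
    congr 1
    nth_rewrite 2 [← Real.rpow_one Real.pi]
    rw [← Real.rpow_add Real.pi_pos, Real.sqrt_eq_rpow]
    norm_num
  rw [hpi]
  field_simp

theorem conj_displacement (β ξ : ℂ) (ψ : Mode) :
    displacement β (displacement ξ (displacement (-β) ψ)) =
      Complex.exp (((2 * (β.im * ξ.re - β.re * ξ.im) : ℝ) : ℂ) * Complex.I) •
        displacement ξ ψ := by
  rw [displacement_displacement ξ, map_smul, displacement_displacement, smul_smul,
    ← Complex.exp_add, ← add_mul, show β + (ξ + -β) = ξ by ring]
  congr 3
  norm_cast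
  simp only [Complex.neg_im, Complex.neg_re, Complex.add_im, Complex.add_re]
  ring

/-- Coherent states are total. -/
theorem eq_zero_of_inner_coherent {f : Mode} (hf : ∀ β, ⟪f, coherent β⟫_ℂ = 0) : f = 0 := by
  -- Conjugation by `D(β)` multiplies `D(ξ)` by a character, so the Fourier transform of `g` at the
  -- frequency matching `β` is `π |⟪f, coherent β⟫|²`. It vanishes everywhere, so inversion at the
  -- origin gives `‖f‖² = g 0 = 0`.
  let g : ℂ → ℂ := fun ξ => ((Real.exp (-‖ξ‖ ^ 2 / 2) : ℝ) : ℂ) * ⟪f, displacement ξ f⟫_ℂ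
  have hc : Continuous g := by
    refine Continuous.mul (by fun_prop) (continuous_inner_displacement f f)
  have hF : FourierTransform.fourier g = 0 := by
    ext1 w
    rw [Real.fourier_eq']
    let β : ℂ := ⟨Real.pi * w.im, -(Real.pi * w.re)⟩
    have h := integral_gauss_mul_inner (displacement (-β) f) (displacement (-β) f)
    rw [inner_displacement_left (-β) f vacuum, neg_neg] at h
    have h0 : ⟪f, displacement β vacuum⟫_ℂ = 0 := hf β
    rw [h0, zero_mul, mul_zero] at h
    rw [Pi.zero_apply, ← h]
    congr 1
    ext1 ξ
    rw [inner_displacement_left, neg_neg, conj_displacement, inner_smul_right, smul_eq_mul]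
    have e : -2 * Real.pi * ⟪ξ, w⟫_ℝ = 2 * (β.im * ξ.re - β.re * ξ.im) := by
      rw [Complex.inner]
      simp only [Complex.mul_re, Complex.conj_re, Complex.conj_im, β]
      ring
    rw [e]
    ring
  have hinv := hc.fourierInv_fourier_eq (integrable_gauss_mul_inner f f)
    (by rw [hF]; exact integrable_zero _ _ _)
  have h0 := congrFun hinv 0
  rw [hF, Real.fourierInv_eq'] at h0
  simpa [g] using h0.symm

theorem ext_inner_coherent {f g : Mode} (h : ∀ β, ⟪coherent β, f⟫_ℂ = ⟪coherent β, g⟫_ℂ) :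
    f = g := by
  rw [← sub_eq_zero]
  refine eq_zero_of_inner_coherent fun β => ?_
  rw [inner_sub_left, ← inner_conj_symm f, ← inner_conj_symm g, h, sub_self]

/-- Coherent-state matrix elements of `|u⟩⟨u|` become integrals of the diagonal quantities `⟪u, D(·)
u⟫`. After averaging over a mixture only its characteristic function is left. -/
theorem inner_coherent_mul_inner_coherent (β γ : ℂ) (u : Mode) :
    ⟪coherent β, u⟫_ℂ * ⟪u, coherent γ⟫_ℂ = (Real.pi : ℂ)⁻¹ *
      ∫ ξ : ℂ, ((Real.exp (-‖ξ‖ ^ 2 / 2) : ℝ) : ℂ) *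
        (Complex.exp (((ξ.im * (-β).re - ξ.re * (-β).im +
          (γ.im * (ξ - β).re - γ.re * (ξ - β).im) : ℝ) : ℂ) * Complex.I) *
          ⟪u, displacement (γ + (ξ - β)) u⟫_ℂ) := by
  have h := integral_gauss_mul_inner (displacement (-γ) u) (displacement (-β) u)
  rw [inner_displacement_left (-γ) u vacuum, inner_displacement_right (-β), neg_neg, neg_neg] at h
  rw [eq_inv_mul_iff_mul_eq₀ (by exact_mod_cast Real.pi_ne_zero),
    mul_comm ⟪coherent β, u⟫_ℂ]
  refine h.symm.trans ?_
  congr 1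
  ext1 ξ
  rw [inner_displacement_left, neg_neg, displacement_displacement ξ, map_smul,
    displacement_displacement, smul_smul, inner_smul_right, ← Complex.exp_add, ← add_mul]
  push_cast [sub_eq_add_neg]
  rfl

section

variable {A : Type*} [MeasurableSpace A] {m : Measure A} [SFinite m] {v : A → Mode}

theorem integral_inner_coherent (hv : AEStronglyMeasurable v m)
    (hi : Integrable (fun a => ‖v a‖ ^ 2) m) (β γ : ℂ) :
    ∫ a, ⟪coherent β, v a⟫_ℂ * ⟪v a, coherent γ⟫_ℂ ∂m = (Real.pi : ℂ)⁻¹ *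
      ∫ ξ : ℂ, ((Real.exp (-‖ξ‖ ^ 2 / 2) : ℝ) : ℂ) *
        (Complex.exp (((ξ.im * (-β).re - ξ.re * (-β).im +
          (γ.im * (ξ - β).re - γ.re * (ξ - β).im) : ℝ) : ℂ) * Complex.I) *
          ∫ a, ⟪v a, displacement (γ + (ξ - β)) (v a)⟫_ℂ ∂m) := by
  simp_rw [inner_coherent_mul_inner_coherent, integral_const_mul]
  congr 1
  rw [integral_integral_swap]
  · simp_rw [integral_const_mul]
  · refine (hi.mul_prod integrable_gauss).mono ?_ ?_
    · have h1 : AEStronglyMeasurable (fun p : A × ℂ => v p.1) (m.prod volume) := hv.comp_fst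
      have h2 : AEStronglyMeasurable (fun p : A × ℂ => (γ + (p.2 - β), v p.1)) (m.prod volume) :=
        AEStronglyMeasurable.prodMk (Measurable.aestronglyMeasurable (by fun_prop)) h1
      have h3 := continuous_displacement_uncurry.comp_aestronglyMeasurable h2
      refine AEStronglyMeasurable.mul ?_ (AEStronglyMeasurable.mul ?_ (h1.inner h3))
      · exact Measurable.aestronglyMeasurable (by fun_prop)
      · exact Measurable.aestronglyMeasurable (by fun_prop)
    · refine Filter.Eventually.of_forall fun p => ?_
      simp only [Function.uncurry, norm_mul, Complex.norm_exp_ofReal_mul_I, one_mul,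
        Complex.norm_real, Real.norm_eq_abs, Real.abs_exp]
      rw [abs_of_nonneg (by positivity), mul_comm]
      gcongr
      simpa [sq] using norm_inner_displacement_le (v p.1) (v p.1) _

end

/-- An operator with a mixture representation is classical as soon as its characteristic function
is that of a mixture of coherent states. -/
theorem isClassical_of_integral_eq {A : Type*} [MeasurableSpace A] {m : Measure A} [SFinite m]
    {v : A → Mode} {σ : Mode →L[ℂ] Mode} (hσ : IsMixture m v σ) (hs : σ.IsPositive)
    {μ : Measure ℂ} [IsProbabilityMeasure μ]
    (h : ∀ ξ : ℂ, ∫ a, ⟪v a, displacement ξ (v a)⟫_ℂ ∂m =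
      ∫ α, ⟪coherent α, displacement ξ (coherent α)⟫_ℂ ∂μ) : IsClassical σ := by
  refine ⟨μ, inferInstance, ?_⟩
  have hcoh : ∀ β γ, ⟪coherent β, σ (coherent γ)⟫_ℂ =
      ∫ α, ⟪coherent β, coherent α⟫_ℂ * ⟪coherent α, coherent γ⟫_ℂ ∂μ := by
    intro β γ
    rw [hσ.inner_eq, integral_inner_coherent hσ.meas hσ.integrable_sq,
      integral_inner_coherent continuous_coherent.aestronglyMeasurable (by simp)]
    simp_rw [h]
  have hint : ∀ g : Mode, Integrable (fun α => ⟪coherent α, g⟫_ℂ • coherent α) μ := by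
    intro g
    refine Integrable.of_bound (C := ‖g‖) ?_ (Filter.Eventually.of_forall fun α => ?_)
    · exact ((Continuous.inner (𝕜 := ℂ) continuous_coherent continuous_const).smul
        continuous_coherent).aestronglyMeasurable
    · rw [norm_smul, norm_coherent, mul_one]
      simpa using norm_inner_le_norm (𝕜 := ℂ) (coherent α) g
  have hin : ∀ f g : Mode, ⟪f, ∫ α, ⟪coherent α, g⟫_ℂ • coherent α ∂μ⟫_ℂ =
      ∫ α, ⟪f, coherent α⟫_ℂ * ⟪coherent α, g⟫_ℂ ∂μ := by
    intro f g
    rw [← integral_inner (hint g)]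
    simp_rw [inner_smul_right, mul_comm]
  -- Totality of coherent states is used twice: once to identify `σ` on coherent vectors, then,
  -- through self-adjointness, to identify it on every vector.
  have h1 : ∀ γ, σ (coherent γ) = ∫ α, ⟪coherent α, coherent γ⟫_ℂ • coherent α ∂μ := fun γ =>
    ext_inner_coherent fun β => by rw [hcoh, hin]
  have h2 : ∀ g, σ g = ∫ α, ⟪coherent α, g⟫_ℂ • coherent α ∂μ := fun g =>
    ext_inner_coherent fun β => by
      rw [hin, ← hs.isSymmetric.apply_clm, h1, ← inner_conj_symm, hin, ← integral_conj]
      simp_rw [map_mul, inner_conj_symm, mul_comm]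
  intro f g
  rw [h2, hin]

end SingleMode

/-! ### Bochner's theorem -/

namespace SingleMode

section Bochner

/-- Positive definite functions on an additive group. -/
def IsPosDefFun {V : Type*} [AddGroup V] (φ : V → ℂ) : Prop :=
  ∀ (n : ℕ) (x : Fin n → V), (Matrix.of fun i j => φ (x i - x j)).PosSemidef

/-- The determinant of the `2 × 2` matrix at the points `t, 0` is `1 - ‖φ t‖ ^ 2`. -/
theorem IsPosDefFun.norm_le_one {V : Type*} [AddGroup V] {φ : V → ℂ} (h : IsPosDefFun φ)
    (h0 : φ 0 = 1) (t : V) : ‖φ t‖ ≤ 1 := by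
  have hp := h 2 ![t, 0]
  have h1 : φ (-t) = (starRingEnd ℂ) (φ t) := by
    have := hp.1.apply 1 0
    simpa using this.symm
  have h2 := hp.det_nonneg
  rw [Matrix.det_fin_two] at h2
  simp only [Matrix.of_apply, Matrix.cons_val_zero, Matrix.cons_val_one, sub_self, h0, sub_zero,
    zero_sub, h1, RCLike.mul_conj, mul_one] at h2
  have h3 : (0 : ℝ) ≤ 1 - ‖φ t‖ ^ 2 := by
    refine Complex.zero_le_real.mp (h2.trans_eq ?_)
    norm_num
  nlinarith [norm_nonneg (φ t)]

theorem IsPosDefFun.mul_char {V : Type*} [AddGroup V] {φ : V → ℂ} (h : IsPosDefFun φ)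
    {e : V → ℂ} (he : ∀ x y, e (x - y) = e x * (starRingEnd ℂ) (e y)) :
    IsPosDefFun fun x => φ x * e x := by
  intro n x
  have h1 := (h n x).hadamard (Matrix.posSemidef_vecMulVec_self_star fun i => e (x i))
  refine (congrArg Matrix.PosSemidef ?_).mp h1
  ext i j
  simp [Matrix.vecMulVec_apply, he]

theorem IsPosDefFun.sum_nonneg {V : Type*} [AddGroup V] {φ : V → ℂ} (h : IsPosDefFun φ)
    (n : ℕ) (x : Fin n → V) : 0 ≤ ∑ i, ∑ j, φ (x i - x j) := by
  have := (h n x).dotProduct_mulVec_nonneg (fun _ => 1)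
  simpa [dotProduct, mulVec] using this

/-- A positive definite kernel has nonnegative mean with respect to any product `ν × ν`. -/
theorem integral_integral_nonneg_of_sum_nonneg {V : Type*} [MeasurableSpace V] (ν : Measure V)
    [IsProbabilityMeasure ν] {k : V → V → ℂ} (hk : StronglyMeasurable (Function.uncurry k)) {C : ℝ}
    (hC : ∀ x y, ‖k x y‖ ≤ C) (hd : ∀ x, k x x = 1)
    (hpos : ∀ (n : ℕ) (x : Fin n → V), 0 ≤ ∑ i, ∑ j, k (x i) (x j)) :
    0 ≤ ∫ x, ∫ y, k x y ∂ν ∂ν := by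
  set z := ∫ x, ∫ y, k x y ∂ν ∂ν with hz
  have hint : Integrable (Function.uncurry k) (ν.prod ν) :=
    Integrable.of_bound hk.aestronglyMeasurable C (Filter.Eventually.of_forall fun p => hC p.1 p.2)
  -- The quadratic form is averaged over `n` independent points of law `ν`: each off-diagonal pair
  -- contributes `z`, each diagonal term `1`.
  have key : ∀ n : ℕ, 0 ≤ (n : ℂ) * ((n : ℂ) - 1) * z + n := by
    intro n
    let P : Measure (Fin n → V) := Measure.pi fun _ => ν
    have hmp : ∀ i j : Fin n, i ≠ j →
        MeasurePreserving (fun x : Fin n → V => (x i, x j)) P (ν.prod ν) := by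
      intro i j hij
      have hind := (ProbabilityTheory.iIndepFun_pi (μ := fun _ : Fin n => ν)
        (X := fun _ : Fin n => (id : V → V)) (fun _ => aemeasurable_id)).indepFun hij
      have hmap := (ProbabilityTheory.indepFun_iff_map_prod_eq_prod_map_map
        (measurable_pi_apply i).aemeasurable (measurable_pi_apply j).aemeasurable).mp hind
      refine ⟨by fun_prop, hmap.trans ?_⟩
      have he : ∀ i : Fin n, P.map (fun x => x i) = ν := fun i =>
        (measurePreserving_eval (fun _ : Fin n => ν) i).map_eq
      exact congrArg₂ Measure.prod (he i) (he j)
    have h1 : ∀ i j : Fin n, Integrable (fun x => k (x i) (x j)) P := by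
      intro i j
      by_cases hij : i = j
      · subst hij
        simp [hd]
      · exact (hmp i j hij).integrable_comp_of_integrable hint
    have h2 : ∀ i j : Fin n, ∫ x, k (x i) (x j) ∂P = if i = j then 1 else z := by
      intro i j
      split_ifs with hij
      · subst hij
        simp [hd]
      · refine Eq.trans ?_ (integral_prod _ hint)
        rw [← (hmp i j hij).map_eq,
          integral_map (hmp i j hij).measurable.aemeasurable hk.aestronglyMeasurable]
        rfl
    have h3 : 0 ≤ ∫ x, ∑ i, ∑ j, k (x i) (x j) ∂P :=
      integral_nonneg fun x => hpos n x
    rw [integral_finsetSum _ fun i _ => integrable_finsetSum _ fun j _ => h1 i j] at h3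
    simp_rw [fun i => integral_finsetSum Finset.univ fun j _ => h1 i j, h2] at h3
    have h4 : ∑ i : Fin n, ∑ j : Fin n, (if i = j then (1 : ℂ) else z) =
        (n : ℂ) * ((n : ℂ) - 1) * z + n := by
      have : ∀ i j : Fin n, (if i = j then (1 : ℂ) else z) = z + if i = j then 1 - z else 0 := by
        intro i j; split_ifs <;> ring
      simp_rw [this, Finset.sum_add_distrib]
      simp
      ring
    rwa [h4] at h3
  have hlim : Filter.Tendsto (fun n : ℕ => z + ((n : ℂ) + 1)⁻¹) Filter.atTop (nhds (z + 0)) := by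
    refine tendsto_const_nhds.add ?_
    have := tendsto_one_div_add_atTop_nhds_zero_nat (𝕜 := ℂ)
    simpa using this
  rw [add_zero] at hlim
  refine ge_of_tendsto' hlim fun n => ?_
  -- Dividing by `(n + 2) (n + 1)`, which never vanishes, leaves `z + 1 / (n + 1)`.
  have h := key (n + 2)
  have h2 : (0 : ℂ) ≤ (((((n : ℝ) + 2) * ((n : ℝ) + 1))⁻¹ : ℝ) : ℂ) :=
    Complex.zero_le_real.mpr (by positivity)
  have h3 := mul_nonneg h2 h
  have e1 : ((n : ℂ) + 1) ≠ 0 := by exact_mod_cast n.succ_ne_zero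
  have e2 : ((n : ℂ) + 2) ≠ 0 := by exact_mod_cast (n + 1).succ_ne_zero
  refine h3.trans_eq ?_
  push_cast
  field_simp
  ring

variable {V : Type*} [NormedAddCommGroup V] [InnerProductSpace ℝ V] [FiniteDimensional ℝ V]
  [MeasurableSpace V] [BorelSpace V]

theorem integrable_exp_neg_mul_norm_sq {c : ℝ} (hc : 0 < c) :
    Integrable fun x : V => Real.exp (-c * ‖x‖ ^ 2) := by
  have h := (GaussianFourier.integrable_cexp_neg_mul_sq_norm_add (V := V) (b := (c : ℂ))
    (by simpa using hc) 0 0).norm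
  refine h.congr (Filter.Eventually.of_forall fun ξ => ?_)
  simp only [zero_mul, add_zero, Complex.norm_exp]
  congr 1
  norm_cast

theorem integral_exp_neg_mul_norm_sq_pos {c : ℝ} (hc : 0 < c) :
    0 < ∫ x : V, Real.exp (-c * ‖x‖ ^ 2) := by
  rw [GaussianFourier.integral_rexp_neg_mul_sq_norm hc]
  positivity

/-- With `x = y + u`, the identity `2c‖y + u‖² + 2c‖y‖² = 4c‖y + u/2‖² + c‖u‖²` separates the
variables: the difference of two independent Gaussians is Gaussian. -/
theorem integral_gauss_convolution {ψ : V → ℂ} (hψ : Continuous ψ) {C : ℝ}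
    (hC : ∀ x, ‖ψ x‖ ≤ C) {c : ℝ} (hc : 0 < c) :
    ∫ y : V, ∫ x : V, ((Real.exp (-(2 * c) * ‖x‖ ^ 2) * Real.exp (-(2 * c) * ‖y‖ ^ 2) : ℝ) : ℂ) *
        ψ (x - y) =
      ((∫ y : V, Real.exp (-(4 * c) * ‖y‖ ^ 2) : ℝ) : ℂ) *
        ∫ u : V, ((Real.exp (-c * ‖u‖ ^ 2) : ℝ) : ℂ) * ψ u := by
  have hg := integrable_exp_neg_mul_norm_sq (V := V) (c := 2 * c) (by positivity)
  have hint : Integrable (fun p : V × V => ((Real.exp (-(2 * c) * ‖p.2‖ ^ 2) *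
      Real.exp (-(2 * c) * ‖p.1‖ ^ 2) : ℝ) : ℂ) * ψ (p.2 - p.1)) (volume.prod volume) := by
    refine Integrable.mul_bdd (c := C) ?_ ?_ (Filter.Eventually.of_forall fun p => hC _)
    · refine ((hg.mul_prod hg).congr (Filter.Eventually.of_forall fun p => ?_)).ofReal
      exact mul_comm _ _
    · exact Continuous.aestronglyMeasurable (by fun_prop)
  have hint2 := (measurePreserving_prod_add (volume : Measure V)
    (volume : Measure V)).integrable_comp_of_integrable hint
  have h1 : ∀ y : V, ∫ x : V, ((Real.exp (-(2 * c) * ‖x‖ ^ 2) *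
      Real.exp (-(2 * c) * ‖y‖ ^ 2) : ℝ) : ℂ) * ψ (x - y) =
      ∫ u : V, ((Real.exp (-(2 * c) * ‖y + u‖ ^ 2) *
      Real.exp (-(2 * c) * ‖y‖ ^ 2) : ℝ) : ℂ) * ψ (y + u - y) := fun y =>
    (integral_add_left_eq_self (fun x => ((Real.exp (-(2 * c) * ‖x‖ ^ 2) *
      Real.exp (-(2 * c) * ‖y‖ ^ 2) : ℝ) : ℂ) * ψ (x - y)) y).symm
  simp_rw [h1]
  rw [integral_integral_swap (f := fun y u : V => ((Real.exp (-(2 * c) * ‖y + u‖ ^ 2) *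
      Real.exp (-(2 * c) * ‖y‖ ^ 2) : ℝ) : ℂ) * ψ (y + u - y)) hint2, ← integral_const_mul]
  congr 1
  ext1 u
  have h2 : ∀ y : V, ((Real.exp (-(2 * c) * ‖y + u‖ ^ 2) *
      Real.exp (-(2 * c) * ‖y‖ ^ 2) : ℝ) : ℂ) * ψ (y + u - y) =
      ((Real.exp (-(4 * c) * ‖y + (1 / 2 : ℝ) • u‖ ^ 2) : ℝ) : ℂ) *
        (((Real.exp (-c * ‖u‖ ^ 2) : ℝ) : ℂ) * ψ u) := by
    intro y
    rw [← mul_assoc, ← Complex.ofReal_mul, ← Real.exp_add, ← Real.exp_add, add_sub_cancel_left]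
    congr 3
    rw [norm_add_sq_real, norm_add_sq_real, norm_smul, inner_smul_right]
    norm_num
    ring
  simp_rw [h2]
  rw [integral_mul_const, ← integral_complex_ofReal,
    integral_add_right_eq_self (fun y : V => ((Real.exp (-(4 * c) * ‖y‖ ^ 2) : ℝ) : ℂ))]

/-- Up to a positive constant the integral is the mean of `φ (x - y)` over independent Gaussian `x`,
`y`. -/
theorem IsPosDefFun.integral_gauss_mul_nonneg {φ : V → ℂ} (h : IsPosDefFun φ) (hφ : Continuous φ)
    (h0 : φ 0 = 1) {c : ℝ} (hc : 0 < c) :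
    0 ≤ ∫ u : V, ((Real.exp (-c * ‖u‖ ^ 2) : ℝ) : ℂ) * φ u := by
  have hI := integral_exp_neg_mul_norm_sq_pos (V := V) (c := 2 * c) (by positivity)
  have hJ := integral_exp_neg_mul_norm_sq_pos (V := V) (c := 4 * c) (by positivity)
  set I := ∫ x : V, Real.exp (-(2 * c) * ‖x‖ ^ 2) with hIdef
  have hgi := integrable_exp_neg_mul_norm_sq (V := V) (c := 2 * c) (by positivity)
  let g : V → NNReal := fun x => ⟨Real.exp (-(2 * c) * ‖x‖ ^ 2) / I, by positivity⟩
  have hgm : Measurable g := by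
    refine Measurable.subtype_mk ?_
    fun_prop
  let ν : Measure V := volume.withDensity fun x => (g x : ℝ≥0∞)
  have hν : IsProbabilityMeasure ν := by
    constructor
    rw [withDensity_apply _ MeasurableSet.univ, Measure.restrict_univ]
    have : ∀ x, (g x : ℝ≥0∞) = ENNReal.ofReal (Real.exp (-(2 * c) * ‖x‖ ^ 2) / I) := by
      intro x
      rw [ENNReal.ofReal, Real.toNNReal_of_nonneg (by positivity)]
      rfl
    simp_rw [this]
    rw [← ofReal_integral_eq_lintegral_ofReal (hgi.div_const I)
      (Filter.Eventually.of_forall fun x => by positivity), integral_div, div_self hI.ne']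
    simp
  have hmain := integral_integral_nonneg_of_sum_nonneg ν (k := fun y x => φ (x - y)) (C := 1)
    (Continuous.stronglyMeasurable (by fun_prop)) (fun x y => h.norm_le_one h0 _)
    (fun x => by simp [h0]) (fun n x => by
      rw [Finset.sum_comm]
      exact h.sum_nonneg n x)
  have e1 : ∫ y, ∫ x, φ (x - y) ∂ν ∂ν = (((I ^ 2)⁻¹ *
      ∫ y : V, Real.exp (-(4 * c) * ‖y‖ ^ 2) : ℝ) : ℂ) *
      ∫ u : V, ((Real.exp (-c * ‖u‖ ^ 2) : ℝ) : ℂ) * φ u := by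
    rw [Complex.ofReal_mul, mul_assoc, ← integral_gauss_convolution hφ (h.norm_le_one h0) hc,
      ← integral_const_mul]
    have hgs : ∀ (x : V) (z : ℂ), g x • z = ((Real.exp (-(2 * c) * ‖x‖ ^ 2) / I : ℝ) : ℂ) * z :=
      fun x z => Complex.real_smul
    simp only [ν]
    rw [integral_withDensity_eq_integral_smul hgm]
    congr 1
    ext1 y
    rw [integral_withDensity_eq_integral_smul hgm, ← integral_const_mul, hgs,
      ← integral_const_mul]
    congr 1
    ext1 x
    rw [hgs]
    push_cast
    field_simp
  rw [e1] at hmain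
  have hpos : (0 : ℝ) < (I ^ 2)⁻¹ * ∫ y : V, Real.exp (-(4 * c) * ‖y‖ ^ 2) := by positivity
  have h3 := mul_nonneg (Complex.zero_le_real.mpr (inv_pos.mpr hpos).le) hmain
  rwa [← mul_assoc, ← Complex.ofReal_mul, inv_mul_cancel₀ hpos.ne', Complex.ofReal_one,
    one_mul] at h3

/-- Multiplying by a character preserves positive definiteness, so every frequency reduces to the
integral at frequency zero. -/
theorem fourier_gauss_mul_nonneg {φ : V → ℂ} (h : IsPosDefFun φ) (hφ : Continuous φ)
    (h0 : φ 0 = 1) {c : ℝ} (hc : 0 < c) (w : V) :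
    0 ≤ FourierTransform.fourier (fun u : V => ((Real.exp (-c * ‖u‖ ^ 2) : ℝ) : ℂ) * φ u) w := by
  let e : V → ℂ := fun u => Complex.exp (((-2 * Real.pi * ⟪u, w⟫_ℝ : ℝ) : ℂ) * Complex.I)
  have he : ∀ x y, e (x - y) = e x * (starRingEnd ℂ) (e y) := by
    intro x y
    simp only [e, ← Complex.exp_conj, ← Complex.exp_add, map_mul, Complex.conj_ofReal,
      Complex.conj_I, inner_sub_left]
    congr 1
    push_cast
    ring
  have h1 := (h.mul_char he).integral_gauss_mul_nonneg (by fun_prop) (by simp [e, h0]) hc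
  rw [Real.fourier_eq']
  refine h1.trans_eq ?_
  congr 1
  ext1 u
  simp only [e, smul_eq_mul]
  ring

theorem integral_norm_fourier_gauss {b : ℝ} (hb : 0 < b) :
    ∫ w : V, ‖FourierTransform.fourier (fun u : V => Complex.exp (-(b : ℂ) * ‖u‖ ^ 2)) w‖ = 1 := by
  have hn : ∀ w : V, ‖FourierTransform.fourier
      (fun u : V => Complex.exp (-(b : ℂ) * ‖u‖ ^ 2)) w‖ =
      (Real.pi / b) ^ (Module.finrank ℝ V / 2 : ℝ) * Real.exp (-(Real.pi ^ 2 / b) * ‖w‖ ^ 2) := by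
    intro w
    rw [fourier_gaussian_innerProductSpace (by simpa using hb), norm_mul]
    congr 1
    · have : ((Real.pi : ℂ) / b) ^ (Module.finrank ℝ V / 2 : ℂ) =
          (((Real.pi / b) ^ (Module.finrank ℝ V / 2 : ℝ) : ℝ) : ℂ) := by
        rw [Complex.ofReal_cpow (by positivity)]
        push_cast
        rfl
      rw [this, Complex.norm_real, Real.norm_of_nonneg (by positivity)]
    · rw [Complex.norm_exp]
      congr 1
      rw [show (-(Real.pi : ℂ) ^ 2 * ‖w‖ ^ 2 / b) = ((-(Real.pi ^ 2 / b) * ‖w‖ ^ 2 : ℝ) : ℂ) by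
        push_cast; ring, Complex.ofReal_re]
  simp_rw [hn]
  rw [integral_const_mul, GaussianFourier.integral_rexp_neg_mul_sq_norm (by positivity),
    ← Real.mul_rpow (by positivity) (by positivity)]
  have : Real.pi / b * (Real.pi / (Real.pi ^ 2 / b)) = 1 := by
    field_simp
  rw [this, Real.one_rpow]

theorem integrable_gauss_mul {φ : V → ℂ} (h : IsPosDefFun φ) (hφ : Continuous φ)
    (h0 : φ 0 = 1) {c : ℝ} (hc : 0 < c) :
    Integrable fun u : V => ((Real.exp (-c * ‖u‖ ^ 2) : ℝ) : ℂ) * φ u :=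
  (integrable_exp_neg_mul_norm_sq hc).ofReal.mul_bdd (c := 1) hφ.aestronglyMeasurable
    (Filter.Eventually.of_forall fun u => h.norm_le_one h0 u)

theorem continuous_fourier_of_integrable {f : V → ℂ} (hf : Integrable f) :
    Continuous (FourierTransform.fourier f) :=
  VectorFourier.fourierIntegral_continuous Real.continuous_fourierChar
    (by exact continuous_inner) hf

/-- A nonnegative Fourier transform of a bounded integrable function is integrable. By duality, its
integral against a Gaussian equals the integral of `f` against the transform of that Gaussian, which
has `L¹` norm one. The bound is therefore uniform in the width. -/
theorem integrable_fourier_gauss_mul {φ : V → ℂ} (h : IsPosDefFun φ) (hφ : Continuous φ)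
    (h0 : φ 0 = 1) {c : ℝ} (hc : 0 < c) :
    Integrable (FourierTransform.fourier
      (fun u : V => ((Real.exp (-c * ‖u‖ ^ 2) : ℝ) : ℂ) * φ u)) := by
  set f : V → ℂ := fun u : V => ((Real.exp (-c * ‖u‖ ^ 2) : ℝ) : ℂ) * φ u with hf
  have hfi : Integrable f := integrable_gauss_mul h hφ h0 hc
  have hfn : ∀ u, ‖f u‖ ≤ 1 := by
    intro u
    rw [hf, norm_mul, Complex.norm_real, Real.norm_of_nonneg (by positivity)]
    exact mul_le_one₀ (Real.exp_le_one_iff.mpr (by nlinarith [sq_nonneg ‖u‖])) (norm_nonneg _)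
      (h.norm_le_one h0 u)
  have hcont := continuous_fourier_of_integrable hfi
  have hnn := fourier_gauss_mul_nonneg h hφ h0 hc
  have hnorm : ∀ w, FourierTransform.fourier f w = ((‖FourierTransform.fourier f w‖ : ℝ) : ℂ) :=
    fun w => (Complex.eq_coe_norm_of_nonneg (hnn w))
  rw [← integrable_norm_iff hcont.aestronglyMeasurable]
  have hb : ∀ b : ℝ, 0 < b →
      ∫ w : V, Real.exp (-b * ‖w‖ ^ 2) * ‖FourierTransform.fourier f w‖ ≤ 1 := by
    intro b hb
    have hgi : Integrable fun u : V => Complex.exp (-(b : ℂ) * ‖u‖ ^ 2) := by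
      simpa using GaussianFourier.integrable_cexp_neg_mul_sq_norm_add (V := V) (b := (b : ℂ))
        (by simpa using hb) 0 0
    have hflip := VectorFourier.integral_fourierIntegral_smul_eq_flip (L := innerₗ V)
      (μ := volume) (ν := volume) Real.continuous_fourierChar continuous_inner hgi hfi
    have hflip2 : ∫ w : V, FourierTransform.fourier
        (fun u : V => Complex.exp (-(b : ℂ) * ‖u‖ ^ 2)) w • f w =
        ∫ w : V, Complex.exp (-(b : ℂ) * ‖w‖ ^ 2) • FourierTransform.fourier f w := by
      simpa using! hflip
    have hr : ((∫ w : V, Real.exp (-b * ‖w‖ ^ 2) * ‖FourierTransform.fourier f w‖ : ℝ) : ℂ) =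
        ∫ w : V, FourierTransform.fourier
        (fun u : V => Complex.exp (-(b : ℂ) * ‖u‖ ^ 2)) w • f w := by
      rw [hflip2, ← integral_complex_ofReal]
      congr 1
      ext1 w
      rw [smul_eq_mul, Complex.ofReal_mul, ← hnorm]
      push_cast
      rfl
    refine (Real.le_norm_self _).trans ?_
    rw [← Complex.norm_real, hr, ← integral_norm_fourier_gauss (V := V) hb]
    refine norm_integral_le_of_norm_le ?_ (Filter.Eventually.of_forall fun w => ?_)
    · refine Integrable.of_integral_ne_zero ?_
      rw [integral_norm_fourier_gauss hb]
      exact one_ne_zero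
    · rw [norm_smul]
      exact mul_le_of_le_one_right (norm_nonneg _) (hfn w)
  have hcov : AECover volume Filter.atTop fun n : ℕ => Metric.ball (0 : V) n :=
    aecover_ball tendsto_natCast_atTop_atTop
  refine hcov.integrable_of_integral_bounded_of_nonneg_ae (Real.exp 1) (fun n => ?_)
    (Filter.Eventually.of_forall fun w => norm_nonneg _) ?_
  · exact (hcont.norm.locallyIntegrable.integrableOn_isCompact
      (isCompact_closedBall 0 n)).mono_set Metric.ball_subset_closedBall
  · filter_upwards [Filter.eventually_gt_atTop 0] with n hn
    have hn' : (0 : ℝ) < n := by exact_mod_cast hn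
    -- With `b = n⁻²` the Gaussian weight is at least `e⁻¹` on the ball of radius `n`, whence the
    -- bound `exp 1` on every ball.
    have hpos : (0 : ℝ) < ((n : ℝ) ^ 2)⁻¹ := by positivity
    have hbd : Integrable fun w : V => Real.exp 1 *
        (Real.exp (-((n : ℝ) ^ 2)⁻¹ * ‖w‖ ^ 2) * ‖FourierTransform.fourier f w‖) := by
      refine Integrable.const_mul ?_ _
      refine (integrable_exp_neg_mul_norm_sq hpos).mul_bdd (c := ∫ u, ‖f u‖)
        hcont.norm.aestronglyMeasurable (Filter.Eventually.of_forall fun w => ?_)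
      rw [norm_norm]
      exact VectorFourier.norm_fourierIntegral_le_integral_norm _ _ _ _ _
    calc ∫ w in Metric.ball (0 : V) n, ‖FourierTransform.fourier f w‖
        ≤ ∫ w in Metric.ball (0 : V) n, Real.exp 1 *
          (Real.exp (-((n : ℝ) ^ 2)⁻¹ * ‖w‖ ^ 2) * ‖FourierTransform.fourier f w‖) := by
          refine setIntegral_mono_on ?_ hbd.integrableOn Metric.isOpen_ball.measurableSet ?_
          · exact (hcont.norm.locallyIntegrable.integrableOn_isCompact
              (isCompact_closedBall 0 n)).mono_set Metric.ball_subset_closedBall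
          · intro w hw
            rw [← mul_assoc, ← Real.exp_add]
            refine le_mul_of_one_le_left (norm_nonneg _) (Real.one_le_exp ?_)
            have h1 : ‖w‖ < n := by simpa using hw
            have h2 : ((n : ℝ) ^ 2)⁻¹ * ‖w‖ ^ 2 ≤ 1 := by
              rw [inv_mul_le_iff₀ (by positivity), mul_one]
              gcongr
            linarith
      _ ≤ ∫ w : V, Real.exp 1 *
          (Real.exp (-((n : ℝ) ^ 2)⁻¹ * ‖w‖ ^ 2) * ‖FourierTransform.fourier f w‖) :=
          setIntegral_le_integral hbd (Filter.Eventually.of_forall fun w => by positivity)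
      _ ≤ Real.exp 1 := by
          rw [integral_const_mul]
          exact mul_le_of_le_one_right (Real.exp_pos 1).le (hb _ hpos)

theorem exists_charFun_eq_gauss_mul {φ : V → ℂ} (h : IsPosDefFun φ) (hφ : Continuous φ)
    (h0 : φ 0 = 1) {c : ℝ} (hc : 0 < c) : ∃ μ : ProbabilityMeasure V,
      ∀ t, charFun (μ : Measure V) t = ((Real.exp (-c * ‖t‖ ^ 2) : ℝ) : ℂ) * φ t := by
  set f : V → ℂ := fun u : V => ((Real.exp (-c * ‖u‖ ^ 2) : ℝ) : ℂ) * φ u with hf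
  have hfi : Integrable f := integrable_gauss_mul h hφ h0 hc
  have hFi : Integrable (FourierTransform.fourier f) := integrable_fourier_gauss_mul h hφ h0 hc
  have hinv := (show Continuous f by fun_prop).fourierInv_fourier_eq hfi hFi
  have hcont := continuous_fourier_of_integrable hfi
  have hnorm : ∀ w, FourierTransform.fourier f w = ((‖FourierTransform.fourier f w‖ : ℝ) : ℂ) :=
    fun w => (Complex.eq_coe_norm_of_nonneg (fourier_gauss_mul_nonneg h hφ h0 hc w))
  -- Fourier inversion says that the measure with density the (nonnegative) transform of `f` has
  -- characteristic function `f`, once the `2π` of the Fourier convention is absorbed by a dilation.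
  let ν : Measure V := volume.withDensity fun w => (‖FourierTransform.fourier f w‖₊ : ℝ≥0∞)
  have hchar : ∀ t, charFun (ν.map fun x => (2 * Real.pi) • x) t = f t := by
    intro t
    rw [charFun_map_smul, charFun_apply, ← congrFun hinv t, Real.fourierInv_eq']
    simp only [ν]
    rw [integral_withDensity_eq_integral_smul hcont.nnnorm.measurable]
    congr 1
    ext1 w
    rw [NNReal.smul_def, coe_nnnorm, Complex.real_smul, ← hnorm, smul_eq_mul, mul_comm,
      inner_smul_right]
  have hprob : IsProbabilityMeasure (ν.map fun x => (2 * Real.pi) • x) := by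
    have h1 := hchar 0
    rw [charFun_zero, hf] at h1
    simp only [norm_zero, h0] at h1
    constructor
    rw [← ENNReal.toReal_eq_one_iff]
    exact_mod_cast (by simpa using h1 :
      (((ν.map fun x => (2 * Real.pi) • x).real Set.univ : ℝ) : ℂ) = 1)
  exact ⟨⟨_, hprob⟩, hchar⟩

/-- **Bochner's theorem** on a finite-dimensional inner product space. -/
theorem IsPosDefFun.exists_charFun_eq {φ : V → ℂ} (h : IsPosDefFun φ) (hφ : Continuous φ)
    (h0 : φ 0 = 1) : ∃ μ : ProbabilityMeasure V, ∀ t, charFun (μ : Measure V) t = φ t := by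
  have hpos : ∀ n : ℕ, (0 : ℝ) < 1 / ((n : ℝ) + 1) := fun n => by positivity
  -- The Gaussian damping is removed by a weak limit. Pointwise convergence to a function continuous
  -- at `0` gives tightness, and an ultrafilter limit replaces the choice of a subsequence.
  choose μ hμ using fun n : ℕ => exists_charFun_eq_gauss_mul h hφ h0 (hpos n)
  have hlim : ∀ t, Filter.Tendsto (fun n => charFun (μ n : Measure V) t) Filter.atTop
      (nhds (φ t)) := by
    intro t
    simp_rw [hμ]
    have h1 : Filter.Tendsto (fun n : ℕ => ((Real.exp (-(1 / ((n : ℝ) + 1)) * ‖t‖ ^ 2) : ℝ) : ℂ))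
        Filter.atTop (nhds ((Real.exp (-0 * ‖t‖ ^ 2) : ℝ) : ℂ)) := by
      have h2 := tendsto_one_div_add_atTop_nhds_zero_nat (𝕜 := ℝ)
      exact (Complex.continuous_ofReal.tendsto _).comp ((Real.continuous_exp.tendsto _).comp
        (h2.neg.mul_const _))
    simpa using h1.mul_const (φ t)
  have htight := isTightMeasureSet_of_tendsto_charFun (μ := fun n => (μ n : Measure V))
    hφ.continuousAt hlim
  have hcpt : IsCompact (closure (Set.range μ)) := by
    refine isCompact_closure_of_isTightMeasureSet ?_
    convert htight using 1
    ext ν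
    simp
  obtain ⟨μ₀, -, hμ₀⟩ := hcpt.ultrafilter_le_nhds ((Filter.hyperfilter ℕ).map μ) (by
    refine Filter.le_principal_iff.mpr (Filter.mem_map.mpr (Filter.univ_mem' fun n => ?_))
    exact subset_closure ⟨n, rfl⟩)
  refine ⟨μ₀, fun t => ?_⟩
  have h1 : Filter.Tendsto μ (Filter.hyperfilter ℕ) (nhds μ₀) := hμ₀
  rw [ProbabilityMeasure.tendsto_iff_forall_integral_rclike_tendsto ℂ] at h1
  have h2 := h1 (BoundedContinuousFunction.innerProbChar t)
  simp_rw [← charFun_eq_integral_innerProbChar] at h2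
  exact tendsto_nhds_unique h2 ((hlim t).mono_left Nat.hyperfilter_le_atTop)

end Bochner

end SingleMode

/-! ### Positive semidefinite kernels and sufficiency of the criterion -/

namespace SingleMode

section HadamardExp

variable {ι : Type*} [Fintype ι]

theorem posSemidef_fin_two {a c : ℝ} {b : ℂ} (ha : 0 ≤ a) (hc : 0 ≤ c) (h : ‖b‖ ^ 2 ≤ a * c) :
    (!![(a : ℂ), b; (starRingEnd ℂ) b, (c : ℂ)]).PosSemidef := by
  refine Matrix.PosSemidef.of_dotProduct_mulVec_nonneg ?_ fun x => ?_
  · ext i j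
    fin_cases i <;> fin_cases j <;> simp
  · have e : star x ⬝ᵥ (!![(a : ℂ), b; (starRingEnd ℂ) b, (c : ℂ)] *ᵥ x) =
        ((a * ‖x 0‖ ^ 2 + c * ‖x 1‖ ^ 2 + 2 * ((starRingEnd ℂ) (x 0) * b * x 1).re : ℝ) : ℂ) := by
      simp only [dotProduct, mulVec, Fin.sum_univ_two, Complex.sq_norm, Complex.normSq_apply]
      apply Complex.ext <;> simp <;> ring
    rw [e, Complex.zero_le_real]
    have h1 : -(‖x 0‖ * ‖b‖ * ‖x 1‖) ≤ ((starRingEnd ℂ) (x 0) * b * x 1).re := by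
      have := (abs_le.mp (Complex.abs_re_le_norm ((starRingEnd ℂ) (x 0) * b * x 1))).1
      simpa using this
    have h2 : ‖b‖ ≤ √a * √c := by
      rw [← Real.sqrt_mul ha]
      exact Real.le_sqrt_of_sq_le h
    have h3 : ‖x 0‖ * ‖b‖ * ‖x 1‖ ≤ ‖x 0‖ * (√a * √c) * ‖x 1‖ := by gcongr
    nlinarith [sq_nonneg (√a * ‖x 0‖ - √c * ‖x 1‖), Real.sq_sqrt ha, Real.sq_sqrt hc]

theorem posSemidef_one_kernel : (Matrix.of fun _ _ : ι => (1 : ℂ)).PosSemidef := by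
  have h := Matrix.posSemidef_vecMulVec_self_star (fun _ : ι => (1 : ℂ))
  refine (congrArg Matrix.PosSemidef ?_).mp h
  ext i j
  simp [Matrix.vecMulVec_apply]

/-- The entrywise exponential of a positive semidefinite matrix is positive semidefinite. -/
theorem posSemidef_exp {A : Matrix ι ι ℂ} (hA : A.PosSemidef) :
    (Matrix.of fun i j => Complex.exp (A i j)).PosSemidef := by
  -- Entrywise powers are positive by the Schur product theorem; the exponential is a limit of their
  -- nonnegative combinations.
  have hpow : ∀ k : ℕ, (Matrix.of fun i j => A i j ^ k).PosSemidef := by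
    intro k
    induction k with
    | zero => simpa using posSemidef_one_kernel
    | succ k ih =>
      refine (congrArg Matrix.PosSemidef ?_).mp (ih.hadamard hA)
      ext i j
      simp [pow_succ]
  have hsum : ∀ N : ℕ, (∑ k ∈ Finset.range N,
      ((k.factorial : ℝ)⁻¹ : ℂ) • Matrix.of fun i j => A i j ^ k).PosSemidef := by
    intro N
    refine Matrix.posSemidef_sum _ fun k _ => (hpow k).smul ?_
    exact_mod_cast Complex.zero_le_real.mpr (by positivity : (0 : ℝ) ≤ (k.factorial : ℝ)⁻¹)
  refine Matrix.PosSemidef.of_dotProduct_mulVec_nonneg ?_ fun x => ?_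
  · ext i j
    have := hA.1.apply i j
    simp only [Matrix.conjTranspose_apply, Matrix.of_apply, RCLike.star_def,
      ← Complex.exp_conj] at this ⊢
    rw [this]
  · have hlim : Filter.Tendsto (fun N : ℕ => star x ⬝ᵥ ((∑ k ∈ Finset.range N,
        ((k.factorial : ℝ)⁻¹ : ℂ) • Matrix.of fun i j => A i j ^ k) *ᵥ x)) Filter.atTop
        (nhds (star x ⬝ᵥ ((Matrix.of fun i j => Complex.exp (A i j)) *ᵥ x))) := by
      simp only [dotProduct, mulVec]
      refine tendsto_finsetSum _ fun i _ => Filter.Tendsto.const_mul _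
        (tendsto_finsetSum _ fun j _ => Filter.Tendsto.mul_const _ ?_)
      have h1 := (NormedSpace.expSeries_div_hasSum_exp (A i j)).tendsto_sum_nat
      rw [← Complex.exp_eq_exp_ℂ] at h1
      refine h1.congr fun N => ?_
      rw [Matrix.sum_apply]
      refine Finset.sum_congr rfl fun k _ => ?_
      simp [div_eq_inv_mul]
    exact ge_of_tendsto' hlim fun N => (hsum N).dotProduct_mulVec_nonneg x

end HadamardExp

/-- The action of a real `2 × 2` matrix on the phase space `ℂ`. -/
def matAct (X : Matrix (Fin 2) (Fin 2) ℝ) (ξ : ℂ) : ℂ :=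
  ⟨X 0 0 * ξ.re + X 0 1 * ξ.im, X 1 0 * ξ.re + X 1 1 * ξ.im⟩

/-- The bilinear form on the phase space `ℂ` of a real `2 × 2` matrix. -/
def bilin (Y : Matrix (Fin 2) (Fin 2) ℝ) (ξ η : ℂ) : ℝ :=
  ξ.re * (Y 0 0 * η.re + Y 0 1 * η.im) + ξ.im * (Y 1 0 * η.re + Y 1 1 * η.im)

/-- The symplectic form on the phase space `ℂ`. -/
def symp (ξ η : ℂ) : ℝ := ξ.im * η.re - ξ.re * η.im

theorem symp_matAct (X : Matrix (Fin 2) (Fin 2) ℝ) (ξ η : ℂ) :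
    symp (matAct X ξ) (matAct X η) = X.det * symp ξ η := by
  simp only [symp, matAct, Matrix.det_fin_two]
  ring

/-- The coordinate vector of a point of the phase space. -/
def toVec (ξ : ℂ) : Fin 2 → ℝ := ![ξ.re, ξ.im]

theorem mulVec_toVec (X : Matrix (Fin 2) (Fin 2) ℝ) (ξ : ℂ) :
    X *ᵥ toVec ξ = toVec (matAct X ξ) := by
  ext i
  fin_cases i <;> simp [toVec, matAct, mulVec, dotProduct, Fin.sum_univ_two]

theorem dotProduct_toVec (Y : Matrix (Fin 2) (Fin 2) ℝ) (ξ : ℂ) :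
    toVec ξ ⬝ᵥ Y *ᵥ toVec ξ = bilin Y ξ ξ := by
  simp [toVec, bilin, mulVec, dotProduct, Fin.sum_univ_two]

theorem weylChar_toVec (ρ : Mode →L[ℂ] Mode) (ξ : ℂ) :
    weylChar ρ (toVec ξ) = trace (displacement ξ ∘L ρ) := rfl

/-- The hypotheses say that the Hermitian matrix with real part `Z` and upper off-diagonal imaginary
part `d` is positive semidefinite. Its form on the points `x i` is exponentiated entrywise, then the
diagonal factors `exp (-Z(x i, x i) / 2)` are restored by a rank-one Schur product. -/
theorem posSemidef_gauss_kernel {Z : Matrix (Fin 2) (Fin 2) ℝ} (hZ : Z.IsSymm) {d : ℝ}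
    (h0 : 0 ≤ Z 0 0) (h1 : 0 ≤ Z 1 1) (hd : d ^ 2 ≤ Z.det) {n : ℕ} (x : Fin n → ℂ) :
    (Matrix.of fun i j => Complex.exp (((-(bilin Z (x i - x j) (x i - x j)) / 2 : ℝ) : ℂ) -
      ((d * symp (x i) (x j) : ℝ) : ℂ) * Complex.I)).PosSemidef := by
  have hz : Z 1 0 = Z 0 1 := hZ.apply 0 1
  have hH : (!![((Z 0 0 : ℝ) : ℂ), ⟨Z 0 1, d⟩; (starRingEnd ℂ) ⟨Z 0 1, d⟩,
      ((Z 1 1 : ℝ) : ℂ)]).PosSemidef := by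
    refine posSemidef_fin_two h0 h1 ?_
    rw [Complex.sq_norm, Complex.normSq_mk]
    rw [Matrix.det_fin_two, hz] at hd
    nlinarith
  let W : Matrix (Fin n) (Fin 2) ℂ := Matrix.of fun i => ![((x i).re : ℂ), ((x i).im : ℂ)]
  have hG := posSemidef_exp (hH.mul_mul_conjTranspose_same W)
  have hV := Matrix.posSemidef_vecMulVec_self_star
    fun i => Complex.exp ((-(bilin Z (x i) (x i)) / 2 : ℝ) : ℂ)
  refine (congrArg Matrix.PosSemidef ?_).mp (hG.hadamard hV)
  ext i j
  simp only [Matrix.hadamard_apply, Matrix.of_apply, Matrix.vecMulVec_apply, Pi.star_apply,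
    RCLike.star_def, ← Complex.exp_conj, Complex.conj_ofReal, ← Complex.exp_add]
  congr 1
  simp only [Matrix.mul_apply, Fin.sum_univ_two, W, Matrix.of_apply, Matrix.conjTranspose_apply,
    Matrix.cons_val_zero, Matrix.cons_val_one, RCLike.star_def, Complex.conj_ofReal]
  apply Complex.ext <;> simp [bilin, symp, hz] <;> ring

section Char

variable {A : Type*} [MeasurableSpace A] {m : Measure A} {v : A → Mode} {ρ : Mode →L[ℂ] Mode}

theorem IsMixture.integrable_inner_displacement (h : IsMixture m v ρ) (α β : ℂ) :
    Integrable (fun a => ⟪displacement α (v a), displacement β (v a)⟫_ℂ) m := by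
  refine h.integrable_sq.mono' ?_ (Filter.Eventually.of_forall fun a => ?_)
  · exact ((displacement α).continuous.comp_aestronglyMeasurable h.meas).inner
      ((displacement β).continuous.comp_aestronglyMeasurable h.meas)
  · refine (norm_inner_le_norm _ _).trans_eq ?_
    rw [norm_displacement, norm_displacement, sq]

theorem IsMixture.continuous_char (h : IsMixture m v ρ) :
    Continuous fun ξ : ℂ => trace (displacement ξ ∘L ρ) := by
  simp_rw [h.trace_comp]
  refine continuous_of_dominated (bound := fun a => ‖v a‖ ^ 2) (fun ξ => ?_) (fun ξ => ?_)
    h.integrable_sq (Filter.Eventually.of_forall fun a => continuous_inner_displacement _ _)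
  · exact h.meas.inner ((displacement ξ).continuous.comp_aestronglyMeasurable h.meas)
  · refine Filter.Eventually.of_forall fun a => ?_
    rw [sq]
    exact norm_inner_displacement_le _ _ _

theorem IsMixture.trace_displacement_sub (h : IsMixture m v ρ) (α β : ℂ) :
    Complex.exp ((symp α β : ℝ) * Complex.I) * trace (displacement (α - β) ∘L ρ) =
      ∫ a, ⟪displacement β (v a), displacement α (v a)⟫_ℂ ∂m := by
  rw [h.trace_comp, ← integral_const_mul]
  congr 1
  ext1 a
  rw [inner_displacement_left, displacement_displacement, inner_smul_right,
    show -β + α = α - β by ring]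
  congr 4
  simp only [symp, Complex.neg_im, Complex.neg_re]
  ring

/-- The easy half of the quantum Bochner theorem: by the Weyl relation the entries are averaged
inner products of displaced vectors, a Gram matrix. -/
theorem IsMixture.posSemidef_char (h : IsMixture m v ρ) {n : ℕ} (x : Fin n → ℂ) :
    (Matrix.of fun i j => Complex.exp ((symp (x i) (x j) : ℝ) * Complex.I) *
      trace (displacement (x i - x j) ∘L ρ)).PosSemidef := by
  simp_rw [h.trace_displacement_sub]
  refine Matrix.PosSemidef.of_dotProduct_mulVec_nonneg ?_ fun c => ?_
  · ext i j
    simp only [Matrix.conjTranspose_apply, Matrix.of_apply, RCLike.star_def, ← integral_conj,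
      inner_conj_symm]
  · have e : star c ⬝ᵥ ((Matrix.of fun i j => ∫ a, ⟪displacement (x j) (v a),
        displacement (x i) (v a)⟫_ℂ ∂m) *ᵥ c) = ∫ a, ((‖∑ i, (starRingEnd ℂ) (c i) •
          displacement (x i) (v a)‖ ^ 2 : ℝ) : ℂ) ∂m := by
      have e1 : ∀ a, ((‖∑ i, (starRingEnd ℂ) (c i) • displacement (x i) (v a)‖ ^ 2 : ℝ) : ℂ) =
          ∑ i, ∑ j, (starRingEnd ℂ) (c i) * (c j *
            ⟪displacement (x j) (v a), displacement (x i) (v a)⟫_ℂ) := by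
        intro a
        rw [Complex.ofReal_pow]
        refine (inner_self_eq_norm_sq_to_K (𝕜 := ℂ)
          (∑ i, (starRingEnd ℂ) (c i) • displacement (x i) (v a))).symm.trans ?_
        rw [inner_sum]
        refine Finset.sum_congr rfl fun i _ => ?_
        rw [sum_inner]
        refine Finset.sum_congr rfl fun j _ => ?_
        rw [inner_smul_left, inner_smul_right, Complex.conj_conj]
        ring
      simp_rw [e1]
      have hi := h.integrable_inner_displacement
      rw [integral_finsetSum _ fun i _ => integrable_finsetSum _ fun j _ =>
        ((hi _ _).const_mul _).const_mul _]
      simp_rw [fun i => integral_finsetSum (μ := m) Finset.univ fun j _ =>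
        ((hi (x j) (x i)).const_mul (c j)).const_mul ((starRingEnd ℂ) (c i)), integral_const_mul]
      simp [dotProduct, mulVec, Finset.mul_sum, mul_comm, mul_left_comm]
    rw [e]
    exact integral_nonneg fun a => Complex.zero_le_real.mpr (by positivity)

/-- `X` scales the symplectic form by `det X`, so the twist of the quantum kernel at the points `X
x_i` is cancelled by the Gaussian kernel with `d = det X`. -/
theorem IsMixture.isPosDefFun_char_mul_gauss (h : IsMixture m v ρ)
    {X Z : Matrix (Fin 2) (Fin 2) ℝ} (hZ : Z.IsSymm)
    (h0 : 0 ≤ Z 0 0) (h1 : 0 ≤ Z 1 1) (hd : X.det ^ 2 ≤ Z.det) :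
    IsPosDefFun fun ξ : ℂ => trace (displacement (matAct X ξ) ∘L ρ) *
      ((Real.exp (-(bilin Z ξ ξ) / 2) : ℝ) : ℂ) := by
  intro n x
  refine (congrArg Matrix.PosSemidef ?_).mp ((h.posSemidef_char fun i => matAct X (x i)).hadamard
    (posSemidef_gauss_kernel hZ h0 h1 hd x))
  ext i j
  have e : matAct X (x i) - matAct X (x j) = matAct X (x i - x j) := by
    apply Complex.ext <;> simp [matAct] <;> ring
  simp only [Matrix.hadamard_apply, Matrix.of_apply, symp_matAct, e]
  rw [mul_right_comm, ← Complex.exp_add, mul_comm, Complex.ofReal_exp]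
  congr 2
  ring

end Char

theorem IsDensity.trace_eq {ρ : Mode →L[ℂ] Mode} (hρ : IsDensity ρ) : trace ρ = 1 :=
  hρ.2.trace_eq

/-- Positivity is complete positivity for a single block. -/
theorem IsChannel.isDensity {Γ : traceClass →ₗ[ℂ] traceClass} (hΓ : IsChannel Γ)
    {ρ : Mode →L[ℂ] Mode} (hρ : IsDensity ρ) :
    IsDensity (Γ hρ.toTraceClass : Mode →L[ℂ] Mode) := by
  constructor
  · rw [ContinuousLinearMap.isPositive_iff_complex]
    intro f
    have h := hΓ.completely_positive 1 (fun _ _ => hρ.toTraceClass)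
      (fun v => by
        have h2 := RCLike.nonneg_iff.mp (hρ.1.inner_nonneg_right (v 0))
        simp only [Finset.univ_unique, Finset.sum_singleton]
        exact Complex.nonneg_iff.mpr ⟨h2.1, h2.2.symm⟩) fun _ => f
    simp only [Finset.univ_unique, Finset.sum_singleton] at h
    have h2 := Complex.nonneg_iff.mp h
    have h3 : ⟪(Γ hρ.toTraceClass : Mode →L[ℂ] Mode) f, f⟫_ℂ =
        (starRingEnd ℂ) ⟪f, (Γ hρ.toTraceClass : Mode →L[ℂ] Mode) f⟫_ℂ :=
      (inner_conj_symm _ _).symm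
    rw [h3]
    refine ⟨?_, by
      rw [RCLike.re_to_complex, Complex.conj_re]
      exact h2.1⟩
    apply Complex.ext
    · simp
    · simpa only [Complex.conj_im, neg_eq_zero, zero_eq_neg, RCLike.re_to_complex,
        Complex.ofReal_im] using h2.2.symm
  · have h := hasTrace_comp (ContinuousLinearMap.id ℂ Mode) (Γ hρ.toTraceClass)
    rw [ContinuousLinearMap.id_comp, hΓ.trace_preserving] at h
    rwa [show trace (hρ.toTraceClass : Mode →L[ℂ] Mode) = 1 from hρ.trace_eq] at h

/-- A sufficient condition for a Gaussian channel to break nonclassicality. -/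
theorem IsGaussianChannel.nonclassicalityBreaking {Γ : traceClass →ₗ[ℂ] traceClass}
    {X Y : Matrix (Fin 2) (Fin 2) ℝ} (hΓ : IsGaussianChannel Γ X Y)
    (h0 : 1 ≤ Y 0 0) (h1 : 1 ≤ Y 1 1) (hd : X.det ^ 2 ≤ (Y - 1).det) :
    NonclassicalityBreaking Γ := by
  intro ρ hρ
  have hσ := hΓ.toIsChannel.isDensity hρ
  obtain ⟨A, _, m, v, _, hv, -⟩ := hρ.exists_isMixture
  obtain ⟨B, _, m', w, _, hw, -⟩ := hσ.exists_isMixture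
  have hpd := hv.isPosDefFun_char_mul_gauss (X := X) (Z := Y - 1)
    (hΓ.symm.sub Matrix.isSymm_one) (by simpa using h0) (by simpa using h1) hd
  have hmat : Continuous (matAct X) :=
    Complex.equivRealProdCLM.symm.continuous.comp (f := fun ξ : ℂ =>
      (X 0 0 * ξ.re + X 0 1 * ξ.im, X 1 0 * ξ.re + X 1 1 * ξ.im)) (by fun_prop)
  obtain ⟨μ₀, hμ₀⟩ := hpd.exists_charFun_eq (by
    refine Continuous.mul (hv.continuous_char.comp hmat) ?_
    simp only [bilin]
    fun_prop) (by
    have e : matAct X 0 = 0 := by apply Complex.ext <;> simp [matAct]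
    have e2 : displacement 0 ∘L ρ = ρ := by ext1 f; simp
    simp [bilin, e, e2, hρ.trace_eq])
  -- This change of variable turns the Euclidean character `exp (i ⟪x, ξ⟫)` into the coherent-state
  -- phase `exp (2 i symp ξ α)`.
  have hmeas : Measurable fun x : ℂ => (⟨x.im / 2, -x.re / 2⟩ : ℂ) :=
    (Complex.equivRealProdCLM.symm.continuous.comp (f := fun x : ℂ =>
      (x.im / 2, -x.re / 2)) (by fun_prop)).measurable
  let μ : Measure ℂ := (μ₀ : Measure ℂ).map fun x : ℂ => (⟨x.im / 2, -x.re / 2⟩ : ℂ)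
  have : IsProbabilityMeasure μ := Measure.isProbabilityMeasure_map hmeas.aemeasurable
  refine isClassical_of_integral_eq hw hσ.1 (μ := μ) fun ξ => ?_
  rw [← hw.trace_comp, ← weylChar_toVec, hΓ.weylChar_out, mulVec_toVec, dotProduct_toVec,
    weylChar_toVec]
  simp_rw [inner_coherent_displacement_self]
  rw [integral_mul_const, integral_map hmeas.aemeasurable
    (Measurable.aestronglyMeasurable (by fun_prop))]
  have h2 := hμ₀ ξ
  rw [charFun_apply] at h2
  have h3 : ∀ x : ℂ, 2 * (ξ.im * (x.im / 2) - ξ.re * (-x.re / 2)) = ⟪x, ξ⟫_ℝ := by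
    intro x
    rw [Complex.inner]
    simp
    ring
  simp_rw [h3]
  rw [h2, mul_assoc, ← Complex.ofReal_mul, ← Real.exp_add]
  congr 3
  simp [bilin, hΓ.symm.apply 0 1]
  ring

end SingleMode

/-! ### Gaussian integrals on phase space and necessity of the criterion -/

namespace SingleMode

theorem integrable_gauss_linear {a b d ε : ℝ} (hε : 0 < ε)
    (hM : ∀ x y : ℝ, ε * (x ^ 2 + y ^ 2) ≤ a * x ^ 2 + 2 * b * x * y + d * y ^ 2)
    (c : ℂ) (p q : ℝ) : Integrable fun ξ : ℂ => Complex.exp (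
      ((-(a * ξ.re ^ 2 + 2 * b * ξ.re * ξ.im + d * ξ.im ^ 2) / 2 : ℝ) : ℂ) +
        c * ((p * ξ.re + q * ξ.im : ℝ) : ℂ)) := by
  have h := GaussianFourier.integrable_cexp_neg_mul_sq_norm_add (V := ℂ) (b := ((ε / 2 : ℝ) : ℂ))
    (by simpa using hε) c ⟨p, q⟩
  refine h.mono (Continuous.aestronglyMeasurable (by fun_prop))
    (Filter.Eventually.of_forall fun ξ => ?_)
  rw [Complex.norm_exp, Complex.norm_exp, Real.exp_le_exp]
  have e1 : ⟪(⟨p, q⟩ : ℂ), ξ⟫_ℝ = p * ξ.re + q * ξ.im := by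
    rw [Complex.inner]
    simp
    ring
  have e2 : (-((ε / 2 : ℝ) : ℂ) * (‖ξ‖ : ℂ) ^ 2) = ((-(ε / 2) * ‖ξ‖ ^ 2 : ℝ) : ℂ) := by
    push_cast; ring
  rw [e1, e2, Complex.add_re, Complex.add_re, Complex.ofReal_re, Complex.ofReal_re,
    Complex.sq_norm, Complex.normSq_apply]
  have := hM ξ.re ξ.im
  gcongr
  nlinarith

/-- Gaussian integral over the phase space with a linear term. -/
theorem exists_integral_gauss_linear {a b d ε : ℝ} (hε : 0 < ε)
    (hM : ∀ x y : ℝ, ε * (x ^ 2 + y ^ 2) ≤ a * x ^ 2 + 2 * b * x * y + d * y ^ 2) :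
    ∃ K : ℝ, 0 < K ∧ ∀ (c : ℂ) (p q : ℝ), ∫ ξ : ℂ, Complex.exp (
      ((-(a * ξ.re ^ 2 + 2 * b * ξ.re * ξ.im + d * ξ.im ^ 2) / 2 : ℝ) : ℂ) +
        c * ((p * ξ.re + q * ξ.im : ℝ) : ℂ)) =
      K * Complex.exp (c ^ 2 *
        (((d * p ^ 2 - 2 * b * p * q + a * q ^ 2) / (a * d - b ^ 2) / 2 : ℝ) : ℂ)) := by
  have ha : 0 < a := by have := hM 1 0; norm_num at this; linarith
  have hdet : 0 < a * d - b ^ 2 := by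
    have h1 := hM (-b) a
    have h2 : 0 < ε * ((-b) ^ 2 + a ^ 2) := by positivity
    have h3 : 0 < a * (a * d - b ^ 2) := by nlinarith
    exact pos_of_mul_pos_right h3 ha.le
  have hs : 0 < d - b ^ 2 / a := by
    have : d - b ^ 2 / a = (a * d - b ^ 2) / a := by field_simp
    rw [this]
    positivity
  refine ⟨(2 * Real.pi / a) ^ (1 / 2 : ℝ) * (2 * Real.pi / (d - b ^ 2 / a)) ^ (1 / 2 : ℝ),
    by positivity, fun c p q => ?_⟩
  have hmp := Complex.volume_preserving_equiv_real_prod.symm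
  rw [← hmp.integral_comp Complex.measurableEquivRealProd.symm.measurableEmbedding]
  have hint := (hmp.integrable_comp_emb
    Complex.measurableEquivRealProd.symm.measurableEmbedding).mpr
    (integrable_gauss_linear hε hM c p q)
  rw [Measure.volume_eq_prod]
  refine (integral_prod_symm _ hint).trans ?_
  have hac : (a : ℂ) ≠ 0 := by exact_mod_cast ha.ne'
  have hsc : (d : ℂ) - b ^ 2 / a ≠ 0 := by exact_mod_cast hs.ne'
  have hdetc : (a : ℂ) * d - b ^ 2 ≠ 0 := by exact_mod_cast hdet.ne'
  -- Completing the square in `x` leaves a Gaussian in `y` with the Schur complement `d - b² / a` as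
  -- coefficient.
  have hin : ∀ y : ℝ, ∫ x : ℝ, ((fun ξ : ℂ => Complex.exp (
      ((-(a * ξ.re ^ 2 + 2 * b * ξ.re * ξ.im + d * ξ.im ^ 2) / 2 : ℝ) : ℂ) +
        c * ((p * ξ.re + q * ξ.im : ℝ) : ℂ))) ∘ Complex.measurableEquivRealProd.symm) (x, y) =
      (((2 * Real.pi / a) ^ (1 / 2 : ℝ) : ℝ) : ℂ) *
      Complex.exp ((-((d - b ^ 2 / a : ℝ) / 2 : ℂ)) * (y : ℂ) ^ 2 +
        (c * (q - p * b / a)) * y + c ^ 2 * p ^ 2 / (2 * a)) := by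
    intro y
    have e : ∀ x : ℝ, ((fun ξ : ℂ => Complex.exp (
      ((-(a * ξ.re ^ 2 + 2 * b * ξ.re * ξ.im + d * ξ.im ^ 2) / 2 : ℝ) : ℂ) +
        c * ((p * ξ.re + q * ξ.im : ℝ) : ℂ))) ∘ Complex.measurableEquivRealProd.symm) (x, y) =
        Complex.exp ((-(a / 2 : ℂ)) * (x : ℂ) ^ 2 + (c * p - b * y) * x +
          (-(d * (y : ℂ) ^ 2) / 2 + c * q * y)) := by
      intro x
      have e : Complex.measurableEquivRealProd.symm (x, y) = ⟨x, y⟩ := rfl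
      rw [Function.comp_apply, e]
      congr 1
      push_cast
      ring
    simp_rw [e]
    rw [integral_cexp_quadratic (by norm_cast; simpa using ha)]
    congr 1
    · rw [Complex.ofReal_cpow (by positivity)]
      push_cast
      congr 1
      field_simp
    · congr 1
      push_cast
      field_simp
      ring
  simp_rw [hin]
  rw [integral_const_mul, integral_cexp_quadratic (by norm_cast; simpa using hs), ← mul_assoc]
  congr 1
  · rw [Complex.ofReal_mul, Complex.ofReal_cpow (by positivity) (x := 2 * Real.pi / (d - b ^ 2 / a))]
    congr 1
    push_cast
    congr 1
    field_simp
  · congr 1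
    push_cast
    have e3 : (d : ℂ) - b ^ 2 / a = (a * d - b ^ 2) / a := by field_simp
    rw [e3]
    field_simp
    ring

theorem IsClassical.exists_trace_eq {σ : Mode →L[ℂ] Mode} (h : IsClassical σ) :
    ∃ μ : Measure ℂ, IsProbabilityMeasure μ ∧ ∀ ξ : ℂ, trace (displacement ξ ∘L σ) =
      (∫ α, Complex.exp (((2 * symp ξ α : ℝ) : ℂ) * Complex.I) ∂μ) *
        ((Real.exp (-(ξ.re ^ 2 + ξ.im ^ 2) / 2) : ℝ) : ℂ) := by
  obtain ⟨μ, hμ, h⟩ := h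
  refine ⟨μ, hμ, fun ξ => ?_⟩
  have hm : IsMixture μ coherent σ :=
    ⟨continuous_coherent.aestronglyMeasurable, by simp, h⟩
  rw [hm.trace_comp]
  simp_rw [inner_coherent_displacement_self]
  rw [integral_mul_const]
  rfl

section Necessity

variable {Γ : traceClass →ₗ[ℂ] traceClass} {X Y : Matrix (Fin 2) (Fin 2) ℝ}

/-- The vacuum factor `exp (-|ξ|² / 2)` of the classical output is divided out, which turns `Y` into
`Y - 1`. Unnormalised input vectors are allowed, as the test vectors below are superpositions. -/
theorem IsGaussianChannel.exists_char_eq (hΓ : IsGaussianChannel Γ X Y)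
    (hNB : NonclassicalityBreaking Γ) (u : Mode) :
    ∃ μ : Measure ℂ, IsProbabilityMeasure μ ∧ ∀ ξ : ℂ,
      ⟪u, displacement (matAct X ξ) u⟫_ℂ * ((Real.exp (-(bilin (Y - 1) ξ ξ) / 2) : ℝ) : ℂ) =
      ((‖u‖ ^ 2 : ℝ) : ℂ) * ∫ α, Complex.exp (((2 * symp ξ α : ℝ) : ℂ) * Complex.I) ∂μ := by
  by_cases hu : u = 0
  · exact ⟨Measure.dirac 0, inferInstance, by simp [hu]⟩
  have hn : (‖u‖ : ℂ) ≠ 0 := by simpa using hu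
  set w : Mode := ((‖u‖ : ℂ)⁻¹) • u with hw
  have hw1 : ‖w‖ = 1 := by rw [hw, norm_smul]; simp [hu]
  obtain ⟨μ, hμ, h⟩ := (hNB _ (isDensity_ketBra hw1)).exists_trace_eq
  refine ⟨μ, hμ, fun ξ => ?_⟩
  have h1 := h ξ
  rw [← weylChar_toVec, hΓ.weylChar_out, mulVec_toVec, dotProduct_toVec, weylChar_toVec,
    (hasTrace_comp_ketBra _ w w).trace_eq] at h1
  have e1 : ⟪w, displacement (matAct X ξ) w⟫_ℂ = ((‖u‖ ^ 2 : ℝ) : ℂ)⁻¹ *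
      ⟪u, displacement (matAct X ξ) u⟫_ℂ := by
    rw [hw, map_smul, inner_smul_left, inner_smul_right]
    simp
    field_simp
  have e2 : Real.exp (-(bilin (Y - 1) ξ ξ) / 2) = Real.exp (-(bilin Y ξ ξ) / 2) *
      Real.exp ((ξ.re ^ 2 + ξ.im ^ 2) / 2) := by
    rw [← Real.exp_add]
    congr 1
    simp [bilin]
    ring
  have e3 : ((Real.exp (-(ξ.re ^ 2 + ξ.im ^ 2) / 2) : ℝ) : ℂ) *
      ((Real.exp ((ξ.re ^ 2 + ξ.im ^ 2) / 2) : ℝ) : ℂ) = 1 := by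
    rw [← Complex.ofReal_mul, ← Real.exp_add]
    norm_num
    ring_nf
    simp
  rw [e1] at h1
  rw [e2, Complex.ofReal_mul]
  have hn2 : ((‖u‖ ^ 2 : ℝ) : ℂ) ≠ 0 := by
    push_cast
    positivity
  field_simp at h1
  simp only [neg_div] at h1 e3 ⊢
  linear_combination ((Real.exp ((ξ.re ^ 2 + ξ.im ^ 2) / 2) : ℝ) : ℂ) * h1 +
    ((‖u‖ ^ 2 : ℝ) : ℂ) * (∫ α, Complex.exp (((2 * symp ξ α : ℝ) : ℂ) * Complex.I) ∂μ) * e3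

theorem norm_inner_displacement_mul_exp_le (hΓ : IsGaussianChannel Γ X Y)
    (hNB : NonclassicalityBreaking Γ) (u : Mode) (ξ : ℂ) :
    ‖⟪u, displacement (matAct X ξ) u⟫_ℂ‖ * Real.exp (-(bilin (Y - 1) ξ ξ) / 2) ≤ ‖u‖ ^ 2 := by
  obtain ⟨μ, hμ, h⟩ := hΓ.exists_char_eq hNB u
  have h1 := congrArg norm (h ξ)
  rw [norm_mul, norm_mul, Complex.norm_real, Complex.norm_real, Real.norm_of_nonneg (by positivity),
    Real.norm_of_nonneg (by positivity)] at h1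
  rw [h1]
  refine mul_le_of_le_one_right (by positivity) ?_
  refine (norm_integral_le_of_norm_le_const (C := 1)
    (Filter.Eventually.of_forall fun α => ?_)).trans_eq (by simp)
  rw [Complex.norm_exp_ofReal_mul_I]

/-- Approximate eigenvectors of displacement operators, with eigenvalue one. -/
theorem exists_norm_displacement_sub_le (η : ℂ) (R : ℝ) :
    ∃ u : Mode, R ≤ ‖u‖ ∧ ‖displacement η u - u‖ ≤ 2 := by
  -- The vector is a sum of vacua displaced by multiples of `η`. Displacements along one line
  -- commute without phases, and the overlaps are positive, so `N` terms give squared norm at least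
  -- `N`. The shift by `η` telescopes to a difference of two unit vectors.
  let w : ℕ → Mode := fun k => displacement ((k : ℝ) * η) vacuum
  have hin : ∀ j k : ℕ, 0 ≤ RCLike.re ⟪w j, w k⟫_ℂ := by
    intro j k
    simp only [w]
    rw [inner_displacement_left, displacement_displacement, inner_smul_right,
      inner_vacuum_displacement_vacuum]
    have e : (-((j : ℝ) * η)).im * ((k : ℝ) * η).re - (-((j : ℝ) * η)).re * ((k : ℝ) * η).im = 0 := by
      simp
      ring
    rw [e]
    simp only [Complex.ofReal_zero, zero_mul, Complex.exp_zero, one_mul, RCLike.re_to_complex,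
      Complex.ofReal_re]
    positivity
  have hself : ∀ k : ℕ, RCLike.re ⟪w k, w k⟫_ℂ = 1 := by
    intro k
    rw [inner_self_eq_norm_sq]
    simp [w]
  have hshift : ∀ k : ℕ, displacement η (w k) = w (k + 1) := by
    intro k
    simp only [w]
    rw [displacement_displacement]
    have e : η.im * ((k : ℝ) * η).re - η.re * ((k : ℝ) * η).im = 0 := by
      simp
      ring
    rw [e, show η + (k : ℝ) * η = ((k + 1 : ℕ) : ℝ) * η by push_cast; ring]
    simp
  obtain ⟨N, hN⟩ := exists_nat_ge (R ^ 2)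
  refine ⟨∑ k ∈ Finset.range N, w k, ?_, ?_⟩
  · have h1 : (N : ℝ) ≤ ‖∑ k ∈ Finset.range N, w k‖ ^ 2 := by
      rw [← inner_self_eq_norm_sq (𝕜 := ℂ), sum_inner, map_sum]
      calc (N : ℝ) = ∑ j ∈ Finset.range N, (1 : ℝ) := by simp
        _ ≤ _ := by
          refine Finset.sum_le_sum fun j hj => ?_
          rw [inner_sum, map_sum, ← hself j]
          exact Finset.single_le_sum (f := fun k => RCLike.re ⟪w j, w k⟫_ℂ)
            (fun k _ => hin j k) hj
    exact abs_le_of_sq_le_sq' (hN.trans h1) (norm_nonneg _) |>.2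
  · rw [map_sum]
    simp_rw [hshift]
    rw [← Finset.sum_sub_distrib, Finset.sum_range_sub]
    refine (norm_sub_le _ _).trans ?_
    simp [w]
    norm_num

/-- On almost invariant vectors of `D(Xξ)` the input characteristic function is nearly one after
normalisation, while a negative form would multiply it by a factor `E > 1`, exceeding the bound for
a classical output. -/
theorem IsGaussianChannel.bilin_nonneg (hΓ : IsGaussianChannel Γ X Y)
    (hNB : NonclassicalityBreaking Γ) (ξ : ℂ) : 0 ≤ bilin (Y - 1) ξ ξ := by
  by_contra hneg
  push Not at hneg
  set E := Real.exp (-(bilin (Y - 1) ξ ξ) / 2) with hE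
  have hE1 : 1 < E := Real.one_lt_exp_iff.mpr (by linarith)
  -- The norm is chosen just beyond `2E / (E - 1)`, the largest value compatible with `(‖u‖² - 2‖u‖)
  -- E ≤ ‖u‖²`.
  obtain ⟨u, hR, hu⟩ := exists_norm_displacement_sub_le (matAct X ξ) (2 * E / (E - 1) + 1)
  have h1 := norm_inner_displacement_mul_exp_le hΓ hNB u ξ
  have h2 : ‖u‖ ^ 2 - 2 * ‖u‖ ≤ ‖⟪u, displacement (matAct X ξ) u⟫_ℂ‖ := by
    have e : ⟪u, displacement (matAct X ξ) u⟫_ℂ = ⟪u, u⟫_ℂ -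
        -⟪u, displacement (matAct X ξ) u - u⟫_ℂ := by
      rw [inner_sub_right]; ring
    have h3 : ‖⟪u, displacement (matAct X ξ) u - u⟫_ℂ‖ ≤ ‖u‖ * 2 :=
      (norm_inner_le_norm _ _).trans (by gcongr)
    have h4 : ‖⟪u, u⟫_ℂ‖ = ‖u‖ ^ 2 := by
      rw [inner_self_eq_norm_sq_to_K]
      simp
    have h5 := norm_sub_norm_le ⟪u, u⟫_ℂ (-⟪u, displacement (matAct X ξ) u - u⟫_ℂ)
    rw [norm_neg] at h5
    rw [e]
    linarith
  have hpos : 0 < E - 1 := by linarith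
  have hupos : 0 < ‖u‖ := lt_of_lt_of_le (by positivity) hR
  have h6 : (‖u‖ ^ 2 - 2 * ‖u‖) * E ≤ ‖u‖ ^ 2 :=
    (mul_le_mul_of_nonneg_right h2 (by positivity)).trans h1
  have h7 : ‖u‖ * (E - 1) ≤ 2 * E := by
    by_contra hc
    push Not at hc
    nlinarith
  rw [← le_div_iff₀ hpos] at h7
  linarith

/-- Matrix elements of the displacement operator in an odd superposition of coherent states. -/
theorem inner_cat_displacement (ζ : ℂ) :
    ⟪coherent 1 - coherent (-1), displacement ζ (coherent 1 - coherent (-1))⟫_ℂ =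
      ((Real.exp (-(ζ.re ^ 2 + ζ.im ^ 2) / 2) : ℝ) : ℂ) *
        (Complex.exp (2 * Complex.I * ζ.im) + Complex.exp (-2 * Complex.I * ζ.im) -
          Complex.exp (-2) * (Complex.exp (2 * ζ.re) + Complex.exp (-2 * ζ.re))) := by
  set G := ((Real.exp (-(ζ.re ^ 2 + ζ.im ^ 2) / 2) : ℝ) : ℂ) with hG
  have h11 : ⟪coherent 1, displacement ζ (coherent 1)⟫_ℂ = G * Complex.exp (2 * Complex.I * ζ.im) := by
    rw [inner_coherent_displacement_self, mul_comm]
    congr 2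
    push_cast
    simp
    ring
  have h22 : ⟪coherent (-1), displacement ζ (coherent (-1))⟫_ℂ =
      G * Complex.exp (-2 * Complex.I * ζ.im) := by
    rw [inner_coherent_displacement_self, mul_comm]
    congr 2
    push_cast
    simp
    ring
  have h12 : ⟪coherent 1, displacement ζ (coherent (-1))⟫_ℂ =
      G * (Complex.exp (-2) * Complex.exp (2 * ζ.re)) := by
    rw [inner_coherent_displacement_coherent, hG, Complex.ofReal_exp, Complex.ofReal_exp,
      ← Complex.exp_add, ← Complex.exp_add, ← Complex.exp_add]
    congr 1
    simp
    ring
  have h21 : ⟪coherent (-1), displacement ζ (coherent 1)⟫_ℂ =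
      G * (Complex.exp (-2) * Complex.exp (-2 * ζ.re)) := by
    rw [inner_coherent_displacement_coherent, hG, Complex.ofReal_exp, Complex.ofReal_exp,
      ← Complex.exp_add, ← Complex.exp_add, ← Complex.exp_add]
    congr 1
    simp
    ring
  rw [map_sub, inner_sub_left, inner_sub_right, inner_sub_right, h11, h12, h21, h22]
  ring

/-- After exchanging integrals, the inner one is the Fourier transform of a Gaussian, which is
positive for every `α`. -/
theorem integral_gauss_mul_integral_exp_nonneg (μ : Measure ℂ) [IsProbabilityMeasure μ] {ε : ℝ}
    (hε : 0 < ε) : 0 ≤ ∫ ξ : ℂ, ((Real.exp (-(ε * (ξ.re ^ 2 + ξ.im ^ 2)) / 2) : ℝ) : ℂ) *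
      ∫ α, Complex.exp (((2 * symp ξ α : ℝ) : ℂ) * Complex.I) ∂μ := by
  have hM : ∀ x y : ℝ, ε * (x ^ 2 + y ^ 2) ≤ ε * x ^ 2 + 2 * 0 * x * y + ε * y ^ 2 := by
    intro x y
    linarith
  obtain ⟨K, hK, h⟩ := exists_integral_gauss_linear hε hM
  have hg : Integrable fun ξ : ℂ => ((Real.exp (-(ε * (ξ.re ^ 2 + ξ.im ^ 2)) / 2) : ℝ) : ℂ) := by
    refine (integrable_gauss_linear hε hM 0 0 0).congr (Filter.Eventually.of_forall fun ξ => ?_)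
    simp only [zero_mul, add_zero, Complex.ofReal_exp]
    congr 2
    ring
  have hsymp : Continuous fun p : ℂ × ℂ => symp p.1 p.2 := by
    simp only [symp]
    fun_prop
  simp_rw [← integral_const_mul]
  rw [integral_integral_swap]
  · refine integral_nonneg fun α => ?_
    have h1 := h (2 * Complex.I) (-α.im) α.re
    have e : ∀ ξ : ℂ, ((Real.exp (-(ε * (ξ.re ^ 2 + ξ.im ^ 2)) / 2) : ℝ) : ℂ) *
        Complex.exp (((2 * symp ξ α : ℝ) : ℂ) * Complex.I) = Complex.exp (
        ((-(ε * ξ.re ^ 2 + 2 * 0 * ξ.re * ξ.im + ε * ξ.im ^ 2) / 2 : ℝ) : ℂ) +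
        2 * Complex.I * ((-α.im * ξ.re + α.re * ξ.im : ℝ) : ℂ)) := by
      intro ξ
      rw [Complex.ofReal_exp, ← Complex.exp_add]
      congr 1
      simp only [symp]
      push_cast
      ring
    simp_rw [e, h1, mul_pow, Complex.I_sq]
    norm_cast
    positivity
  · refine ((hg.mul_prod (integrable_const (1 : ℂ) (μ := μ))).mul_bdd (c := 1)
      (g := fun p : ℂ × ℂ => Complex.exp (((2 * symp p.1 p.2 : ℝ) : ℂ) * Complex.I))
      (Continuous.aestronglyMeasurable (by fun_prop))
      (Filter.Eventually.of_forall fun p => by rw [Complex.norm_exp_ofReal_mul_I])).congr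
      (Filter.Eventually.of_forall fun p => ?_)
    simp [Function.uncurry]

/-- The Gaussian test is applied to the odd superposition of `|1⟩` and `|-1⟩`. The diagonal terms
contribute damped oscillations, the interference terms enter with a minus sign and real growing
exponents, and nonnegativity compares the two. The parameter `ε` makes the quadratic form below
definite. -/
theorem IsGaussianChannel.det_le_of_pos (hΓ : IsGaussianChannel Γ X Y)
    (hNB : NonclassicalityBreaking Γ) {ε : ℝ} (hε : 0 < ε) :
    X.det ^ 2 ≤ (Y 0 0 - 1 + ε) * (Y 1 1 - 1 + ε) - Y 0 1 ^ 2 := by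
  have hy : Y 1 0 = Y 0 1 := hΓ.symm.apply 0 1
  -- `a, b, d` are the entries of `M = XᵀX + (Y - 1) + ε`, which collects the Gaussian factors of
  -- the input overlaps, the channel and the test function.
  set a : ℝ := X 0 0 ^ 2 + X 1 0 ^ 2 + (Y 0 0 - 1) + ε with ha
  set b : ℝ := X 0 0 * X 0 1 + X 1 0 * X 1 1 + Y 0 1 with hb
  set d : ℝ := X 0 1 ^ 2 + X 1 1 ^ 2 + (Y 1 1 - 1) + ε with hd
  have hM : ∀ x y : ℝ, ε * (x ^ 2 + y ^ 2) ≤ a * x ^ 2 + 2 * b * x * y + d * y ^ 2 := by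
    intro x y
    have h := hΓ.bilin_nonneg hNB ⟨x, y⟩
    simp [bilin, hy] at h
    nlinarith [sq_nonneg (X 0 0 * x + X 0 1 * y), sq_nonneg (X 1 0 * x + X 1 1 * y)]
  have hdet : 0 < a * d - b ^ 2 := by
    have ha : 0 < a := by have := hM 1 0; norm_num at this; linarith
    have h1 := hM (-b) a
    have h2 : 0 < ε * ((-b) ^ 2 + a ^ 2) := by positivity
    have h3 : 0 < a * (a * d - b ^ 2) := by nlinarith
    exact pos_of_mul_pos_right h3 ha.le
  obtain ⟨K, hK, hint⟩ := exists_integral_gauss_linear hε hM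
  set u : Mode := coherent 1 - coherent (-1) with hu
  obtain ⟨μ, hμ, hchar⟩ := hΓ.exists_char_eq hNB u
  have hnn := mul_nonneg (Complex.zero_le_real.mpr (sq_nonneg ‖u‖))
    (integral_gauss_mul_integral_exp_nonneg μ hε)
  rw [← integral_const_mul] at hnn
  let F : ℂ → ℝ → ℝ → ℂ → ℂ := fun c p q ξ => Complex.exp (
      ((-(a * ξ.re ^ 2 + 2 * b * ξ.re * ξ.im + d * ξ.im ^ 2) / 2 : ℝ) : ℂ) +
        c * ((p * ξ.re + q * ξ.im : ℝ) : ℂ))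
  have hF : ∀ c p q, Integrable (F c p q) := integrable_gauss_linear hε hM
  have hf : ∀ ξ : ℂ, ((‖u‖ ^ 2 : ℝ) : ℂ) *
      (((Real.exp (-(ε * (ξ.re ^ 2 + ξ.im ^ 2)) / 2) : ℝ) : ℂ) *
      ∫ α, Complex.exp (((2 * symp ξ α : ℝ) : ℂ) * Complex.I) ∂μ) =
      F (2 * Complex.I) (X 1 0) (X 1 1) ξ + F (-2 * Complex.I) (X 1 0) (X 1 1) ξ -
        Complex.exp (-2) * (F 2 (X 0 0) (X 0 1) ξ + F (-2) (X 0 0) (X 0 1) ξ) := by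
    intro ξ
    rw [mul_left_comm, ← hchar ξ, hu, inner_cat_displacement]
    have e : ((Real.exp (-(ε * (ξ.re ^ 2 + ξ.im ^ 2)) / 2) : ℝ) : ℂ) *
        (((Real.exp (-((matAct X ξ).re ^ 2 + (matAct X ξ).im ^ 2) / 2) : ℝ) : ℂ) *
        ((Real.exp (-(bilin (Y - 1) ξ ξ) / 2) : ℝ) : ℂ)) = Complex.exp
        ((-(a * ξ.re ^ 2 + 2 * b * ξ.re * ξ.im + d * ξ.im ^ 2) / 2 : ℝ) : ℂ) := by
      rw [← Complex.ofReal_mul, ← Complex.ofReal_mul, ← Real.exp_add, ← Real.exp_add,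
        Complex.ofReal_exp]
      congr 2
      simp [bilin, matAct, hy, ha, hb, hd]
      ring
    simp only [F, Complex.exp_add, ← e]
    have e1 : (((matAct X ξ).im : ℝ) : ℂ) = ((X 1 0 * ξ.re + X 1 1 * ξ.im : ℝ) : ℂ) := rfl
    have e2 : (((matAct X ξ).re : ℝ) : ℂ) = ((X 0 0 * ξ.re + X 0 1 * ξ.im : ℝ) : ℂ) := rfl
    rw [e1, e2]
    ring
  simp_rw [hf] at hnn
  have hF2 : ∀ c₁ c₂ p q, Integrable fun ξ => F c₁ p q ξ + F c₂ p q ξ :=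
    fun c₁ c₂ p q => (hF c₁ p q).add (hF c₂ p q)
  have hintF : ∀ c p q, ∫ ξ, F c p q ξ = K * Complex.exp (c ^ 2 *
      (((d * p ^ 2 - 2 * b * p * q + a * q ^ 2) / (a * d - b ^ 2) / 2 : ℝ) : ℂ)) := hint
  rw [integral_sub (hF2 _ _ _ _) ((hF2 _ _ _ _).const_mul _),
    integral_const_mul, integral_add (hF _ _ _) (hF _ _ _), integral_add (hF _ _ _) (hF _ _ _),
    hintF, hintF, hintF, hintF] at hnn
  set Q1 := (d * X 1 0 ^ 2 - 2 * b * X 1 0 * X 1 1 + a * X 1 1 ^ 2) / (a * d - b ^ 2) with hQ1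
  set Q2 := (d * X 0 0 ^ 2 - 2 * b * X 0 0 * X 0 1 + a * X 0 1 ^ 2) / (a * d - b ^ 2) with hQ2
  have h1 : (0 : ℝ) ≤ K * (2 * (Real.exp (-2 * Q1) - Real.exp (-2 + 2 * Q2))) := by
    refine Complex.zero_le_real.mp (hnn.trans_eq ?_)
    rw [Real.exp_add]
    push_cast
    have e1 : (2 * Complex.I) ^ 2 * ((Q1 : ℂ) / 2) = -2 * Q1 := by
      rw [mul_pow, Complex.I_sq]; ring
    have e2 : (-2 * Complex.I) ^ 2 * ((Q1 : ℂ) / 2) = -2 * Q1 := by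
      rw [mul_pow, Complex.I_sq]; ring
    have e3 : (2 : ℂ) ^ 2 * ((Q2 : ℂ) / 2) = 2 * Q2 := by ring
    have e4 : (-2 : ℂ) ^ 2 * ((Q2 : ℂ) / 2) = 2 * Q2 := by ring
    rw [e1, e2, e3, e4]
    ring
  have h2 : Real.exp (-2 + 2 * Q2) ≤ Real.exp (-2 * Q1) := by
    have := nonneg_of_mul_nonneg_right h1 hK
    linarith
  rw [Real.exp_le_exp] at h2
  -- This is `tr (X M⁻¹ Xᵀ) ≤ 1`. For `2 × 2` matrices, `det M - tr (adj M · XᵀX) = det (M - XᵀX) -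
  -- det X ^ 2`, so clearing the denominator yields exactly the claim.
  have h3 : Q1 + Q2 ≤ 1 := by linarith
  rw [hQ1, hQ2, ← add_div, div_le_one hdet] at h3
  rw [Matrix.det_fin_two]
  simp only [ha, hb, hd] at h3
  nlinarith

theorem IsGaussianChannel.det_le (hΓ : IsGaussianChannel Γ X Y)
    (hNB : NonclassicalityBreaking Γ) : X.det ^ 2 ≤ (Y - 1).det := by
  have hy : Y 1 0 = Y 0 1 := hΓ.symm.apply 0 1
  have hc : Continuous fun ε : ℝ => (Y 0 0 - 1 + ε) * (Y 1 1 - 1 + ε) - Y 0 1 ^ 2 := by fun_prop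
  have hlim := (hc.tendsto 0).mono_left (nhdsWithin_le_nhds (s := Set.Ioi 0))
  have h := ge_of_tendsto hlim (Filter.eventually_of_mem self_mem_nhdsWithin
    fun ε hε => hΓ.det_le_of_pos hNB hε)
  refine h.trans_eq ?_
  simp [Matrix.det_fin_two, hy]
  ring

end Necessity

end SingleMode

/-! ### The uncertainty relation from complete positivity -/

namespace SingleMode

section ChannelCondition

variable {Γ : traceClass →ₗ[ℂ] traceClass} {X Y : Matrix (Fin 2) (Fin 2) ℝ}

theorem trace_comp_add (B : Mode →L[ℂ] Mode) (S T : traceClass) :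
    trace (B ∘L ((S + T : traceClass) : Mode →L[ℂ] Mode)) =
      trace (B ∘L (S : Mode →L[ℂ] Mode)) + trace (B ∘L (T : Mode →L[ℂ] Mode)) := by
  have h := (hasTrace_comp B S).add (hasTrace_comp B T)
  rw [← ContinuousLinearMap.comp_add] at h
  exact h.trace_eq

theorem trace_comp_smul (B : Mode →L[ℂ] Mode) (c : ℂ) (T : traceClass) :
    trace (B ∘L ((c • T : traceClass) : Mode →L[ℂ] Mode)) =
      c * trace (B ∘L (T : Mode →L[ℂ] Mode)) := by
  have h := (hasTrace_comp B T).smul c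
  rw [← ContinuousLinearMap.comp_smul] at h
  exact h.trace_eq

/-- The Gaussian property extends from states to all trace-class operators. -/
theorem IsGaussianChannel.trace_displacement_comp (hΓ : IsGaussianChannel Γ X Y) (ξ : ℂ)
    (T : traceClass) : trace (displacement ξ ∘L (Γ T : Mode →L[ℂ] Mode)) =
      trace (displacement (matAct X ξ) ∘L (T : Mode →L[ℂ] Mode)) *
        ((Real.exp (-(bilin Y ξ ξ) / 2) : ℝ) : ℂ) := by
  obtain ⟨T, hT⟩ := T
  induction hT using Submodule.span_induction with
  | mem ρ hρ =>
    have h := hΓ.weylChar_out ρ hρ (toVec ξ)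
    rwa [mulVec_toVec, dotProduct_toVec, weylChar_toVec, weylChar_toVec] at h
  | zero =>
    have e : (⟨0, Submodule.zero_mem _⟩ : traceClass) = 0 := rfl
    have h0 : trace (0 : Mode →L[ℂ] Mode) = 0 := hasTrace_zero.trace_eq
    simp [e, h0]
  | add S T hS hT h1 h2 =>
    have e : (⟨S + T, Submodule.add_mem _ hS hT⟩ : traceClass) = ⟨S, hS⟩ + ⟨T, hT⟩ := rfl
    rw [e, map_add, trace_comp_add, trace_comp_add, h1, h2, add_mul]
  | smul c T hT h1 =>
    have e : (⟨c • T, Submodule.smul_mem _ c hT⟩ : traceClass) = c • ⟨T, hT⟩ := rfl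
    rw [e, map_smul, trace_comp_smul, trace_comp_smul, h1, mul_assoc]

/-- Image of a Hilbert basis under a displacement. -/
noncomputable def displacedBasis {ι : Type*} (α : ℂ) (b : HilbertBasis ι ℂ Mode) :
    HilbertBasis ι ℂ Mode :=
  HilbertBasis.ofRepr ((displacementEquiv α).symm.trans b.repr)

theorem displacedBasis_apply {ι : Type*} (α : ℂ) (b : HilbertBasis ι ℂ Mode) (i : ι) :
    displacedBasis α b i = displacement α (b i) := by
  classical
  rw [← HilbertBasis.repr_symm_single, ← HilbertBasis.repr_symm_single]
  rfl

/-- The trace of `D(α - β) T` is computed in the basis displaced by `-β`, so that sums of matrix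
elements of `T` yield characteristic function values. -/
theorem hasSum_inner_displacement {ι : Type} (b : HilbertBasis ι ℂ Mode) (T : traceClass)
    (α β : ℂ) :
    HasSum (fun k => ⟪displacement (-α) (b k), (T : Mode →L[ℂ] Mode) (displacement (-β) (b k))⟫_ℂ)
      (Complex.exp ((symp α β : ℝ) * Complex.I) *
        trace (displacement (α - β) ∘L (T : Mode →L[ℂ] Mode))) := by
  have h := ((hasTrace_comp (displacement (α - β)) T).smul
    (Complex.exp ((symp α β : ℝ) * Complex.I))) ι (displacedBasis (-β) b)
  refine h.congr_fun fun k => ?_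
  rw [displacedBasis_apply, _root_.smul_apply, inner_smul_right, ContinuousLinearMap.comp_apply,
    inner_displacement_right, displacement_displacement, inner_smul_left,
    show -(α - β) + -β = -α by ring, ← Complex.exp_conj, ← mul_assoc, ← Complex.exp_add]
  simp only [map_mul, Complex.conj_I, Complex.conj_ofReal, symp]
  rw [show (-(α - β)).im * (-β).re - (-(α - β)).re * (-β).im = α.im * β.re - α.re * β.im by
    simp only [Complex.neg_re, Complex.neg_im, Complex.sub_re, Complex.sub_im]; ring,
    mul_neg, add_neg_cancel, Complex.exp_zero, one_mul]

/-- Complete positivity is tested on the blocks `|u i⟩⟨u j|`, with `u i` the vacuum displaced by `-X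
z_i`. This choice makes the input characteristic function at `X (z_i - z_j)` a pure phase. Summing
over a basis displaced by `-z_i` in the `i`th slot gives the kernel. -/
theorem IsGaussianChannel.kernel_nonneg (hΓ : IsGaussianChannel Γ X Y) {n : ℕ}
    (z c : Fin n → ℂ) : 0 ≤ ∑ i, ∑ j, (starRingEnd ℂ) (c i) * (c j * Complex.exp (
      ((-(bilin Y (z i - z j) (z i - z j)) / 2 : ℝ) : ℂ) +
        (((1 - X.det) * symp (z i) (z j) : ℝ) : ℂ) * Complex.I)) := by
  obtain ⟨s, b, -⟩ := exists_hilbertBasis ℂ Mode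
  let u : Fin n → Mode := fun i => displacement (-matAct X (z i)) vacuum
  let T : Fin n → Fin n → traceClass := fun i j => ⟨ketBra (u i) (u j), ketBra_mem_traceClass _ _⟩
  have hT : ∀ v : Fin n → Mode, 0 ≤ ∑ i, ∑ j, ⟪v i, (T i j : Mode →L[ℂ] Mode) (v j)⟫_ℂ := by
    intro v
    have e : ∑ i, ∑ j, ⟪v i, (T i j : Mode →L[ℂ] Mode) (v j)⟫_ℂ =
        (starRingEnd ℂ) (∑ i, ⟪u i, v i⟫_ℂ) * ∑ j, ⟪u j, v j⟫_ℂ := by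
      rw [map_sum, Finset.sum_mul_sum]
      refine Finset.sum_congr rfl fun i _ => Finset.sum_congr rfl fun j _ => ?_
      simp only [T, InnerProductSpace.rankOne_apply, inner_smul_right, inner_conj_symm]
      ring
    rw [e, mul_comm, Complex.mul_conj]
    exact Complex.zero_le_real.mpr (Complex.normSq_nonneg _)
  have hcp := hΓ.completely_positive n T hT
  have hval : ∀ i j, Complex.exp ((symp (z i) (z j) : ℝ) * Complex.I) *
      trace (displacement (z i - z j) ∘L (Γ (T i j) : Mode →L[ℂ] Mode)) = Complex.exp (
      ((-(bilin Y (z i - z j) (z i - z j)) / 2 : ℝ) : ℂ) +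
        (((1 - X.det) * symp (z i) (z j) : ℝ) : ℂ) * Complex.I) := by
    intro i j
    have e : matAct X (z i - z j) = matAct X (z i) - matAct X (z j) := by
      apply Complex.ext <;> simp [matAct] <;> ring
    have e2 : ⟪u j, displacement (matAct X (z i) - matAct X (z j)) (u i)⟫_ℂ =
        Complex.exp ((-(X.det * symp (z i) (z j)) : ℝ) * Complex.I) := by
      simp only [u]
      rw [displacement_displacement, inner_smul_right,
        show matAct X (z i) - matAct X (z j) + -matAct X (z i) = -matAct X (z j) by ring,
        inner_displacement_displacement, inner_self_eq_norm_sq_to_K, norm_vacuum, ← symp_matAct]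
      simp only [symp, RCLike.ofReal_one, one_pow, mul_one]
      congr 3
      simp only [Complex.sub_im, Complex.sub_re, Complex.neg_im, Complex.neg_re]
      ring
    rw [hΓ.trace_displacement_comp, e, (hasTrace_comp_ketBra _ _ _).trace_eq, e2,
      Complex.ofReal_exp, ← Complex.exp_add, ← Complex.exp_add]
    congr 1
    push_cast
    ring
  have hsum : HasSum (fun k => ∑ i, ∑ j, ⟪c i • displacement (-z i) (b k),
      (Γ (T i j) : Mode →L[ℂ] Mode) (c j • displacement (-z j) (b k))⟫_ℂ)
      (∑ i, ∑ j, (starRingEnd ℂ) (c i) * (c j * Complex.exp (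
      ((-(bilin Y (z i - z j) (z i - z j)) / 2 : ℝ) : ℂ) +
        (((1 - X.det) * symp (z i) (z j) : ℝ) : ℂ) * Complex.I))) := by
    refine hasSum_sum fun i _ => hasSum_sum fun j _ => ?_
    rw [← hval, mul_left_comm]
    simp only [map_smul, inner_smul_left, inner_smul_right]
    exact ((hasSum_inner_displacement b (Γ (T i j)) (z i) (z j)).mul_left _).mul_left _
  exact hsum.nonneg fun k => hcp fun i => c i • displacement (-z i) (b k)

/-- Scaling the points by `√τ` scales the quadratic exponent by `τ`; the diagonal Gaussian factors
are absorbed into the coefficients. -/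
theorem IsGaussianChannel.exp_kernel_nonneg (hΓ : IsGaussianChannel Γ X Y) {n : ℕ}
    (z x : Fin n → ℂ) {τ : ℝ} (hτ : 0 ≤ τ) :
    0 ≤ ∑ i, ∑ j, (starRingEnd ℂ) (x i) * (x j * Complex.exp (τ *
      ((bilin Y (z i) (z j) : ℝ) + (((1 - X.det) * symp (z i) (z j) : ℝ) : ℂ) * Complex.I))) := by
  have hy : Y 1 0 = Y 0 1 := hΓ.symm.apply 0 1
  have h := hΓ.kernel_nonneg (fun i => (√τ : ℝ) * z i)
    (fun i => x i * ((Real.exp (τ * bilin Y (z i) (z i) / 2) : ℝ) : ℂ))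
  refine h.trans_eq (Finset.sum_congr rfl fun i _ => Finset.sum_congr rfl fun j _ => ?_)
  have hs : √τ * √τ = τ := Real.mul_self_sqrt hτ
  have e : Complex.exp (τ * ((bilin Y (z i) (z j) : ℝ) +
      (((1 - X.det) * symp (z i) (z j) : ℝ) : ℂ) * Complex.I)) =
      ((Real.exp (τ * bilin Y (z i) (z i) / 2) : ℝ) : ℂ) *
      ((Real.exp (τ * bilin Y (z j) (z j) / 2) : ℝ) : ℂ) * Complex.exp (
      ((-(bilin Y (√τ * z i - √τ * z j) (√τ * z i - √τ * z j)) / 2 : ℝ) : ℂ) +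
        (((1 - X.det) * symp (√τ * z i) (√τ * z j) : ℝ) : ℂ) * Complex.I) := by
    have e1 : bilin Y (√τ * z i - √τ * z j) (√τ * z i - √τ * z j) =
        τ * (bilin Y (z i) (z i) + bilin Y (z j) (z j) - 2 * bilin Y (z i) (z j)) := by
      conv_rhs => rw [← hs]
      simp only [bilin, hy, Complex.sub_re, Complex.sub_im, Complex.re_ofReal_mul,
        Complex.im_ofReal_mul]
      ring
    have e2 : symp (√τ * z i) (√τ * z j) = τ * symp (z i) (z j) := by
      conv_rhs => rw [← hs]
      simp only [symp, Complex.re_ofReal_mul, Complex.im_ofReal_mul]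
      ring
    rw [e1, e2, Complex.ofReal_exp, Complex.ofReal_exp, ← Complex.exp_add, ← Complex.exp_add]
    congr 1
    push_cast
    ring
  rw [e, map_mul, Complex.conj_ofReal]
  ring

theorem IsGaussianChannel.posSemidef (hΓ : IsGaussianChannel Γ X Y) :
    (!![((Y 0 0 : ℝ) : ℂ), ⟨Y 0 1, -(1 - X.det)⟩; (starRingEnd ℂ) ⟨Y 0 1, -(1 - X.det)⟩,
      ((Y 1 1 : ℝ) : ℂ)]).PosSemidef := by
  have hy : Y 1 0 = Y 0 1 := hΓ.symm.apply 0 1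
  refine Matrix.PosSemidef.of_dotProduct_mulVec_nonneg ?_ fun w => ?_
  · ext i j
    fin_cases i <;> fin_cases j <;> simp
  · let z : Fin 3 → ℂ := ![0, 1, Complex.I]
    let x : Fin 3 → ℂ := ![-(w 0 + w 1), w 0, w 1]
    let H : Fin 3 → Fin 3 → ℂ := fun i j =>
      (bilin Y (z i) (z j) : ℝ) + (((1 - X.det) * symp (z i) (z j) : ℝ) : ℂ) * Complex.I
    have hx : ∑ i, ∑ j, (starRingEnd ℂ) (x i) * x j = 0 := by
      simp [x, Fin.sum_univ_three]
      ring
    have hlim : Filter.Tendsto (fun τ : ℝ => ∑ i, ∑ j, (starRingEnd ℂ) (x i) * (x j *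
        ((τ : ℂ)⁻¹ * (Complex.exp (τ * H i j) - 1)))) (nhdsWithin 0 (Set.Ioi 0))
        (nhds (∑ i, ∑ j, (starRingEnd ℂ) (x i) * (x j * H i j))) := by
      refine tendsto_finsetSum _ fun i _ => tendsto_finsetSum _ fun j _ =>
        Filter.Tendsto.const_mul _ (Filter.Tendsto.const_mul _ ?_)
      have hd : HasDerivAt (fun τ : ℝ => Complex.exp (τ * H i j)) (H i j) 0 := by
        simpa using ((Complex.ofRealCLM.hasDerivAt (x := 0)).mul_const (H i j)).cexp
      refine (hd.tendsto_slope.mono_left (nhdsWithin_mono _ fun τ hτ => ne_of_gt hτ)).congr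
        fun τ => ?_
      simp [slope_def_module]
    have e : star w ⬝ᵥ ((!![((Y 0 0 : ℝ) : ℂ), ⟨Y 0 1, -(1 - X.det)⟩;
        (starRingEnd ℂ) ⟨Y 0 1, -(1 - X.det)⟩, ((Y 1 1 : ℝ) : ℂ)]) *ᵥ w) =
        ∑ i, ∑ j, (starRingEnd ℂ) (x i) * (x j * H i j) := by
      simp only [dotProduct, mulVec, Fin.sum_univ_two, Fin.sum_univ_three, x, H, z, bilin, symp]
      apply Complex.ext <;> simp [hy] <;> ring
    rw [e]
    refine ge_of_tendsto hlim (Filter.eventually_of_mem self_mem_nhdsWithin fun τ hτ => ?_)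
    have hτ' : (0 : ℝ) < τ := hτ
    have h := mul_nonneg (Complex.zero_le_real.mpr (inv_pos.mpr hτ').le)
      (hΓ.exp_kernel_nonneg z x hτ'.le)
    have e2 : ∑ i, ∑ j, (starRingEnd ℂ) (x i) * (x j *
        ((τ : ℂ)⁻¹ * (Complex.exp (τ * H i j) - 1))) = ((τ⁻¹ : ℝ) : ℂ) *
        ∑ i, ∑ j, (starRingEnd ℂ) (x i) * (x j * Complex.exp (τ * H i j)) -
        (τ : ℂ)⁻¹ * ∑ i, ∑ j, (starRingEnd ℂ) (x i) * x j := by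
      simp only [Finset.mul_sum, ← Finset.sum_sub_distrib]
      refine Finset.sum_congr rfl fun i _ => Finset.sum_congr rfl fun j _ => ?_
      push_cast
      ring
    rw [e2, hx, mul_zero, sub_zero]
    exact h

/-- The uncertainty relation satisfied by the parameters of a Gaussian channel. -/
theorem IsGaussianChannel.uncertainty (hΓ : IsGaussianChannel Γ X Y) :
    0 ≤ Y 0 0 ∧ 0 ≤ Y 1 1 ∧ (1 - X.det) ^ 2 ≤ Y.det := by
  have hy : Y 1 0 = Y 0 1 := hΓ.symm.apply 0 1
  have h := hΓ.posSemidef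
  have h0 := h.diag_nonneg (i := 0)
  have h1 := h.diag_nonneg (i := 1)
  have hdet := h.det_nonneg
  refine ⟨by simpa using h0, by simpa using h1, ?_⟩
  rw [Matrix.det_fin_two_of, Complex.mul_conj, Complex.normSq_mk] at hdet
  have h2 : (0 : ℝ) ≤ Y 0 0 * Y 1 1 - (Y 0 1 * Y 0 1 + -(1 - X.det) * -(1 - X.det)) := by
    exact_mod_cast hdet
  have h3 : Y.det = Y 0 0 * Y 1 1 - Y 0 1 * Y 0 1 := by rw [Matrix.det_fin_two, hy]
  nlinarith

end ChannelCondition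

end SingleMode

/-! ### Canonical forms and elementary inequalities -/

namespace SingleMode

section CanonicalForms

variable {Γ : traceClass →ₗ[ℂ] traceClass} {X Y X₀ Y₀ : Matrix (Fin 2) (Fin 2) ℝ}

theorem posSemidef_fin_two_iff (hY : Y.IsSymm) :
    Y.PosSemidef ↔ 0 ≤ Y 0 0 ∧ 0 ≤ Y 1 1 ∧ 0 ≤ Y.det := by
  have hy : Y 1 0 = Y 0 1 := hY.apply 0 1
  refine ⟨fun h => ⟨h.diag_nonneg, h.diag_nonneg, h.det_nonneg⟩, fun ⟨h0, h1, h⟩ => ?_⟩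
  refine Matrix.PosSemidef.of_dotProduct_mulVec_nonneg (by simpa using hY) fun w => ?_
  rw [Matrix.det_fin_two, hy] at h
  simp only [dotProduct, mulVec, Fin.sum_univ_two, Pi.star_apply, star_trivial, hy]
  rcases h0.eq_or_lt with h0 | h0
  · have h2 : Y 0 1 = 0 := by
      rw [← h0] at h
      nlinarith [sq_nonneg (Y 0 1)]
    rw [← h0, h2]
    nlinarith [mul_nonneg h1 (sq_nonneg (w 1))]
  · refine nonneg_of_mul_nonneg_right (a := Y 0 0) ?_ h0
    nlinarith [sq_nonneg (Y 0 0 * w 0 + Y 0 1 * w 1), mul_nonneg h (sq_nonneg (w 1))]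

theorem IsGaussianChannel.nonclassicalityBreaking_iff (hΓ : IsGaussianChannel Γ X Y) :
    NonclassicalityBreaking Γ ↔ (Y - 1).PosSemidef ∧ X.det ^ 2 ≤ (Y - 1).det := by
  have hs : (Y - 1).IsSymm := hΓ.symm.sub Matrix.isSymm_one
  rw [posSemidef_fin_two_iff hs]
  refine ⟨fun h => ?_, fun ⟨⟨h0, h1, _⟩, hd⟩ => ?_⟩
  · have h0 := hΓ.bilin_nonneg h 1
    have h1 := hΓ.bilin_nonneg h Complex.I
    have hd := hΓ.det_le h
    refine ⟨⟨by simpa [bilin] using h0, by simpa [bilin] using h1, (sq_nonneg _).trans hd⟩, hd⟩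
  · exact hΓ.nonclassicalityBreaking (by simpa using h0) (by simpa using h1) hd

theorem symplectic_iff_det_eq_one (S : Matrix (Fin 2) (Fin 2) ℝ) :
    S * symplecticForm * Sᵀ = symplecticForm ↔ S.det = 1 := by
  have e : S * symplecticForm * Sᵀ = S.det • symplecticForm := by
    ext i j
    fin_cases i <;> fin_cases j <;>
      simp [symplecticForm, Matrix.mul_apply, Fin.sum_univ_two, Matrix.det_fin_two] <;> ring
  rw [e]
  refine ⟨fun h => ?_, fun h => by rw [h, one_smul]⟩
  simpa [symplecticForm] using congrFun (congrFun h 0) 1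

theorem HasForm.det_eq (h : HasForm X Y X₀ Y₀) : X₀.det = X.det := by
  obtain ⟨S, R, hS, hR, rfl, -⟩ := h
  rw [symplectic_iff_det_eq_one] at hS
  rw [Matrix.det_mul, Matrix.det_mul, hS, (Matrix.mem_specialOrthogonalGroup_iff.mp hR).2]
  ring

theorem HasForm.exists_rotation (h : HasForm X Y X₀ Y₀) :
    ∃ R : Matrix (Fin 2) (Fin 2) ℝ, Rᵀ * R = 1 ∧ R * Rᵀ = 1 ∧ Rᵀ * Y * R = Y₀ := by
  obtain ⟨S, R, -, hR, -, rfl⟩ := h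
  have hR' := (Matrix.mem_specialOrthogonalGroup_iff.mp hR).1
  exact ⟨R, (Matrix.mem_orthogonalGroup_iff' (Fin 2) ℝ).mp hR',
    (Matrix.mem_orthogonalGroup_iff (Fin 2) ℝ).mp hR', rfl⟩

theorem posSemidef_rotation_iff {R : Matrix (Fin 2) (Fin 2) ℝ} (hR : R * Rᵀ = 1) :
    (Rᵀ * Y * R).PosSemidef ↔ Y.PosSemidef := by
  refine ⟨fun h => ?_, fun h => by simpa using h.conjTranspose_mul_mul_same R⟩
  have h := h.mul_mul_conjTranspose_same R
  rw [Matrix.conjTranspose_eq_transpose_of_trivial,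
    show R * (Rᵀ * Y * R) * Rᵀ = (R * Rᵀ) * Y * (R * Rᵀ) by simp only [Matrix.mul_assoc],
    hR, Matrix.one_mul, Matrix.mul_one] at h
  exact h

theorem det_rotation {R : Matrix (Fin 2) (Fin 2) ℝ} (hR : R * Rᵀ = 1) :
    (Rᵀ * Y * R).det = Y.det := by
  have h := congrArg Matrix.det hR
  rw [Matrix.det_mul, Matrix.det_one] at h
  rw [Matrix.det_mul, Matrix.det_mul]
  linear_combination Y.det * h

/-- A symplectic factor and a rotation both have determinant one, and a rotation carries `Y - 1` to
`Y₀ - 1`, so the criterion is constant on orbits. -/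
theorem HasForm.nonclassicalityBreaking_iff (hΓ : IsGaussianChannel Γ X Y)
    (h : HasForm X Y X₀ Y₀) :
    NonclassicalityBreaking Γ ↔ (Y₀ - 1).PosSemidef ∧ X₀.det ^ 2 ≤ (Y₀ - 1).det := by
  obtain ⟨R, hR, hR', rfl⟩ := h.exists_rotation
  have e : Rᵀ * Y * R - 1 = Rᵀ * (Y - 1) * R := by
    rw [Matrix.mul_sub, Matrix.sub_mul, Matrix.mul_one, hR]
  rw [hΓ.nonclassicalityBreaking_iff, h.det_eq, e, posSemidef_rotation_iff hR', det_rotation hR']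

theorem posSemidef_diagonal_sub_one_iff (a b : ℝ) :
    (diagonal ![a, b] - 1).PosSemidef ↔ 1 ≤ a ∧ 1 ≤ b := by
  rw [← Matrix.diagonal_one, Matrix.diagonal_sub, Matrix.posSemidef_diagonal_iff]
  simp [Fin.forall_fin_two]

theorem HasForm.nonclassicalityBreaking_iff_of_diagonal (hΓ : IsGaussianChannel Γ X Y) {a b : ℝ}
    (h : HasForm X Y X₀ (diagonal ![a, b])) :
    NonclassicalityBreaking Γ ↔ 1 ≤ a ∧ 1 ≤ b ∧ X₀.det ^ 2 ≤ (a - 1) * (b - 1) := by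
  have e : (diagonal ![a, b] - 1).det = (a - 1) * (b - 1) := by
    simp [Matrix.det_fin_two]
  rw [h.nonclassicalityBreaking_iff hΓ, posSemidef_diagonal_sub_one_iff, e, and_assoc]

theorem HasForm.uncertainty (hΓ : IsGaussianChannel Γ X Y) {a b : ℝ}
    (h : HasForm X Y X₀ (diagonal ![a, b])) :
    0 ≤ a ∧ 0 ≤ b ∧ (1 - X₀.det) ^ 2 ≤ a * b := by
  obtain ⟨R, hR, hR', e⟩ := h.exists_rotation
  obtain ⟨h0, h1, hd⟩ := hΓ.uncertainty
  have hp := (posSemidef_rotation_iff hR').mpr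
    ((posSemidef_fin_two_iff hΓ.symm).mpr ⟨h0, h1, (sq_nonneg _).trans hd⟩)
  have hdet := det_rotation (Y := Y) hR'
  rw [e] at hp hdet
  rw [Matrix.posSemidef_diagonal_iff] at hp
  refine ⟨by simpa using hp 0, by simpa using hp 1, ?_⟩
  rw [h.det_eq]
  refine hd.trans_eq ?_
  rw [← hdet]
  simp

theorem rotation_mem {c s : ℝ} (h : c ^ 2 + s ^ 2 = 1) :
    !![c, -s; s, c] ∈ Matrix.specialOrthogonalGroup (Fin 2) ℝ := by
  rw [Matrix.mem_specialOrthogonalGroup_iff, Matrix.mem_orthogonalGroup_iff]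
  constructor
  · ext i j
    fin_cases i <;> fin_cases j <;>
      simp [Matrix.mul_apply, Fin.sum_univ_two] <;> linarith
  · rw [Matrix.det_fin_two_of]
    linarith

/-- A real symmetric `2 × 2` matrix is diagonalised by a rotation. -/
theorem exists_rotation_diagonal (hY : Y.IsSymm) :
    ∃ R ∈ Matrix.specialOrthogonalGroup (Fin 2) ℝ, ∃ a b : ℝ, Rᵀ * Y * R = diagonal ![a, b] := by
  have hy : Y 1 0 = Y 0 1 := hY.apply 0 1
  -- The traceless part of `Y`, read as a complex number, turns at twice the speed of the rotation;
  -- half its argument is the diagonalising angle.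
  let z : ℂ := ⟨(Y 0 0 - Y 1 1) / 2, Y 0 1⟩
  set c := Real.cos (z.arg / 2) with hc
  set s := Real.sin (z.arg / 2) with hs
  have h1 : c ^ 2 + s ^ 2 = 1 := Real.cos_sq_add_sin_sq _
  have hre : ‖z‖ * (c ^ 2 - s ^ 2) = (Y 0 0 - Y 1 1) / 2 := by
    have h := Complex.norm_mul_cos_arg z
    rwa [show z.arg = 2 * (z.arg / 2) by ring, Real.cos_two_mul', ← hc, ← hs] at h
  have him : ‖z‖ * (2 * s * c) = Y 0 1 := by
    have h := Complex.norm_mul_sin_arg z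
    rwa [show z.arg = 2 * (z.arg / 2) by ring, Real.sin_two_mul, ← hc, ← hs] at h
  have hoff : Y 0 1 * (c ^ 2 - s ^ 2) + (Y 1 1 - Y 0 0) * (c * s) = 0 := by
    linear_combination -(c ^ 2 - s ^ 2) * him + 2 * c * s * hre
  refine ⟨!![c, -s; s, c], rotation_mem h1,
    Y 0 0 * c ^ 2 + 2 * Y 0 1 * (c * s) + Y 1 1 * s ^ 2,
    Y 0 0 * s ^ 2 - 2 * Y 0 1 * (c * s) + Y 1 1 * c ^ 2, ?_⟩
  ext i j
  fin_cases i <;> fin_cases j <;>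
    simp [Matrix.mul_apply, Fin.sum_univ_two, hy]
  · ring
  · linear_combination hoff
  · linear_combination hoff
  · ring

/-- Once `R` diagonalises `Y`, the factor `S = X₀ (X R)⁻¹` is forced, and in dimension two
determinant one is all that symplecticity asks. -/
theorem exists_hasForm_of_det_ne_zero (hY : Y.IsSymm) (hX : X.det ≠ 0)
    (hX₀ : X₀.det = X.det) : ∃ a b : ℝ, HasForm X Y X₀ (diagonal ![a, b]) := by
  obtain ⟨R, hR, a, b, h⟩ := exists_rotation_diagonal hY
  have hdet : (X * R).det = X.det := by
    rw [Matrix.det_mul, (Matrix.mem_specialOrthogonalGroup_iff.mp hR).2, mul_one]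
  have hu : IsUnit (X * R).det := by rw [hdet]; exact isUnit_iff_ne_zero.mpr hX
  refine ⟨a, b, X₀ * (X * R)⁻¹, R, (symplectic_iff_det_eq_one _).mpr ?_, hR, ?_, h⟩
  · rw [Matrix.det_mul, Matrix.det_nonsing_inv, hdet, hX₀, Ring.mul_inverse_cancel _ hX.isUnit]
  · rw [Matrix.mul_assoc, Matrix.mul_assoc, Matrix.nonsing_inv_mul _ hu, Matrix.mul_one]

theorem exists_hasForm_of_det_eq_zero (hX : X.det = 0) (hX0 : X ≠ 0) :
    ∃ Y₀ : Matrix (Fin 2) (Fin 2) ℝ, HasForm X Y (diagonal ![1, 0]) Y₀ := by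
  obtain ⟨v, hv, hXv⟩ := Matrix.exists_mulVec_eq_zero_iff.mpr hX
  have hn : 0 < v 0 ^ 2 + v 1 ^ 2 := by
    by_contra hneg
    refine hv (funext fun i => ?_)
    fin_cases i
    · change v 0 = 0
      nlinarith [sq_nonneg (v 0), sq_nonneg (v 1)]
    · change v 1 = 0
      nlinarith [sq_nonneg (v 0), sq_nonneg (v 1)]
  set n := √(v 0 ^ 2 + v 1 ^ 2) with hn'
  have hn0 : 0 < n := Real.sqrt_pos.mpr hn
  have hn2 : n ^ 2 = v 0 ^ 2 + v 1 ^ 2 := Real.sq_sqrt hn.le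
  -- The second column of the rotation is the unit kernel vector, so `X R` keeps only a nonzero
  -- first column `u`. The determinant-one matrix `S` below then sends `u` to the first basis
  -- vector.
  obtain ⟨c, hc⟩ : ∃ c, c * n = v 1 := ⟨v 1 / n, by field_simp⟩
  obtain ⟨s, hs⟩ : ∃ s, -s * n = v 0 := ⟨-(v 0 / n), by field_simp⟩
  have hcs : c ^ 2 + s ^ 2 = 1 := by
    refine mul_left_cancel₀ (pow_ne_zero 2 hn0.ne') ?_
    linear_combination (c * n + v 1) * hc + (-s * n + v 0) * hs - hn2
  have hker : ∀ i, -X i 0 * s + X i 1 * c = 0 := fun i => by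
    have h := congrFun hXv i
    simp only [mulVec, dotProduct, Fin.sum_univ_two, Pi.zero_apply] at h
    refine mul_right_cancel₀ hn0.ne' ?_
    linear_combination h + X i 0 * hs + X i 1 * hc
  set u : Fin 2 → ℝ := fun i => X i 0 * c + X i 1 * s with hu
  have hN : u 0 ^ 2 + u 1 ^ 2 ≠ 0 := by
    intro h0
    have hu0 : u = 0 := by
      ext i
      fin_cases i
      · change u 0 = 0
        nlinarith [sq_nonneg (u 0), sq_nonneg (u 1)]
      · change u 1 = 0
        nlinarith [sq_nonneg (u 0), sq_nonneg (u 1)]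
    refine hX0 (Matrix.ext fun i j => ?_)
    have h1 : X i 0 * c + X i 1 * s = 0 := congrFun hu0 i
    fin_cases j
    · change X i 0 = 0
      linear_combination c * h1 - s * hker i - X i 0 * hcs
    · change X i 1 = 0
      linear_combination s * h1 + c * hker i - X i 1 * hcs
  have hXR : X * !![c, -s; s, c] = !![u 0, 0; u 1, 0] := by
    ext i j
    fin_cases i <;> fin_cases j <;> simp [Matrix.mul_apply, Fin.sum_univ_two, hu]
    · linear_combination hker 0
    · linear_combination hker 1
  refine ⟨_, !![u 0 / (u 0 ^ 2 + u 1 ^ 2), u 1 / (u 0 ^ 2 + u 1 ^ 2); -u 1, u 0],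
    !![c, -s; s, c], (symplectic_iff_det_eq_one _).mpr ?_, rotation_mem hcs, ?_, rfl⟩
  · rw [Matrix.det_fin_two_of]
    field_simp
    ring
  · rw [Matrix.mul_assoc, hXR]
    ext i j
    fin_cases i <;> fin_cases j <;> simp [Matrix.mul_apply, Fin.sum_univ_two]
    · field_simp
    · ring

theorem posSemidef_sub_one_iff_eigenvalue (hY : Y.IsSymm) : (Y - 1).PosSemidef ↔
    ∀ μ : ℝ, Module.End.HasEigenvalue (Matrix.toLin' Y) μ → 1 ≤ μ := by
  constructor
  · intro h μ hμ
    obtain ⟨v, hv⟩ := hμ.exists_hasEigenvector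
    have hYv : Y *ᵥ v = μ • v := by simpa using hv.apply_eq_smul
    have h1 := h.dotProduct_mulVec_nonneg v
    rw [Matrix.sub_mulVec, hYv, Matrix.one_mulVec, dotProduct_sub, dotProduct_smul, smul_eq_mul,
      star_trivial] at h1
    have h2 : 0 < v ⬝ᵥ v := by simpa using Matrix.dotProduct_star_self_pos_iff.mpr hv.2
    nlinarith
  · intro h
    obtain ⟨R, hR, a, b, hd⟩ := exists_rotation_diagonal hY
    have hO := (Matrix.mem_specialOrthogonalGroup_iff.mp hR).1
    have h1 : Rᵀ * R = 1 := (Matrix.mem_orthogonalGroup_iff' (Fin 2) ℝ).mp hO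
    have h2 : R * Rᵀ = 1 := (Matrix.mem_orthogonalGroup_iff (Fin 2) ℝ).mp hO
    have hYR : Y * R = R * diagonal ![a, b] := by
      rw [← hd, ← Matrix.mul_assoc, ← Matrix.mul_assoc, h2, Matrix.one_mul]
    have key : ∀ i, 1 ≤ ![a, b] i := fun i => by
      refine h _ (Module.End.hasEigenvalue_of_hasEigenvector (x := R *ᵥ Pi.single i 1)
        ⟨Module.End.mem_eigenspace_iff.mpr ?_, fun h0 => ?_⟩)
      · rw [Matrix.toLin'_apply, Matrix.mulVec_mulVec, hYR, ← Matrix.mulVec_mulVec,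
          Matrix.diagonal_mulVec_single, mul_one, ← Matrix.mulVec_smul, ← Pi.single_smul,
          smul_eq_mul, mul_one]
      · have h3 := congrArg (fun w => (Rᵀ *ᵥ w) i) h0
        simp only [Matrix.mulVec_mulVec, h1, Matrix.one_mulVec, Matrix.mulVec_zero,
          Pi.single_eq_same, Pi.zero_apply, one_ne_zero] at h3
    have e : Rᵀ * (Y - 1) * R = diagonal ![a, b] - 1 := by
      rw [Matrix.mul_sub, Matrix.sub_mul, Matrix.mul_one, h1, hd]
    rw [← posSemidef_rotation_iff h2, e, posSemidef_diagonal_sub_one_iff]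
    exact ⟨key 0, key 1⟩

/-- The harmonic form of the nonclassicality-breaking criterion. -/
theorem harmonic_criterion {κ a b : ℝ} (hκ : 0 < κ) :
    (0 < a + κ ^ 2 - 1 ∧ 0 < b + κ ^ 2 - 1 ∧
      1 / (a + κ ^ 2 - 1) + 1 / (b + κ ^ 2 - 1) ≤ 1 / κ ^ 2) ↔
    1 < a ∧ 1 < b ∧ κ ^ 4 ≤ (a - 1) * (b - 1) := by
  have hk : 0 < κ ^ 2 := by positivity
  -- With `p = a + κ² - 1` and `q = b + κ² - 1`, `(p - κ²) (q - κ²) ≥ κ⁴` is the same as `κ² (p + q)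
  -- ≤ p q`; positivity of `p`, `q` then forces each to exceed `κ²`.
  have key : ∀ {p q : ℝ}, 0 < p → 0 < q →
      (1 / p + 1 / q ≤ 1 / κ ^ 2 ↔ κ ^ 2 * (p + q) ≤ p * q) := fun {p q} hp hq => by
    rw [div_add_div _ _ hp.ne' hq.ne', div_le_div_iff₀ (mul_pos hp hq) hk]
    constructor <;> intro h <;> linarith
  constructor
  · rintro ⟨ha, hb, h⟩
    rw [key ha hb] at h
    refine ⟨?_, ?_, by nlinarith⟩
    · by_contra hneg
      nlinarith [mul_pos hk ha, mul_nonneg (sub_nonneg.mpr (not_lt.mp hneg)) hb.le]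
    · by_contra hneg
      nlinarith [mul_pos hk hb, mul_nonneg (sub_nonneg.mpr (not_lt.mp hneg)) ha.le]
  · rintro ⟨ha, hb, h⟩
    have ha' : 0 < a + κ ^ 2 - 1 := by linarith
    have hb' : 0 < b + κ ^ 2 - 1 := by linarith
    exact ⟨ha', hb', (key ha' hb').mpr (by nlinarith)⟩

theorem one_lt_iff_of_pos {k a b : ℝ} (hk : 0 < k) :
    (1 ≤ a ∧ 1 ≤ b ∧ k ≤ (a - 1) * (b - 1)) ↔ (1 < a ∧ 1 < b ∧ k ≤ (a - 1) * (b - 1)) := by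
  refine ⟨fun ⟨ha, hb, h⟩ => ⟨ha.lt_of_ne ?_, hb.lt_of_ne ?_, h⟩,
    fun ⟨ha, hb, h⟩ => ⟨ha.le, hb.le, h⟩⟩
  · rintro rfl
    linarith
  · rintro rfl
    linarith

/-- Under the uncertainty relation, the determinant inequality alone implies `1 < a` and `1 < b`,
except for pure loss. -/
theorem one_lt_of_uncertainty {d a b : ℝ} (hd : d ≠ 0) (ha : 0 ≤ a) (hb : 0 ≤ b)
    (hu : (1 - d) ^ 2 ≤ a * b) (h : d ^ 2 ≤ (a - 1) * (b - 1))
    (hne : 0 < d → ¬ (a = 1 - d ∧ b = 1 - d)) : 1 < a ∧ 1 < b := by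
  have hd2 : 0 < d ^ 2 := by positivity
  have hpos : 0 < (a - 1) * (b - 1) := hd2.trans_le h
  rcases pos_and_pos_or_neg_and_neg_of_mul_pos hpos with ⟨h1, h2⟩ | ⟨h1, h2⟩
  · exact ⟨by linarith, by linarith⟩
  · exfalso
    -- If `a, b < 1`, then `(1 - r)² ≥ (1 - a) (1 - b) ≥ d²` gives `r ≤ 1 - |d|`, whereas the
    -- uncertainty relation gives `r ≥ 1 - d`. Hence `d > 0` and equality holds throughout,
    -- including `a + b = 2 r`, so `a = b = 1 - d`.
    set r := √(a * b) with hr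
    have hr0 : 0 ≤ r := Real.sqrt_nonneg _
    have hr2 : r ^ 2 = a * b := Real.sq_sqrt (mul_nonneg ha hb)
    have hab : 2 * r ≤ a + b := by
      refine abs_le_of_sq_le_sq' ?_ (add_nonneg ha hb) |>.2
      nlinarith [sq_nonneg (a - b)]
    have hr1 : r ≤ 1 - |d| := by
      have h3 : |d| ≤ 1 - r := by
        refine abs_le_of_sq_le_sq (by nlinarith) (by linarith)
      linarith
    have hr3 : 1 - d ≤ r := (abs_le_of_sq_le_sq' (by linarith) hr0).2
    have hdabs : d = |d| := le_antisymm (le_abs_self d) (by linarith)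
    have hdpos : 0 < d := by rw [hdabs]; exact abs_pos.mpr hd
    have hrd : r = 1 - d := le_antisymm (by linarith) hr3
    have hsum : a + b = 2 * r := le_antisymm (by nlinarith) hab
    have hdiff : a - b = 0 := by
      refine pow_eq_zero_iff two_ne_zero |>.mp ?_
      linear_combination (a + b + 2 * r) * hsum + 4 * hr2
    exact hne hdpos ⟨by linarith, by linarith⟩

end CanonicalForms

end SingleMode

/-! ### The theorem -/

theorem mainTheorem2 (Γ : traceClass →ₗ[ℂ] traceClass) (X Y : Matrix (Fin 2) (Fin 2) ℝ)
    (hΓ : IsGaussianChannel Γ X Y) :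
    -- every Gaussian channel has one of the canonical forms, according to `det X`
    (0 < X.det → ∃ κ a b : ℝ, 0 < κ ∧
      HasForm X Y (κ • (1 : Matrix (Fin 2) (Fin 2) ℝ)) (diagonal ![a, b])) ∧
    (X.det < 0 → ∃ κ a b : ℝ, 0 < κ ∧ HasForm X Y (κ • sigma3) (diagonal ![a, b])) ∧
    (X.det = 0 → X ≠ 0 → ∃ Y₀ : Matrix (Fin 2) (Fin 2) ℝ,
      HasForm X Y (diagonal ![1, 0]) Y₀) ∧
    (X = 0 → ∃ a b : ℝ, HasForm X Y 0 (diagonal ![a, b])) ∧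
    -- first canonical form
    (∀ κ a b : ℝ, 0 < κ →
      HasForm X Y (κ • (1 : Matrix (Fin 2) (Fin 2) ℝ)) (diagonal ![a, b]) →
      (NonclassicalityBreaking Γ ↔ 1 < a ∧ 1 < b ∧ κ ^ 4 ≤ (a - 1) * (b - 1)) ∧
      (NonclassicalityBreaking Γ ↔
        0 < a + κ ^ 2 - 1 ∧ 0 < b + κ ^ 2 - 1 ∧
          1 / (a + κ ^ 2 - 1) + 1 / (b + κ ^ 2 - 1) ≤ 1 / κ ^ 2) ∧
      (¬ (a = 1 - κ ^ 2 ∧ b = 1 - κ ^ 2) →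
        (NonclassicalityBreaking Γ ↔ κ ^ 4 ≤ (a - 1) * (b - 1)))) ∧
    -- second canonical form
    (∀ κ a b : ℝ, 0 < κ → HasForm X Y (κ • sigma3) (diagonal ![a, b]) →
      (NonclassicalityBreaking Γ ↔ κ ^ 4 ≤ (a - 1) * (b - 1)) ∧
      (NonclassicalityBreaking Γ ↔
        0 < a + κ ^ 2 - 1 ∧ 0 < b + κ ^ 2 - 1 ∧
          1 / (a + κ ^ 2 - 1) + 1 / (b + κ ^ 2 - 1) ≤ 1 / κ ^ 2)) ∧
    -- third canonical form, singular `X ≠ 0`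
    (∀ Y₀ : Matrix (Fin 2) (Fin 2) ℝ, HasForm X Y (diagonal ![1, 0]) Y₀ →
      (NonclassicalityBreaking Γ ↔ (Y₀ - 1).PosSemidef) ∧
      (NonclassicalityBreaking Γ ↔
        ∀ μ : ℝ, Module.End.HasEigenvalue (Matrix.toLin' Y) μ → 1 ≤ μ)) ∧
    -- third canonical form, `X = 0`
    (∀ a b : ℝ, HasForm X Y 0 (diagonal ![a, b]) →
      (NonclassicalityBreaking Γ ↔ 1 ≤ a ∧ 1 ≤ b)) := by
  have hdet1 : ∀ κ : ℝ, (κ • (1 : Matrix (Fin 2) (Fin 2) ℝ)).det = κ ^ 2 := fun κ => by simp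
  have hdet3 : ∀ κ : ℝ, (κ • sigma3).det = -κ ^ 2 := fun κ => by
    simp [sigma3]
  refine ⟨fun hX => ?_, fun hX => ?_, exists_hasForm_of_det_eq_zero, fun hX => ?_,
    fun κ a b hκ h => ?_, fun κ a b hκ h => ?_, fun Y₀ h => ?_, fun a b h => ?_⟩
  · obtain ⟨a, b, h⟩ := exists_hasForm_of_det_ne_zero hΓ.symm hX.ne'
      ((hdet1 √X.det).trans (Real.sq_sqrt hX.le))
    exact ⟨_, a, b, Real.sqrt_pos.mpr hX, h⟩
  · have hX' : 0 < -X.det := neg_pos.mpr hX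
    obtain ⟨a, b, h⟩ := exists_hasForm_of_det_ne_zero hΓ.symm hX.ne
      ((hdet3 √(-X.det)).trans (by rw [Real.sq_sqrt hX'.le, neg_neg]))
    exact ⟨_, a, b, Real.sqrt_pos.mpr hX', h⟩
  · obtain ⟨R, hR, a, b, h⟩ := exists_rotation_diagonal hΓ.symm
    exact ⟨a, b, 1, R, (symplectic_iff_det_eq_one _).mpr Matrix.det_one, hR, by simp [hX], h⟩
  · have hiff := h.nonclassicalityBreaking_iff_of_diagonal hΓ
    obtain ⟨ha, hb, hu⟩ := h.uncertainty hΓ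
    rw [hdet1] at hiff hu
    rw [show (κ ^ 2) ^ 2 = κ ^ 4 by ring, one_lt_iff_of_pos (by positivity)] at hiff
    refine ⟨hiff, hiff.trans (harmonic_criterion hκ).symm, fun hne => hiff.trans
      ⟨fun h => h.2.2, fun h1 => ?_⟩⟩
    obtain ⟨h2, h3⟩ := one_lt_of_uncertainty (pow_pos hκ 2).ne' ha hb hu (by linarith) fun _ => hne
    exact ⟨h2, h3, h1⟩
  · have hiff := h.nonclassicalityBreaking_iff_of_diagonal hΓ
    obtain ⟨ha, hb, hu⟩ := h.uncertainty hΓ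
    rw [hdet3] at hiff hu
    rw [show (-κ ^ 2) ^ 2 = κ ^ 4 by ring, one_lt_iff_of_pos (by positivity)] at hiff
    refine ⟨hiff.trans ⟨fun h => h.2.2, fun h1 => ?_⟩, hiff.trans (harmonic_criterion hκ).symm⟩
    have hk : 0 < κ ^ 2 := pow_pos hκ 2
    -- Here `d = -κ²` is negative, so the pure-loss exception cannot occur.
    obtain ⟨h2, h3⟩ := one_lt_of_uncertainty (neg_ne_zero.mpr hk.ne') ha hb hu
      (by linarith) fun h => absurd h (by linarith)
    exact ⟨h2, h3, h1⟩
  · have hiff := h.nonclassicalityBreaking_iff hΓ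
    have hX : (diagonal ![(1 : ℝ), 0]).det = 0 := by simp
    have hX' : X.det = 0 := by rw [← h.det_eq, hX]
    refine ⟨hiff.trans ⟨fun h => h.1, fun h => ⟨h, ?_⟩⟩, ?_⟩
    -- For singular `X` the determinant condition reads `0 ≤ det (Y₀ - 1)`, already part of
    -- positivity.
    · rw [hX]
      simpa using h.det_nonneg
    · rw [← posSemidef_sub_one_iff_eigenvalue hΓ.symm, hΓ.nonclassicalityBreaking_iff, hX']
      exact ⟨fun h => h.1, fun h => ⟨h, by simpa using h.det_nonneg⟩⟩
  · rw [h.nonclassicalityBreaking_iff_of_diagonal hΓ]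
    refine ⟨fun h => ⟨h.1, h.2.1⟩, fun h => ⟨h.1, h.2, ?_⟩⟩
    simpa using mul_nonneg (sub_nonneg.mpr h.1) (sub_nonneg.mpr h.2)
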